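/- Conventions. Manifolds are smooth, Hausdorff, second countable and without boundary. Let $(M,g)$ be a Riemannian manifold of dimension $n$, and let $\alpha$ be a smooth $q$-form on $M$ which is a semi-calibration, i.e. $\alpha(e_1,\dots,e_q)\le 1$ for all orthonormal $e_1,\dots,e_q\in T_xM$, $x\in M$ (closedness of $\alpha$ is not assumed). Let $H\subseteq TM$ be a smooth distribution of rank $q$ calibrated by $\alpha$: each $H_x$ has an orthonormal basis with $\alpha(e_1,\dots,e_q)=1$. Orient $H$ by $\alpha$. Let $V=H^\perp$, with orthogonal projections $p_H,p_V$, and let $\alpha=\sum_{i=0}^q\alpha_i$ with $\alpha_i\in\Gamma(\Lambda^{q-i}H^*\otimes\Lambda^iV^*)$ (so $\alpha_2=0$ if $q<2$). An oriented $q$-plane $\pi\subseteq T_xM$ is positive horizontally projectable if $p_H|_\pi:\pi\to H_x$ is an orientation preserving isomorphism. For such $\pi$ let $g^H_\pi=g(p_H\cdot,p_H\cdot)|_\pi$, let $\mathrm{vol}^H_\pi$ and $\mathrm{vol}_\pi$ be the volume forms of $\pi$ for $g^H_\pi$ and $g|_\pi$, and set $$ve(\pi)=\tfrac12\big|p_V|_\pi\big|^2_{g^H_\pi\otimes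 g},\qquad f(\pi)=ve(\pi)\,\frac{\mathrm{vol}^H_\pi}{\mathrm{vol}_\pi}.$$ Let $\Sigma$ be a compact oriented $q$-manifold, and let $\mathcal{HPI}^+$ be the set of smooth immersions $\iota:\Sigma\to M$ such that every $\iota_*(T_\sigma\Sigma)$ is positive horizontally projectable. Call $\iota\in\mathcal{HPI}^+$ $f$-calibrated if $\alpha_2|_\pi=f(\pi)\,\mathrm{vol}_\pi$ for each $\pi=\iota_*(T_\sigma\Sigma)$. The vertical energy of $\iota\in\mathcal{HPI}^+$ is $$VE(\iota)=\int_\Sigma ve(\iota)\,\mathrm{vol}^H_\iota,$$ where $ve(\iota)(\sigma)=ve(\iota_*(T_\sigma\Sigma))$ and $\mathrm{vol}^H_\iota$ is the volume form on $\Sigma$ of the metric $g(p_H\iota_*\cdot,p_H\iota_*\cdot)$. Let $R$ be a commutative ring with a ring homomorphism $R\to\mathbb{R}$ (for example $R=\mathbb{Z}$ or $R=\mathbb{R}$). Two smooth maps $\iota,\iota':\Sigma\to M$ are homologous if $\iota_*[\Sigma]=\iota'_*[\Sigma]$ in the (smooth) singular homology $H_q(M;R)$. We say that $\iota\in\mathcal{HPI}^+$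 minimizes $VE$ in its restricted homology class if $VE(\iota)\le VE(\iota')$ for all $\iota'\in\mathcal{HPI}^+$ homologous to $\iota$. Corollary. (1) If $d\alpha_2=0$, then every $f$-calibrated immersion $\iota:\Sigma\to M$ of a compact oriented $q$-manifold minimizes $VE$ in its restricted homology class. (2) Let $M$ be a $7$-manifold with a $G_2$-structure $\varphi$, i.e. a smooth $3$-form which at each point is identified, by a linear isomorphism $T_xM\cong\mathbb{R}^7$, with $\varphi_0=dx_{123}+dx_{145}+dx_{167}+dx_{246}-dx_{257}-dx_{347}-dx_{356}$, and let $g$ be the induced metric, obtained from the Euclidean one by the same isomorphisms. Let $H$ be an associative distribution (a smooth distribution of rank $3$ calibrated by $\varphi$), let $\underline\omega=\varphi_2$ be the component of $\varphi$ in $\Gamma(H^*\otimes\Lambda^2V^*)$, and define the cross product by $g(u\times v,w)=\varphi(u,v,w)$. Let $\iota:\Sigma\to M$ be a Fueter immersion of a compact oriented $3$-manifold: $\iota\in\mathcal{HPI}^+$ (where $\alpha=\varphi$) and, for each $\pi=\iota_*(T_\sigma\Sigma)$ and each positive $g^H_\pi$-orthonormal basis $v_1,v_2,v_3$ of $\pi$,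 $\sum_{i=1}^3p_H(v_i)\times p_V(v_i)=0$. If $d\underline\omega=0$, then $\iota$ minimizes $VE$ in its restricted homology class. -/

import Mathlib

open Module Bundle
open scoped Manifold ContDiff Topology Bundle

noncomputable section

namespace VerticalEnergy

/-! ### Differential forms on a manifold

All manifolds are smooth, without boundary, and modelled on `EuclideanSpace ℝ (Fin n)`. -/

section Forms

variable {n : ℕ} {M : Type*} [TopologicalSpace M] [ChartedSpace (EuclideanSpace ℝ (Fin n)) M]

/-- A (not necessarily smooth) differential `k`-form on the `n`-manifold `M`. -/
abbrev DForm (n k : ℕ) (M : Type*) [TopologicalSpace M]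
    [ChartedSpace (EuclideanSpace ℝ (Fin n)) M] : Type _ :=
  ∀ x : M, (TangentSpace (𝓡 n) x) [⋀^Fin k]→L[ℝ] ℝ

/-- The expression of the form `α` in the preferred chart at `x₀`: the pullback of `α` under the
inverse of the chart. It is meaningful on the target of the chart. -/
def DForm.inChart {k : ℕ} (α : DForm n k M) (x₀ : M) (y : EuclideanSpace ℝ (Fin n)) :
    (EuclideanSpace ℝ (Fin n)) [⋀^Fin k]→L[ℝ] ℝ :=
  (α ((chartAt (EuclideanSpace ℝ (Fin n)) x₀).symm y)).compContinuousLinearMap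
    (mfderiv (𝓡 n) (𝓡 n) (chartAt (EuclideanSpace ℝ (Fin n)) x₀).symm y)

/-- The form `α` is smooth: its expression in every preferred chart is smooth. -/
def DForm.IsSmooth {k : ℕ} (α : DForm n k M) : Prop :=
  ∀ x₀ : M, ContDiffOn ℝ ∞ (α.inChart x₀) (chartAt (EuclideanSpace ℝ (Fin n)) x₀).target

/-- The exterior derivative `dα` of a differential form, computed at `x` in the preferred chart
at `x`. -/
def DForm.d {k : ℕ} (α : DForm n k M) : DForm n (k + 1) M := fun x =>
  (extDeriv (α.inChart x) (chartAt (EuclideanSpace ℝ (Fin n)) x x)).compContinuousLinearMap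
    (mfderiv (𝓡 n) (𝓡 n) (chartAt (EuclideanSpace ℝ (Fin n)) x) x)

end Forms

/-! ### Orientations and integration -/

section Orientation

variable {q : ℕ} {S : Type*} [TopologicalSpace S] [ChartedSpace (EuclideanSpace ℝ (Fin q)) S]

/-- The tuple `v` is a positively oriented basis of the oriented vector space `(T, o)`. -/
def IsPositiveFrame {T : Type*} [AddCommGroup T] [Module ℝ T] (o : Orientation ℝ T (Fin q))
    (v : Fin q → T) : Prop :=
  ∃ b : Basis (Fin q) ℝ T, ⇑b = v ∧ b.orientation = o

/-- The coordinate frame `∂/∂y₁, …, ∂/∂y_q` of the preferred chart at `x₀`, at the point with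
coordinates `y`. -/
def chartFrame (x₀ : S) (y : EuclideanSpace ℝ (Fin q)) :
    Fin q → TangentSpace (𝓡 q) ((chartAt (EuclideanSpace ℝ (Fin q)) x₀).symm y) := fun i =>
  mfderiv (𝓡 q) (𝓡 q) (chartAt (EuclideanSpace ℝ (Fin q)) x₀).symm y
    (EuclideanSpace.single i (1 : ℝ))

/-- An orientation of the `q`-manifold `S`: a choice of an orientation of every tangent space
which is continuous, i.e. near every point the coordinate frame of a chart is
everywhere positive or everywhere negative. -/
structure ManifoldOrientation (q : ℕ) (S : Type*) [TopologicalSpace S]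
    [ChartedSpace (EuclideanSpace ℝ (Fin q)) S] where
  orient : ∀ x : S, Orientation ℝ (TangentSpace (𝓡 q) x) (Fin q)
  continuous_orient : ∀ x₀ : S,
    (∀ᶠ y in 𝓝 (chartAt (EuclideanSpace ℝ (Fin q)) x₀ x₀),
      IsPositiveFrame (orient ((chartAt (EuclideanSpace ℝ (Fin q)) x₀).symm y))
        (chartFrame x₀ y)) ∨
    (∀ᶠ y in 𝓝 (chartAt (EuclideanSpace ℝ (Fin q)) x₀ x₀),
      IsPositiveFrame (-orient ((chartAt (EuclideanSpace ℝ (Fin q)) x₀).symm y))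
        (chartFrame x₀ y))

/-- A smooth partition of unity of `S` subordinate to the domains of the preferred charts. -/
def chartPartition (S : Type*) [TopologicalSpace S] [ChartedSpace (EuclideanSpace ℝ (Fin q)) S]
    [IsManifold (𝓡 q) ∞ S] [T2Space S] [CompactSpace S] :
    SmoothPartitionOfUnity S (𝓡 q) S Set.univ :=
  (SmoothPartitionOfUnity.exists_isSubordinate_chartAt_source (𝓡 q) S).choose

/-- The integral over the compact manifold `S` of a density `δ`, i.e. of a function of the `q`-frames
of `S` which is multiplied by `|det A|` under the change of frame `A`. The density of
a volume form that is positive for an orientation takes on *any* frame the absolute value of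
the form, and its integral is the integral of that volume form over the oriented manifold. -/
def integralDensity [IsManifold (𝓡 q) ∞ S] [T2Space S] [CompactSpace S]
    (δ : ∀ x : S, (Fin q → TangentSpace (𝓡 q) x) → ℝ) : ℝ :=
  ∑ᶠ x₀ : S, ∫ y in (chartAt (EuclideanSpace ℝ (Fin q)) x₀).target,
    chartPartition (q := q) S x₀ ((chartAt (EuclideanSpace ℝ (Fin q)) x₀).symm y) *
      δ ((chartAt (EuclideanSpace ℝ (Fin q)) x₀).symm y) (chartFrame x₀ y)

end Orientation

/-! ### Smooth singular homology -/

section Homology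

variable {n q : ℕ} {M : Type*} [TopologicalSpace M] [ChartedSpace (EuclideanSpace ℝ (Fin n)) M]
  {S : Type*} [TopologicalSpace S] [ChartedSpace (EuclideanSpace ℝ (Fin q)) S]

/-- A smooth singular `k`-simplex of the `n`-manifold `M`: a map from the standard simplex (in
barycentric coordinates) to `M` that extends to a smooth map on a neighbourhood of the simplex. -/
@[ext]
structure SmoothSimplex (n k : ℕ) (M : Type*) [TopologicalSpace M]
    [ChartedSpace (EuclideanSpace ℝ (Fin n)) M] where
  toFun : stdSimplex ℝ (Fin (k + 1)) → M
  exists_extension : ∃ (U : Set (Fin (k + 1) → ℝ)) (F : (Fin (k + 1) → ℝ) → M),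
    IsOpen U ∧ stdSimplex ℝ (Fin (k + 1)) ⊆ U ∧
    ContMDiffOn 𝓘(ℝ, Fin (k + 1) → ℝ) (𝓡 n) ∞ F U ∧
    ∀ t : stdSimplex ℝ (Fin (k + 1)), F t = toFun t

/-- The `i`-th face of a smooth singular simplex. -/
def SmoothSimplex.face {k : ℕ} (τ : SmoothSimplex n (k + 1) M) (i : Fin (k + 2)) :
    SmoothSimplex n k M where
  toFun t := τ.toFun (stdSimplex.map i.succAbove t)
  exists_extension := by
    obtain ⟨U, F, hU, hsub, hF, hFτ⟩ := τ.exists_extension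
    let L : (Fin (k + 1) → ℝ) →L[ℝ] (Fin (k + 2) → ℝ) :=
      LinearMap.toContinuousLinearMap (FunOnFinite.linearMap ℝ ℝ i.succAbove)
    have hL : ∀ t : stdSimplex ℝ (Fin (k + 1)),
        L (t : Fin (k + 1) → ℝ) = (stdSimplex.map i.succAbove t : Fin (k + 2) → ℝ) :=
      fun t => rfl
    refine ⟨L ⁻¹' U, F ∘ L, hU.preimage L.continuous, ?_, ?_, ?_⟩
    · intro t ht
      have := hL ⟨t, ht⟩
      change L t ∈ U
      rw [show L t = _ from this]
      exact hsub (stdSimplex.map i.succAbove ⟨t, ht⟩).2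
    · exact hF.comp L.contMDiff.contMDiffOn (fun _ h => h)
    · intro t
      change F (L t) = _
      rw [hL t, hFτ]

/-- The image of a smooth singular simplex under a smooth map. -/
def SmoothSimplex.push {k : ℕ} (ι : C^∞⟮𝓡 q, S; 𝓡 n, M⟯) (τ : SmoothSimplex q k S) :
    SmoothSimplex n k M where
  toFun t := ι (τ.toFun t)
  exists_extension := by
    obtain ⟨U, F, hU, hsub, hF, hFτ⟩ := τ.exists_extension
    exact ⟨U, ι ∘ F, hU, hsub, ι.contMDiff.comp_contMDiffOn hF, fun t => congrArg ι (hFτ t)⟩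

variable (R : Type*) [CommRing R]

/-- Smooth singular `k`-chains of the `n`-manifold `M` with coefficients in `R`. -/
abbrev Chain (n k : ℕ) (M : Type*) [TopologicalSpace M]
    [ChartedSpace (EuclideanSpace ℝ (Fin n)) M] : Type _ :=
  SmoothSimplex n k M →₀ R

/-- The singular boundary operator `∂`. -/
def boundary {k : ℕ} : Chain R n (k + 1) M →ₗ[R] Chain R n k M :=
  Finsupp.linearCombination R fun τ : SmoothSimplex n (k + 1) M =>
    ∑ i : Fin (k + 2), Finsupp.single (τ.face i) ((-1 : R) ^ (i : ℕ))

/-- The chain `c` is a cycle: `∂c = 0` (no condition in degree `0`). -/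
def IsCycle : {k : ℕ} → Chain R n k M → Prop
  | 0, _ => True
  | _ + 1, c => boundary R c = 0

/-- The map induced on chains by a smooth map. -/
def pushChain {k : ℕ} (ι : C^∞⟮𝓡 q, S; 𝓡 n, M⟯) : Chain R q k S →ₗ[R] Chain R n k M :=
  Finsupp.lmapDomain R R (SmoothSimplex.push ι)

/-- The simplex `τ` of the oriented `q`-manifold `S` is an orientation preserving embedding of the
standard `q`-simplex, and `x` is the image of one of its interior points. The standard simplex is
oriented by its edges `e₁ - e₀, …, e_q - e₀`. -/
def IsPositiveSimplexAround (o : ManifoldOrientation q S) (τ : SmoothSimplex q q S) (x : S) :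
    Prop :=
  Function.Injective τ.toFun ∧
  (∃ t : stdSimplex ℝ (Fin (q + 1)), (∀ i, 0 < (t : Fin (q + 1) → ℝ) i) ∧ τ.toFun t = x) ∧
  ∃ (U : Set (Fin (q + 1) → ℝ)) (F : (Fin (q + 1) → ℝ) → S),
    IsOpen U ∧ stdSimplex ℝ (Fin (q + 1)) ⊆ U ∧
    ContMDiffOn 𝓘(ℝ, Fin (q + 1) → ℝ) (𝓡 q) ∞ F U ∧
    (∀ t : stdSimplex ℝ (Fin (q + 1)), F t = τ.toFun t) ∧
    ∀ t ∈ stdSimplex ℝ (Fin (q + 1)),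
      IsPositiveFrame (o.orient (F t)) (fun i : Fin q =>
        mfderiv 𝓘(ℝ, Fin (q + 1) → ℝ) (𝓡 q) F t
          (Pi.single i.succ (1 : ℝ) - Pi.single 0 (1 : ℝ) : Fin (q + 1) → ℝ))

/-- The cycle `c` represents the fundamental class of the oriented `q`-manifold `S`: for every `x`,
its class in the relative homology `H_q(S, S ∖ {x})` is the generator given by the orientation,
i.e. the class of a positively oriented embedded simplex with `x` in its interior. -/
def IsFundamentalCycle (o : ManifoldOrientation q S) (c : Chain R q q S) : Prop :=
  IsCycle R c ∧
  ∀ x : S, ∃ τ : SmoothSimplex q q S, IsPositiveSimplexAround o τ x ∧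
    ∃ (a : Chain R q q S) (b : Chain R q (q + 1) S),
      (∀ σ ∈ a.support, x ∉ Set.range σ.toFun) ∧
      c = Finsupp.single τ 1 + a + boundary R b

/-- The smooth maps `ι` and `ι'` from the compact oriented manifold `S` to `M` are homologous:
`ι_*[S] = ι'_*[S]` in `H_q(M; R)`, where `[S]` is the fundamental class of `S`. (The class of a
fundamental cycle does not depend on its choice.) -/
def Homologous (o : ManifoldOrientation q S) (ι ι' : C^∞⟮𝓡 q, S; 𝓡 n, M⟯) : Prop :=
  ∃ c : Chain R q q S, IsFundamentalCycle R o c ∧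
    ∃ b : Chain R n (q + 1) M, pushChain R ι c - pushChain R ι' c = boundary R b

/-- The map `ι` belongs to the class `U` of maps and minimizes the functional `F` in its restricted
homology class, i.e. among all the maps of the class `U` that are homologous to `ι`. -/
def MinimizesInRestrictedClass (o : ManifoldOrientation q S)
    (U : C^∞⟮𝓡 q, S; 𝓡 n, M⟯ → Prop) (F : C^∞⟮𝓡 q, S; 𝓡 n, M⟯ → ℝ)
    (ι : C^∞⟮𝓡 q, S; 𝓡 n, M⟯) : Prop :=
  U ι ∧ ∀ ι', U ι' → Homologous R o ι ι' → F ι ≤ F ι'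

end Homology

/-! ### Distributions on a Riemannian manifold -/

section Distribution

variable {n q : ℕ} {M : Type*} [TopologicalSpace M] [ChartedSpace (EuclideanSpace ℝ (Fin n)) M]

/-- A smooth distribution of rank `q` on the `n`-manifold `M`: a family of `q`-dimensional subspaces
of the tangent spaces which is locally spanned by `q` smooth vector fields. -/
structure SmoothDistribution (n q : ℕ) (M : Type*) [TopologicalSpace M]
    [ChartedSpace (EuclideanSpace ℝ (Fin n)) M] [IsManifold (𝓡 n) ∞ M] where
  fiber : ∀ x : M, Submodule ℝ (TangentSpace (𝓡 n) x)
  finrank_fiber : ∀ x, finrank ℝ (fiber x) = q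
  exists_frame : ∀ x₀ : M, ∃ U ∈ 𝓝 x₀, ∃ X : Fin q → ∀ x : M, TangentSpace (𝓡 n) x,
    (∀ i, ContMDiffOn (𝓡 n) (𝓡 n).tangent ∞
      (fun x => (⟨x, X i x⟩ : TangentBundle (𝓡 n) M)) U) ∧
    ∀ x ∈ U, fiber x = Submodule.span ℝ (Set.range fun i => X i x)

instance (x : M) : FiniteDimensional ℝ (TangentSpace (𝓡 n) x) :=
  inferInstanceAs (FiniteDimensional ℝ (EuclideanSpace ℝ (Fin n)))

variable [IsManifold (𝓡 n) ∞ M] [RiemannianBundle (fun x : M => TangentSpace (𝓡 n) x)]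

/-- The orthogonal projection `p_H` to the distribution. -/
def SmoothDistribution.pH (H : SmoothDistribution n q M) (x : M) :
    TangentSpace (𝓡 n) x →L[ℝ] TangentSpace (𝓡 n) x :=
  (H.fiber x).starProjection

/-- The orthogonal projection `p_V` to the orthogonal complement `V` of the distribution. -/
def SmoothDistribution.pV (H : SmoothDistribution n q M) (x : M) :
    TangentSpace (𝓡 n) x →L[ℝ] TangentSpace (𝓡 n) x :=
  (H.fiber x)ᗮ.starProjection

/-- The form `α` is a semi-calibration: `α|_π ≤ vol_π` for all oriented planes `π`. -/
def IsSemiCalibration (α : DForm n q M) : Prop :=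
  ∀ (x : M) (e : Fin q → TangentSpace (𝓡 n) x), Orthonormal ℝ e → α x e ≤ 1

/-- The distribution `H` is calibrated by `α`: each `H_x` has an orientation (the one
for which the frame `e` is positive) such that `α|_{H_x} = vol_{H_x}`. -/
def SmoothDistribution.IsCalibratedBy (H : SmoothDistribution n q M) (α : DForm n q M) : Prop :=
  ∀ x : M, ∃ e : Fin q → TangentSpace (𝓡 n) x,
    Orthonormal ℝ e ∧ Submodule.span ℝ (Set.range e) = H.fiber x ∧ α x e = 1

/-- The component `α_p ∈ Γ(Λ^{q-p} H^* ⊗ Λ^p V^*)` of the `q`-form `α`: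
`α_p(v_1, …, v_q)` is the sum, over all choices of `p` of the `q` entries, of the value
of `α` on the tuple obtained by applying `p_V` to the chosen entries and `p_H` to the others. -/
def DForm.component (α : DForm n q M) (H : SmoothDistribution n q M) (p : ℕ) : DForm n q M := fun x =>
  { toContinuousMultilinearMap :=
      ∑ s ∈ Finset.powersetCard p (Finset.univ : Finset (Fin q)),
        (α x).toContinuousMultilinearMap.compContinuousLinearMap
          (fun j => if j ∈ s then H.pV x else H.pH x)
    map_eq_zero_of_eq' := by
      intro v i j hv hij
      have key : ∀ s : Finset (Fin q),
          (fun k => (if k ∈ s.map (Equiv.swap i j).toEmbedding then H.pV x else H.pH x) (v k)) =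
            (fun k => (if k ∈ s then H.pV x else H.pH x) (v k)) ∘ Equiv.swap i j := by
        intro s
        funext k
        have hk : v (Equiv.swap i j k) = v k := by
          rcases eq_or_ne k i with rfl | hki
          · rw [Equiv.swap_apply_left, hv]
          · rcases eq_or_ne k j with rfl | hkj
            · rw [Equiv.swap_apply_right, hv]
            · rw [Equiv.swap_apply_of_ne_of_ne hki hkj]
        simp only [Function.comp_apply, hk, Finset.mem_map_equiv, Equiv.symm_swap]
      have hswap : ∀ s : Finset (Fin q),
          α x (fun k => (if k ∈ s.map (Equiv.swap i j).toEmbedding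
            then H.pV x else H.pH x) (v k)) =
          -α x (fun k => (if k ∈ s then H.pV x else H.pH x) (v k)) := by
        intro s
        rw [key s]
        exact (α x).toAlternatingMap.map_swap _ hij
      have hsum : ∑ s ∈ Finset.powersetCard p Finset.univ,
          α x (fun k => (if k ∈ s then H.pV x else H.pH x) (v k)) = 0 := by
        refine Finset.sum_involution
          (fun s _ => s.map (Equiv.swap i j).toEmbedding) ?_ ?_ ?_ ?_
        · intro s _
          rw [hswap s, add_neg_cancel]
        · intro s _ hne heq
          have := hswap s
          rw [heq] at this
          exact hne (by linarith)
        · intro s hs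
          simpa [Finset.mem_powersetCard] using hs
        · intro s _
          ext k
          simp
      simpa using hsum }

/-! Oriented planes are given below by a positive basis `v`. The number `ve v`
depends only on the plane spanned by `v`, and `vol v`, `volH v` are the values on the positive
basis `v` of the volume forms `vol_π`, `vol^H_π` of the plane `π`. -/

/-- The value on `v` of the volume form, induced by `g`, of the plane with positive basis `v`. -/
def vol {x : M} (v : Fin q → TangentSpace (𝓡 n) x) : ℝ :=
  √(Matrix.gram ℝ v).det

/-- The matrix of the horizontal inner product `g(p_H ·, p_H ·)` in the basis `v`. -/
def SmoothDistribution.gramH (H : SmoothDistribution n q M) {x : M} (v : Fin q → TangentSpace (𝓡 n) x) :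
    Matrix (Fin q) (Fin q) ℝ :=
  Matrix.gram ℝ (fun i => H.pH x (v i))

/-- The value on `v` of the horizontal volume form of the plane with positive basis `v`. -/
def SmoothDistribution.volH (H : SmoothDistribution n q M) {x : M} (v : Fin q → TangentSpace (𝓡 n) x) : ℝ :=
  √(H.gramH v).det

/-- The function `ve = ½ |p_V|_π|²` of the plane `π` with basis `v`, where the norm is
the one defined by the horizontal inner product on `π` and by `g` on `V`. -/
def SmoothDistribution.ve (H : SmoothDistribution n q M) {x : M} (v : Fin q → TangentSpace (𝓡 n) x) : ℝ :=
  (1 / 2) * ∑ i, ∑ j, (H.gramH v)⁻¹ i j * inner ℝ (H.pV x (v i)) (H.pV x (v j))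

/-- The function `f(π) = ve(π) vol^H_π / vol_π`, where `v` is a basis of `π`. -/
def SmoothDistribution.f (H : SmoothDistribution n q M) {x : M} (v : Fin q → TangentSpace (𝓡 n) x) : ℝ :=
  H.ve v * (H.volH v / vol v)

/-- The oriented plane `π` with positive basis `v` is positive horizontally projectable: `p_H`
restricts to an orientation preserving isomorphism from `π` to `H_x`, where `H_x` has the orientation
for which a basis is positive when `α` is positive on it. -/
def SmoothDistribution.IsPositiveProjectable (H : SmoothDistribution n q M) (α : DForm n q M) {x : M}
    (v : Fin q → TangentSpace (𝓡 n) x) : Prop :=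
  LinearIndependent ℝ (fun i => H.pH x (v i)) ∧ 0 < α x (fun i => H.pH x (v i))

variable {S : Type*} [TopologicalSpace S] [ChartedSpace (EuclideanSpace ℝ (Fin q)) S]

/-- The image under the differential of `ι` of a frame of `S`. -/
def pushFrame (ι : C^∞⟮𝓡 q, S; 𝓡 n, M⟯) {x : S} (u : Fin q → TangentSpace (𝓡 q) x) :
    Fin q → TangentSpace (𝓡 n) (ι x) :=
  fun i => mfderiv (𝓡 q) (𝓡 n) ι x (u i)

/-- The positive horizontally projectable immersions. -/
def IsPositiveHPI (α : DForm n q M) (H : SmoothDistribution n q M) (o : ManifoldOrientation q S)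
    (ι : C^∞⟮𝓡 q, S; 𝓡 n, M⟯) : Prop :=
  Manifold.IsImmersion (𝓡 q) (𝓡 n) ∞ ι ∧
  ∀ (x : S) (u : Fin q → TangentSpace (𝓡 q) x), IsPositiveFrame (o.orient x) u →
    H.IsPositiveProjectable α (pushFrame ι u)

/-- The positive horizontally projectable immersion `ι` is `f`-calibrated by the `q`-form `β`, with
`f(π) = ve(π) vol^H_π / vol_π`: all `π = ι_*(T_xS)` satisfy `β|_π = f(π) vol_π`. Here
`α` orients the distribution `H`. -/
def IsFCalibrated (α : DForm n q M) (H : SmoothDistribution n q M) (β : DForm n q M)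
    (o : ManifoldOrientation q S) (ι : C^∞⟮𝓡 q, S; 𝓡 n, M⟯) : Prop :=
  IsPositiveHPI α H o ι ∧
  ∀ (x : S) (u : Fin q → TangentSpace (𝓡 q) x), IsPositiveFrame (o.orient x) u →
    β (ι x) (pushFrame ι u) = H.f (pushFrame ι u) * vol (pushFrame ι u)

/-- The vertical energy `VE(ι) = ∫_S ve(ι) vol^H_ι`. -/
def verticalEnergy [IsManifold (𝓡 q) ∞ S] [T2Space S] [CompactSpace S]
    (H : SmoothDistribution n q M) (ι : C^∞⟮𝓡 q, S; 𝓡 n, M⟯) : ℝ :=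
  integralDensity fun (x : S) (u : Fin q → TangentSpace (𝓡 q) x) =>
    H.ve (pushFrame ι u) * H.volH (pushFrame ι u)

end Distribution

/-! ### Manifolds with a `G₂`-structure -/

section G2

/-- The form `dx_i ∧ dx_j ∧ dx_k` on `ℝ⁷`. -/
def dx (i j k : Fin 7) (u v w : EuclideanSpace ℝ (Fin 7)) : ℝ :=
  Matrix.det !![u i, u j, u k; v i, v j, v k; w i, w j, w k]

/-- The standard `3`-form `dx₁₂₃ + dx₁₄₅ + dx₁₆₇ + dx₂₄₆ - dx₂₅₇ - dx₃₄₇ - dx₃₅₆` on `ℝ⁷`;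
the coordinates are numbered from `0` here. -/
def phi0 (u v w : EuclideanSpace ℝ (Fin 7)) : ℝ :=
  dx 0 1 2 u v w + dx 0 3 4 u v w + dx 0 5 6 u v w + dx 1 3 5 u v w
    - dx 1 4 6 u v w - dx 2 3 6 u v w - dx 2 4 5 u v w

variable {M : Type*} [TopologicalSpace M] [ChartedSpace (EuclideanSpace ℝ (Fin 7)) M]
  [RiemannianBundle (fun x : M => TangentSpace (𝓡 7) x)]

/-- The `3`-form `φ` is a `G₂`-structure whose induced metric is the metric `g` of `M`: at every
point there is a linear isomorphism `A` to `ℝ⁷` such that `φ = A^* φ₀` and `g = A^* g₀`. -/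
def IsG2Structure (φ : DForm 7 3 M) : Prop :=
  φ.IsSmooth ∧
  ∀ x : M, ∃ A : TangentSpace (𝓡 7) x ≃ₗᵢ[ℝ] EuclideanSpace ℝ (Fin 7),
    ∀ u v w : TangentSpace (𝓡 7) x, φ x ![u, v, w] = phi0 (A u) (A v) (A w)

/-- The cross product: `g(u × v, w) = φ(u, v, w)` for all `w`. -/
def cross (φ : DForm 7 3 M) {x : M} (u v : TangentSpace (𝓡 7) x) : TangentSpace (𝓡 7) x :=
  (InnerProductSpace.toDual ℝ (TangentSpace (𝓡 7) x)).symm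
    ((φ x).toContinuousMultilinearMap.toContinuousLinearMap ![u, v, 0] 2)

variable [IsManifold (𝓡 7) ∞ M] {S : Type*} [TopologicalSpace S]
  [ChartedSpace (EuclideanSpace ℝ (Fin 3)) S]

/-- The Fueter operator `∑ p_H(v_i) × p_V(v_i)` of the plane with basis `v`, where `v`
is orthonormal for the horizontal inner product. -/
def fueter (φ : DForm 7 3 M) (H : SmoothDistribution 7 3 M) {x : M}
    (v : Fin 3 → TangentSpace (𝓡 7) x) : TangentSpace (𝓡 7) x :=
  ∑ i, cross φ (H.pH x (v i)) (H.pV x (v i))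

/-- Fueter immersions: positive horizontally projectable immersions `ι` such that the Fueter
operator vanishes on all the planes `ι_*(T_xS)`. -/
def IsFueterImmersion (φ : DForm 7 3 M) (H : SmoothDistribution 7 3 M) (o : ManifoldOrientation 3 S)
    (ι : C^∞⟮𝓡 3, S; 𝓡 7, M⟯) : Prop :=
  IsPositiveHPI φ H o ι ∧
  ∀ (x : S) (u : Fin 3 → TangentSpace (𝓡 3) x), IsPositiveFrame (o.orient x) u →
    Orthonormal ℝ (fun i => H.pH (ι x) (pushFrame ι u i)) → fueter φ H (pushFrame ι u) = 0

end G2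

end VerticalEnergy

end

open VerticalEnergy

/-!
The theorem is a calibration argument for the form `β = α₂`, the component `α.component H 2`.

*Pointwise.* Let `π` be a positive horizontally projectable plane, with a basis `wᵢ = eᵢ + nᵢ`, where
the `eᵢ = p_H wᵢ` are orthonormal with `α(e) = 1` and `nᵢ = p_V wᵢ`. A semi-calibration satisfies
Hadamard's inequality `α(v) ≤ ∏ ‖vᵢ‖` (`alternating_le_prod_norm`). For `vᵢ = eᵢ + t nᵢ` this reads
`1 + t α₁(w) + t² α₂(w) + … ≤ ∏ (1 + t² ‖nᵢ‖²)^{1/2}`, and adding it for `t` and `-t` yields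
`α₂(w) ≤ ½ ∑ ‖nᵢ‖²` (`sum_powersetCard_two_le`). Since `ve vol^H` takes the value `½ ∑ ‖nᵢ‖²` on `w`,
we get `α₂ ≤ ve vol^H = f vol` on `π` (`component_two_le_ve_mul_volH`), with equality on the planes
of an `f`-calibrated immersion.

*Globally.* It remains to see that `∫_Σ ι^*β = ∫_Σ ι'^*β` when `dβ = 0` and `ι`, `ι'` are homologous.
The integral of a form over a smooth simplex is computed on the cube, by means of the collapsing map
`cubeMap` of the cube onto the simplex; then Stokes' theorem for a simplex
(`sum_simplexIntegral_face`) is Stokes' theorem for the cube, some of whose faces collapse. So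
closed forms have the same integrals over homologous cycles. The integral over `Σ`, which is defined
by a partition of unity, is the integral over any fundamental cycle `c`
(`IsFundamentalCycle.integralDensity_eq`): near each point `c` is, up to a boundary, a
positively embedded simplex, the boundary contributes nothing because top degree forms are closed,
and over the simplex the two integrals are related by a change of variables.

*Fueter immersions.* In dimension seven, `0 = ½ ‖∑ eᵢ × nᵢ‖² = ½ ∑ ‖nᵢ‖² - φ₂(w)`
(`phi0_eq_of_sum_cross0_eq_zero`), because `e₁ × e₂ = e₃`, and
`u × (v × w) = -(u × v) × w` for orthogonal `u`, `v`, `w`. So Fueter immersions are `f`-calibrated.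
-/

noncomputable section

namespace VerticalEnergy

/-! ### Forms bounded by one on orthonormal frames -/

section Comass

variable {T : Type*} [NormedAddCommGroup T] [InnerProductSpace ℝ T] {q : ℕ}

/-- The frame obtained from `v` by the matrix `A`, whose rows are the coefficients of the new
vectors. -/
def matFrame {T : Type*} [AddCommGroup T] [Module ℝ T] (A : Matrix (Fin q) (Fin q) ℝ)
    (v : Fin q → T) : Fin q → T :=
  fun i => ∑ j, A i j • v j

theorem alternating_matFrame {T : Type*} [AddCommGroup T] [Module ℝ T]
    (α : T [⋀^Fin q]→ₗ[ℝ] ℝ) (A : Matrix (Fin q) (Fin q) ℝ) (v : Fin q → T) :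
    α (matFrame A v) = A.det * α v := by
  have h := congrArg (fun β : (Fin q → ℝ) [⋀^Fin q]→ₗ[ℝ] ℝ => β A)
    ((α.compLinearMap (Fintype.linearCombination ℝ v)).eq_smul_basis_det (Pi.basisFun ℝ (Fin q)))
  simp only [AlternatingMap.compLinearMap_apply, Pi.basisFun_det, Pi.basisFun_apply,
    Fintype.linearCombination_apply_single, one_smul] at h
  rw [mul_comm]
  exact h

/-- A form that is at most `1` on orthonormal tuples satisfies Hadamard's inequality: on the
span of `v` it is a multiple of the volume form. -/
theorem alternating_le_prod_norm (α : T [⋀^Fin q]→ₗ[ℝ] ℝ)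
    (h : ∀ e : Fin q → T, Orthonormal ℝ e → α e ≤ 1) (v : Fin q → T) :
    α v ≤ ∏ i, ‖v i‖ := by
  rcases Nat.eq_zero_or_pos q with rfl | hq
  · simpa using h v ⟨fun i => i.elim0, fun i => i.elim0⟩
  by_cases hv : LinearIndependent ℝ v
  · let K := Submodule.span ℝ (Set.range v)
    have hfin : finrank ℝ K = q := by simpa using finrank_span_eq_card hv
    have : Fact (finrank ℝ K = q) := ⟨hfin⟩
    let b : Basis (Fin q) ℝ K := Basis.span hv
    let o := b.orientation
    let c := o.finOrthonormalBasis hq hfin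
    have hc : c.toBasis.orientation = o := o.finOrthonormalBasis_orientation hq hfin
    have hb : ∀ i, (b i : T) = v i := fun i => congrArg Subtype.val (Basis.span_apply hv i)
    have h1 : α v = α (fun i => (c i : T)) * c.toBasis.det b := by
      have h := congrArg (fun β : K [⋀^Fin q]→ₗ[ℝ] ℝ => β b)
        ((α.compLinearMap K.subtype).eq_smul_basis_det c.toBasis)
      simpa [Function.comp_def, hb] using h
    have hpos : 0 < c.toBasis.det b := (c.toBasis.orientation_eq_iff_det_pos b).1 hc
    have hle : c.toBasis.det b ≤ ∏ i, ‖v i‖ := by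
      rw [← o.volumeForm_robust c hc]
      refine (o.volumeForm_apply_le _).trans_eq ?_
      simp_rw [← hb]
      rfl
    have hα : α (fun i => (c i : T)) ≤ 1 := h _ (c.orthonormal.comp_linearIsometry K.subtypeₗᵢ)
    rw [h1]
    nlinarith
  · rw [α.map_linearDependent v hv]
    positivity

/-- Comparison of the second order terms at `0` of a polynomial and of `exp (t² A / 2)`. -/
theorem coeff_two_le_of_le_exp (N : ℕ) (c : ℕ → ℝ) (A : ℝ) (h0 : c 0 = 1)
    (h : ∀ t : ℝ, ∑ k ∈ Finset.range (N + 3), t ^ k * c k ≤ Real.exp (t ^ 2 * A / 2)) :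
    c 2 ≤ A / 2 := by
  let r : ℝ → ℝ := fun t => ∑ k ∈ Finset.range N, t ^ k * c (k + 3)
  have hr : Continuous r := by fun_prop
  have hp : ∀ t : ℝ, ∑ k ∈ Finset.range (N + 3), t ^ k * c k =
      1 + t * c 1 + t ^ 2 * c 2 + t ^ 3 * r t := by
    intro t
    simp only [Finset.sum_range_succ', r, Finset.mul_sum]
    simp only [h0, pow_add]
    have : ∑ k ∈ Finset.range N, t ^ k * t ^ 1 * t ^ 1 * t ^ 1 * c (k + 1 + 1 + 1) =
      ∑ k ∈ Finset.range N, t ^ 3 * (t ^ k * c (k + 3)) :=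
        Finset.sum_congr rfl fun k _ => by ring_nf
    rw [this]
    ring
  -- averaging over `t` and `-t` removes the odd terms of order one
  have key : ∀ᶠ t in 𝓝[>] (0 : ℝ),
      2 * c 2 + t * (r t - r (-t)) ≤ A + t ^ 2 * A ^ 2 / 2 := by
    have hlim : Filter.Tendsto (fun t : ℝ => |t ^ 2 * A / 2|) (𝓝[>] 0) (𝓝 0) := by
      have : Continuous fun t : ℝ => |t ^ 2 * A / 2| := by fun_prop
      simpa using (this.tendsto 0).mono_left nhdsWithin_le_nhds
    filter_upwards [self_mem_nhdsWithin, hlim.eventually_lt_const zero_lt_one] with t ht ht1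
    have ht : 0 < t := ht
    have he := abs_le.1 (Real.abs_exp_sub_one_sub_id_le ht1.le)
    have h1 := h t
    have h2 := h (-t)
    rw [hp] at h1 h2
    have e2 : (-t) ^ 2 = t ^ 2 := by ring
    rw [e2] at h2
    have : t ^ 2 * (2 * c 2 + t * (r t - r (-t))) ≤ t ^ 2 * (A + t ^ 2 * A ^ 2 / 2) := by
      nlinarith
    exact le_of_mul_le_mul_left this (by positivity)
  have hl : Filter.Tendsto (fun t : ℝ => 2 * c 2 + t * (r t - r (-t))) (𝓝[>] 0) (𝓝 (2 * c 2)) := by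
    have : Continuous fun t : ℝ => 2 * c 2 + t * (r t - r (-t)) := by fun_prop
    simpa using (this.tendsto 0).mono_left nhdsWithin_le_nhds
  have hr' : Filter.Tendsto (fun t : ℝ => A + t ^ 2 * A ^ 2 / 2) (𝓝[>] 0) (𝓝 A) := by
    have : Continuous fun t : ℝ => A + t ^ 2 * A ^ 2 / 2 := by fun_prop
    simpa using (this.tendsto 0).mono_left nhdsWithin_le_nhds
  have := le_of_tendsto_of_tendsto hl hr' key
  linarith

/-- The pointwise inequality behind the theorem: the comass bound for the tuples `e + t w` is, to
second order in `t`, the bound of the component of degree two by half the energy of `w`. -/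
theorem sum_powersetCard_two_le (α : T [⋀^Fin q]→ₗ[ℝ] ℝ)
    (h : ∀ e : Fin q → T, Orthonormal ℝ e → α e ≤ 1) {e w : Fin q → T} (he : Orthonormal ℝ e)
    (hαe : α e = 1) (hew : ∀ i, inner ℝ (e i) (w i) = 0) :
    ∑ s ∈ Finset.powersetCard 2 (Finset.univ : Finset (Fin q)), α (s.piecewise w e) ≤
      (1 / 2) * ∑ i, ‖w i‖ ^ 2 := by
  let c : ℕ → ℝ := fun k => ∑ s ∈ Finset.powersetCard k (Finset.univ : Finset (Fin q)),
    α (s.piecewise w e)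
  have hc0 : c 0 = 1 := by simp [c, hαe]
  have hc : ∀ k, q < k → c k = 0 := fun k hk => by
    simp only [c]
    rw [Finset.powersetCard_eq_empty.2 (by simpa using hk), Finset.sum_empty]
  have := coeff_two_le_of_le_exp q c (∑ i, ‖w i‖ ^ 2) hc0 fun t => ?_
  · simp only [c] at this
    linarith
  have hexp : ∑ k ∈ Finset.range (q + 3), t ^ k * c k = α (t • w + e) := by
    rw [show q + 3 = q + 1 + 1 + 1 from rfl, Finset.sum_range_succ, Finset.sum_range_succ,
      hc (q + 1) (by omega), hc (q + 1 + 1) (by omega), mul_zero, mul_zero, add_zero, add_zero,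
      α.map_add_univ, ← Finset.powerset_univ, Finset.sum_powerset]
    simp only [Finset.card_univ, Fintype.card_fin, c, Finset.mul_sum]
    refine Finset.sum_congr rfl fun k _ => Finset.sum_congr rfl fun s hs => ?_
    have hs' := (Finset.mem_powersetCard.1 hs).2
    have := α.toMultilinearMap.map_piecewise_smul (fun _ => t) (s.piecewise w e) s
    simp only [Finset.prod_const, hs', smul_eq_mul, AlternatingMap.coe_multilinearMap] at this
    rw [← this]
    congr 1
    ext i
    by_cases hi : i ∈ s <;> simp [hi]
  rw [hexp]
  refine (alternating_le_prod_norm α h _).trans ?_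
  have hn : ∀ i, ‖(t • w + e) i‖ ≤ Real.exp (t ^ 2 * ‖w i‖ ^ 2 / 2) := by
    intro i
    have h2 : ‖(t • w + e) i‖ ^ 2 = t ^ 2 * ‖w i‖ ^ 2 + 1 := by
      have := norm_add_sq_real (t • w i) (e i)
      rw [real_inner_smul_left, real_inner_comm, hew i, he.1 i, norm_smul, mul_pow,
        Real.norm_eq_abs, sq_abs] at this
      simpa using this
    have h3 : ‖(t • w + e) i‖ ^ 2 ≤ Real.exp (t ^ 2 * ‖w i‖ ^ 2 / 2) ^ 2 := by
      rw [h2, ← Real.exp_nat_mul]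
      refine (Real.add_one_le_exp _).trans_eq ?_
      push_cast
      ring_nf
    exact le_of_sq_le_sq h3 (Real.exp_pos _).le
  refine (Finset.prod_le_prod (fun i _ => norm_nonneg _) fun i _ => hn i).trans_eq ?_
  rw [← Real.exp_sum, ← Finset.sum_div, ← Finset.mul_sum]

end Comass

/-! ### The vertical energy of a plane -/

section Pointwise

theorem form_matFrame {n k : ℕ} {M : Type*} [TopologicalSpace M]
    [ChartedSpace (EuclideanSpace ℝ (Fin n)) M] (β : DForm n k M) {x : M}
    (A : Matrix (Fin k) (Fin k) ℝ) (v : Fin k → TangentSpace (𝓡 n) x) :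
    β x (matFrame A v) = A.det * β x v :=
  alternating_matFrame (β x).toAlternatingMap A v

variable {n q : ℕ} {M : Type*} [TopologicalSpace M] [ChartedSpace (EuclideanSpace ℝ (Fin n)) M]
  [IsManifold (𝓡 n) ∞ M] [RiemannianBundle (fun x : M => TangentSpace (𝓡 n) x)]
  {H : SmoothDistribution n q M} {α : DForm n q M} {x : M}

theorem component_apply (p : ℕ) (v : Fin q → TangentSpace (𝓡 n) x) :
    α.component H p x v = ∑ s ∈ Finset.powersetCard p (Finset.univ : Finset (Fin q)),
      α x (fun j => (if j ∈ s then H.pV x else H.pH x) (v j)) := by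
  change (∑ s ∈ Finset.powersetCard p (Finset.univ : Finset (Fin q)),
        (α x).toContinuousMultilinearMap.compContinuousLinearMap
          (fun j => if j ∈ s then H.pV x else H.pH x)) v = _
  rw [_root_.sum_apply]
  rfl

theorem pH_add_pV (v : TangentSpace (𝓡 n) x) : H.pH x v + H.pV x v = v :=
  Submodule.starProjection_add_starProjection_orthogonal (K := H.fiber x) v

theorem inner_pH_pV (v w : TangentSpace (𝓡 n) x) : inner ℝ (H.pH x v) (H.pV x w) = 0 :=
  Submodule.inner_right_of_mem_orthogonal (K := H.fiber x)
    (Submodule.starProjection_apply_mem _ _) (Submodule.starProjection_apply_mem _ _)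

theorem inner_pH_pH (v w : TangentSpace (𝓡 n) x) :
    inner ℝ (H.pH x v) (H.pH x w) = inner ℝ (H.pH x v) w := by
  conv_rhs => rw [← pH_add_pV (H := H) w, inner_add_right, inner_pH_pV, add_zero]

theorem inner_pV_pV (v w : TangentSpace (𝓡 n) x) :
    inner ℝ (H.pV x v) (H.pV x w) = inner ℝ v w - inner ℝ (H.pH x v) w := by
  have h : inner ℝ (H.pV x v) (H.pH x w) = 0 := by rw [real_inner_comm, inner_pH_pV]
  conv_rhs => rw [← inner_sub_left, ← eq_sub_of_add_eq' (pH_add_pV (H := H) v),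
    ← pH_add_pV (H := H) w, inner_add_right, h, zero_add]

theorem map_matFrame {T T' : Type*} [AddCommGroup T] [Module ℝ T] [AddCommGroup T'] [Module ℝ T']
    (L : T →ₗ[ℝ] T') (A : Matrix (Fin q) (Fin q) ℝ) (v : Fin q → T) :
    (fun i => L (matFrame A v i)) = matFrame A (fun i => L (v i)) := by
  ext i; simp [matFrame]

theorem matFrame_mul {T : Type*} [AddCommGroup T] [Module ℝ T]
    (A B : Matrix (Fin q) (Fin q) ℝ) (v : Fin q → T) :
    matFrame (A * B) v = matFrame A (matFrame B v) := by
  ext i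
  simp only [matFrame, Matrix.mul_apply, Finset.sum_smul, Finset.smul_sum, smul_smul]
  exact Finset.sum_comm

theorem matFrame_one {T : Type*} [AddCommGroup T] [Module ℝ T] (v : Fin q → T) :
    matFrame 1 v = v := by
  ext i
  simp [matFrame, Matrix.one_apply]

theorem gram_matFrame {T : Type*} [NormedAddCommGroup T] [InnerProductSpace ℝ T]
    (A : Matrix (Fin q) (Fin q) ℝ) (v : Fin q → T) :
    Matrix.gram ℝ (matFrame A v) = A * Matrix.gram ℝ v * A.transpose := by
  ext i j
  simp only [Matrix.gram_apply, matFrame, Matrix.mul_apply, Matrix.transpose_apply, sum_inner,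
    inner_sum, real_inner_smul_left, real_inner_smul_right, Finset.sum_mul]
  exact Finset.sum_congr rfl fun k _ => Finset.sum_congr rfl fun l _ => by ring

theorem gramH_matFrame (A : Matrix (Fin q) (Fin q) ℝ) {v : Fin q → TangentSpace (𝓡 n) x}
    (hv : Orthonormal ℝ (fun i => H.pH x (v i))) :
    H.gramH (matFrame A v) = A * A.transpose := by
  have := map_matFrame (H.pH x).toLinearMap A v
  simp only [ContinuousLinearMap.coe_coe] at this
  rw [SmoothDistribution.gramH, this, gram_matFrame, Matrix.gram_eq_one_iff_orthonormal.2 hv,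
    mul_one]

theorem volH_matFrame (A : Matrix (Fin q) (Fin q) ℝ) {v : Fin q → TangentSpace (𝓡 n) x}
    (hv : Orthonormal ℝ (fun i => H.pH x (v i))) :
    H.volH (matFrame A v) = |A.det| := by
  rw [SmoothDistribution.volH, gramH_matFrame A hv, Matrix.det_mul, Matrix.det_transpose,
    Real.sqrt_mul_self_eq_abs]

/-- On a frame whose horizontal projection is orthonormal up to a change of frame, `ve` is half the
energy of the vertical projection. -/
theorem ve_matFrame (A : Matrix (Fin q) (Fin q) ℝ) (hA : A.det ≠ 0)
    {v : Fin q → TangentSpace (𝓡 n) x} (hv : Orthonormal ℝ (fun i => H.pH x (v i))) :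
    H.ve (matFrame A v) = (1 / 2) * ∑ i, ‖H.pV x (v i)‖ ^ 2 := by
  have hu : IsUnit A.det := isUnit_iff_ne_zero.2 hA
  have hut : IsUnit A.transpose.det := by rwa [Matrix.det_transpose]
  have hV := map_matFrame (H.pV x).toLinearMap A v
  simp only [ContinuousLinearMap.coe_coe] at hV
  have htr : ∑ i, ∑ j, (H.gramH (matFrame A v))⁻¹ i j *
      inner ℝ (H.pV x (matFrame A v i)) (H.pV x (matFrame A v j)) =
      ((H.gramH (matFrame A v))⁻¹ *
        Matrix.gram ℝ (fun i => H.pV x (matFrame A v i))).trace := by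
    simp only [Matrix.trace, Matrix.diag_apply, Matrix.mul_apply, Matrix.gram_apply]
    refine Finset.sum_congr rfl fun i _ => Finset.sum_congr rfl fun j _ => ?_
    rw [real_inner_comm]
  rw [SmoothDistribution.ve, htr, gramH_matFrame A hv, hV, gram_matFrame, Matrix.mul_inv_rev,
    mul_assoc, Matrix.trace_mul_comm]
  have : A⁻¹ * (A * Matrix.gram ℝ (fun i => H.pV x (v i)) * A.transpose) * A.transpose⁻¹ =
      Matrix.gram ℝ (fun i => H.pV x (v i)) := by
    rw [mul_assoc A, Matrix.nonsing_inv_mul_cancel_left _ _ hu,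
      Matrix.mul_nonsing_inv_cancel_right _ _ hut]
  rw [this]
  simp [Matrix.trace, Matrix.gram_apply]

/-- The matrix that changes the calibrated frame `e` of `H` into the horizontal projection of `v`
changes an adapted frame of the plane of `v` into `v`. -/
theorem exists_adapted (hcal : H.IsCalibratedBy α) {v : Fin q → TangentSpace (𝓡 n) x}
    (hv : LinearIndependent ℝ (fun i => H.pH x (v i))) :
    ∃ (A : Matrix (Fin q) (Fin q) ℝ) (w : Fin q → TangentSpace (𝓡 n) x), A.det ≠ 0 ∧
      v = matFrame A w ∧ Orthonormal ℝ (fun i => H.pH x (w i)) ∧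
      α x (fun i => H.pH x (w i)) = 1 ∧ α x (fun i => H.pH x (v i)) = A.det := by
  obtain ⟨e, he, hspan, hαe⟩ := hcal x
  have hmem : ∀ i, H.pH x (v i) ∈ Submodule.span ℝ (Set.range e) := fun i => by
    rw [hspan]
    exact Submodule.starProjection_apply_mem _ _
  have hex : ∀ i, ∃ c : Fin q → ℝ, ∑ j, c j • e j = H.pH x (v i) := fun i =>
    (Submodule.mem_span_range_iff_exists_fun ℝ).1 (hmem i)
  choose A hA using hex
  have hAe : matFrame (Matrix.of A) e = fun i => H.pH x (v i) := funext hA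
  have hdet : (Matrix.of A).det ≠ 0 := by
    intro h0
    obtain ⟨c, hc0, hc⟩ := Matrix.exists_vecMul_eq_zero_iff.2 h0
    apply hc0
    refine funext (Fintype.linearIndependent_iff.1 hv c ?_)
    have : ∑ i, c i • H.pH x (v i) = ∑ j, (Matrix.vecMul c (Matrix.of A)) j • e j := by
      simp only [← hA, Finset.smul_sum, smul_smul, Matrix.vecMul, dotProduct, Finset.sum_smul]
      exact Finset.sum_comm
    rw [this, hc]
    simp
  have hu := isUnit_iff_ne_zero.2 hdet
  have hw : (fun i => H.pH x (matFrame (Matrix.of A)⁻¹ v i)) = e := by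
    have := map_matFrame (H.pH x).toLinearMap (Matrix.of A)⁻¹ v
    simp only [ContinuousLinearMap.coe_coe] at this
    rw [this, ← hAe, ← matFrame_mul, Matrix.nonsing_inv_mul _ hu, matFrame_one]
  refine ⟨Matrix.of A, matFrame (Matrix.of A)⁻¹ v, hdet, ?_, ?_, ?_, ?_⟩
  · rw [← matFrame_mul, Matrix.mul_nonsing_inv _ hu, matFrame_one]
  · rwa [hw]
  · rwa [hw]
  · rw [← hAe, form_matFrame, hαe, mul_one]

theorem component_two_le (hα : IsSemiCalibration α) {w : Fin q → TangentSpace (𝓡 n) x}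
    (hw : Orthonormal ℝ (fun i => H.pH x (w i))) (hαw : α x (fun i => H.pH x (w i)) = 1) :
    α.component H 2 x w ≤ (1 / 2) * ∑ i, ‖H.pV x (w i)‖ ^ 2 := by
  rw [component_apply]
  refine le_of_eq_of_le ?_ (sum_powersetCard_two_le (α x).toAlternatingMap (hα x) hw hαw
    (w := fun i => H.pV x (w i)) fun i => inner_pH_pV _ _)
  refine Finset.sum_congr rfl fun s _ => ?_
  refine congrArg (α x) (funext fun j => ?_)
  by_cases hj : j ∈ s <;> simp [hj]

/-- The component of degree two of a semi-calibration is at most the vertical energy density on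
positive horizontally projectable planes. -/
theorem component_two_le_ve_mul_volH (hα : IsSemiCalibration α) (hcal : H.IsCalibratedBy α)
    {v : Fin q → TangentSpace (𝓡 n) x} (hv : H.IsPositiveProjectable α v) :
    α.component H 2 x v ≤ H.ve v * H.volH v := by
  obtain ⟨A, w, hA, rfl, hw, hαw, hαv⟩ := exists_adapted hcal hv.1
  have hpos : 0 < A.det := hαv ▸ hv.2
  rw [form_matFrame, volH_matFrame A hw, ve_matFrame A hA hw, abs_of_pos hpos, mul_comm]
  exact mul_le_mul_of_nonneg_right (component_two_le hα hw hαw) hpos.le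

/-- The density of the vertical energy is unchanged under a change of frame of determinant
`-1`. -/
theorem ve_mul_volH_matFrame (hcal : H.IsCalibratedBy α) {v : Fin q → TangentSpace (𝓡 n) x}
    (hv : LinearIndependent ℝ (fun i => H.pH x (v i))) (B : Matrix (Fin q) (Fin q) ℝ)
    (hB : B.det = -1) :
    H.ve (matFrame B v) * H.volH (matFrame B v) = H.ve v * H.volH v := by
  obtain ⟨A, w, hA, rfl, hw, -, -⟩ := exists_adapted hcal hv
  rw [← matFrame_mul, volH_matFrame _ hw, volH_matFrame _ hw, ve_matFrame A hA hw,
    ve_matFrame _ (by rw [Matrix.det_mul, hB]; simpa using hA) hw, Matrix.det_mul, hB]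
  simp

theorem f_mul_vol {v : Fin q → TangentSpace (𝓡 n) x}
    (hv : LinearIndependent ℝ (fun i => H.pH x (v i))) : H.f v * vol v = H.ve v * H.volH v := by
  have hv' : LinearIndependent ℝ v := LinearIndependent.of_comp (H.pH x).toLinearMap hv
  have : 0 < vol v := Real.sqrt_pos.2 (Matrix.posDef_gram_of_linearIndependent hv').det_pos
  rw [SmoothDistribution.f]
  field_simp

end Pointwise

/-! ### Pullback of forms to a vector space -/

section Pullback

variable {n k : ℕ} {M : Type*} [TopologicalSpace M] [ChartedSpace (EuclideanSpace ℝ (Fin n)) M]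
  {E' : Type*} [NormedAddCommGroup E'] [NormedSpace ℝ E']

/-- The expression of the form in every preferred chart is differentiable. -/
def DForm.IsDifferentiable (β : DForm n k M) : Prop :=
  ∀ x₀ : M, DifferentiableOn ℝ (β.inChart x₀) (chartAt (EuclideanSpace ℝ (Fin n)) x₀).target

/-- The pullback of a form by a map `G` from a vector space. -/
def formPullback (β : DForm n k M) (G : E' → M) (a : E') : E' [⋀^Fin k]→L[ℝ] ℝ :=
  (β (G a)).compContinuousLinearMap (mfderiv 𝓘(ℝ, E') (𝓡 n) G a)

theorem formPullback_apply (β : DForm n k M) (G : E' → M) (a : E') (v : Fin k → E') :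
    formPullback β G a v = β (G a) (fun i => mfderiv 𝓘(ℝ, E') (𝓡 n) G a (v i)) := rfl

/-- Equality of the values of a form at base points that are equal, but not by definition. -/
theorem form_congr (β : DForm n k M) {x y : M} (h : x = y) (v : Fin k → EuclideanSpace ℝ (Fin n)) :
    (β x : (Fin k → TangentSpace (𝓡 n) x) → ℝ) v =
      (β y : (Fin k → TangentSpace (𝓡 n) y) → ℝ) v := by
  subst h; rfl

theorem formPullback_congr (β : DForm n k M) {G G' : E' → M} {a : E'} (h : G =ᶠ[𝓝 a] G') :
    formPullback β G a = formPullback β G' a := by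
  ext v
  rw [formPullback_apply, formPullback_apply, h.mfderiv_eq]
  exact form_congr β h.eq_of_nhds _

theorem mdifferentiableAt_of_contMDiffOn {U : Set E'} {G : E' → M} (hU : IsOpen U)
    (hG : ContMDiffOn 𝓘(ℝ, E') (𝓡 n) ∞ G U) {a : E'} (ha : a ∈ U) :
    MDifferentiableAt 𝓘(ℝ, E') (𝓡 n) G a :=
  ((hG a ha).contMDiffAt (hU.mem_nhds ha)).mdifferentiableAt (by simp)

variable [IsManifold (𝓡 n) ∞ M]

theorem mdifferentiableAt_chart (x₀ : M) {x : M}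
    (hx : x ∈ (chartAt (EuclideanSpace ℝ (Fin n)) x₀).source) :
    MDifferentiableAt (𝓡 n) (𝓡 n) (chartAt (EuclideanSpace ℝ (Fin n)) x₀) x :=
  haveI : IsManifold (𝓡 n) 1 M := IsManifold.of_le (n := ∞) (by simp)
  (mdifferentiable_chart x₀).mdifferentiableAt hx

theorem mdifferentiableAt_chart_symm (x₀ : M) {y : EuclideanSpace ℝ (Fin n)}
    (hy : y ∈ (chartAt (EuclideanSpace ℝ (Fin n)) x₀).target) :
    MDifferentiableAt (𝓡 n) (𝓡 n) (chartAt (EuclideanSpace ℝ (Fin n)) x₀).symm y :=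
  haveI : IsManifold (𝓡 n) 1 M := IsManifold.of_le (n := ∞) (by simp)
  (mdifferentiable_chart x₀).mdifferentiableAt_symm hy

/-- The differential of a map `G` in terms of its expression in a chart. -/
theorem mfderiv_eq_comp_chart (x₀ : M) {G : E' → M} {a : E'}
    (hG : MDifferentiableAt 𝓘(ℝ, E') (𝓡 n) G a)
    (ha : G a ∈ (chartAt (EuclideanSpace ℝ (Fin n)) x₀).source) (v : E') :
    (mfderiv 𝓘(ℝ, E') (𝓡 n) G a v : EuclideanSpace ℝ (Fin n)) =
      mfderiv (𝓡 n) (𝓡 n) (chartAt (EuclideanSpace ℝ (Fin n)) x₀).symm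
        (chartAt (EuclideanSpace ℝ (Fin n)) x₀ (G a))
        (fderiv ℝ (chartAt (EuclideanSpace ℝ (Fin n)) x₀ ∘ G) a v) := by
  set e := chartAt (EuclideanSpace ℝ (Fin n)) x₀ with he
  have h1 : MDifferentiableAt 𝓘(ℝ, E') (𝓡 n) (e ∘ G) a :=
    (mdifferentiableAt_chart x₀ ha).comp a hG
  have h2 : G =ᶠ[𝓝 a] e.symm ∘ (e ∘ G) := by
    filter_upwards [hG.continuousAt.preimage_mem_nhds (e.open_source.mem_nhds ha)] with b hb
    exact (e.left_inv hb).symm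
  rw [h2.mfderiv_eq, mfderiv_comp a (mdifferentiableAt_chart_symm x₀ (e.map_source ha)) h1,
    ← mfderiv_eq_fderiv]
  rfl

theorem differentiableAt_chart_comp (x₀ : M) {G : E' → M} {a : E'}
    (hG : MDifferentiableAt 𝓘(ℝ, E') (𝓡 n) G a)
    (ha : G a ∈ (chartAt (EuclideanSpace ℝ (Fin n)) x₀).source) :
    DifferentiableAt ℝ (chartAt (EuclideanSpace ℝ (Fin n)) x₀ ∘ G) a :=
  mdifferentiableAt_iff_differentiableAt.1 ((mdifferentiableAt_chart x₀ ha).comp a hG)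

theorem contDiffOn_chart_comp (x₀ : M) {G : E' → M} {U : Set E'}
    (hG : ContMDiffOn 𝓘(ℝ, E') (𝓡 n) ∞ G U) :
    ContDiffOn ℝ ∞ (chartAt (EuclideanSpace ℝ (Fin n)) x₀ ∘ G)
      (U ∩ G ⁻¹' (chartAt (EuclideanSpace ℝ (Fin n)) x₀).source) :=
  contMDiffOn_iff_contDiffOn.1 ((contMDiffOn_chart (I := 𝓡 n) (n := ∞) (x := x₀)).comp
    (hG.mono Set.inter_subset_left) fun _ h => h.2)

theorem formPullback_eq_inChart (β : DForm n k M) (x₀ : M) {G : E' → M} {a : E'}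
    (hG : MDifferentiableAt 𝓘(ℝ, E') (𝓡 n) G a)
    (ha : G a ∈ (chartAt (EuclideanSpace ℝ (Fin n)) x₀).source) :
    formPullback β G a = (β.inChart x₀
      (chartAt (EuclideanSpace ℝ (Fin n)) x₀ (G a))).compContinuousLinearMap
        (fderiv ℝ (chartAt (EuclideanSpace ℝ (Fin n)) x₀ ∘ G) a) := by
  ext v
  set e := chartAt (EuclideanSpace ℝ (Fin n)) x₀ with he
  rw [formPullback_apply]
  refine (form_congr β (e.left_inv ha).symm _).trans ?_
  exact congrArg (β (e.symm (e (G a)))) (funext fun i => mfderiv_eq_comp_chart x₀ hG ha (v i))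

section

variable {U : Set E'} {G : E' → M}

theorem eventually_formPullback_eq (β : DForm n k M) (hU : IsOpen U)
    (hG : ContMDiffOn 𝓘(ℝ, E') (𝓡 n) ∞ G U) {a : E'} (ha : a ∈ U) (x₀ : M)
    (hx : G a ∈ (chartAt (EuclideanSpace ℝ (Fin n)) x₀).source) :
    formPullback β G =ᶠ[𝓝 a] fun b => (β.inChart x₀
      ((chartAt (EuclideanSpace ℝ (Fin n)) x₀ ∘ G) b)).compContinuousLinearMap
        (fderiv ℝ (chartAt (EuclideanSpace ℝ (Fin n)) x₀ ∘ G) b) := by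
  have hc := (mdifferentiableAt_of_contMDiffOn hU hG ha).continuousAt
  filter_upwards [hU.mem_nhds ha, hc.preimage_mem_nhds
    ((chartAt (EuclideanSpace ℝ (Fin n)) x₀).open_source.mem_nhds hx)] with b hb hb'
  exact formPullback_eq_inChart β x₀ (mdifferentiableAt_of_contMDiffOn hU hG hb) hb'

theorem contDiffAt_chart_comp (hU : IsOpen U)
    (hG : ContMDiffOn 𝓘(ℝ, E') (𝓡 n) ∞ G U) {a : E'} (ha : a ∈ U) (x₀ : M)
    (hx : G a ∈ (chartAt (EuclideanSpace ℝ (Fin n)) x₀).source) :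
    ContDiffAt ℝ ∞ (chartAt (EuclideanSpace ℝ (Fin n)) x₀ ∘ G) a := by
  have hc := (mdifferentiableAt_of_contMDiffOn hU hG ha).continuousAt
  exact (contDiffOn_chart_comp x₀ hG).contDiffAt (Filter.inter_mem (hU.mem_nhds ha)
    (hc.preimage_mem_nhds ((chartAt (EuclideanSpace ℝ (Fin n)) x₀).open_source.mem_nhds hx)))

theorem differentiableAt_formPullback {β : DForm n k M} (hβ : β.IsDifferentiable) (hU : IsOpen U)
    (hG : ContMDiffOn 𝓘(ℝ, E') (𝓡 n) ∞ G U) {a : E'} (ha : a ∈ U) :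
    DifferentiableAt ℝ (formPullback β G) a := by
  set e := chartAt (EuclideanSpace ℝ (Fin n)) (G a) with he
  have hx : G a ∈ e.source := mem_chart_source _ _
  have hcd := contDiffAt_chart_comp hU hG ha (G a) hx
  refine DifferentiableAt.congr_of_eventuallyEq ?_
    (eventually_formPullback_eq β hU hG ha (G a) hx)
  refine DifferentiableAt.continuousAlternatingMapCompContinuousLinearMap ?_ ?_
  · exact ((hβ (G a)).differentiableAt (e.open_target.mem_nhds (e.map_source hx))).comp a
      (hcd.differentiableAt (by simp))
  · exact (hcd.fderiv_right (m := 1) (by norm_cast)).differentiableAt (by simp)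

/-- The exterior derivative commutes with pullback. -/
theorem extDeriv_formPullback {β : DForm n k M} (hβ : β.IsDifferentiable) (hU : IsOpen U)
    (hG : ContMDiffOn 𝓘(ℝ, E') (𝓡 n) ∞ G U) {a : E'} (ha : a ∈ U) :
    extDeriv (formPullback β G) a = formPullback β.d G a := by
  set e := chartAt (EuclideanSpace ℝ (Fin n)) (G a) with he
  have hx : G a ∈ e.source := mem_chart_source _ _
  have hcd := contDiffAt_chart_comp hU hG ha (G a) hx
  have hGa := mdifferentiableAt_of_contMDiffOn hU hG ha
  rw [(eventually_formPullback_eq β hU hG ha (G a) hx).extDeriv_eq,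
    extDeriv_pullback (f := e ∘ G) (r := ∞) (show DifferentiableAt ℝ (β.inChart (G a)) ((e ∘ G) a)
      from (hβ (G a)).differentiableAt (e.open_target.mem_nhds (e.map_source hx))) hcd
      (by simp; norm_cast)]
  ext v
  refine congrArg (extDeriv (β.inChart (G a)) (e (G a))) (funext fun i => ?_)
  have : mfderiv 𝓘(ℝ, E') (𝓡 n) (e ∘ G) a =
      (mfderiv (𝓡 n) (𝓡 n) e (G a)).comp (mfderiv 𝓘(ℝ, E') (𝓡 n) G a) :=
    mfderiv_comp a (mdifferentiableAt_chart (G a) hx) hGa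
  rw [mfderiv_eq_fderiv] at this
  exact congrArg (fun L : E' →L[ℝ] EuclideanSpace ℝ (Fin n) => L (v i)) this

end

end Pullback

/-! ### Parametrizing the simplex by the cube -/

section Cube

/-- The collapse of the cube `[0, 1]^k` onto the standard simplex, with barycentric coordinates
`t_j = x_0 ⋯ x_{j-1} (1 - x_j)` (where `x_k = 0`). -/
def cubeMap : (k : ℕ) → (Fin k → ℝ) → (Fin (k + 1) → ℝ)
  | 0, _ => 1
  | k + 1, x => Fin.cons (1 - x 0) (x 0 • cubeMap k (Fin.tail x))

theorem cubeMap_succ (k : ℕ) (x : Fin (k + 1) → ℝ) :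
    cubeMap (k + 1) x = Fin.cons (1 - x 0) (x 0 • cubeMap k (Fin.tail x)) := rfl

theorem contDiff_cubeMap (k : ℕ) : ContDiff ℝ ∞ (cubeMap k) := by
  induction k with
  | zero => exact contDiff_const
  | succ k ih =>
    have ht : ContDiff ℝ ∞ (fun x : Fin (k + 1) → ℝ => Fin.tail x) :=
      contDiff_pi.2 fun i => contDiff_apply ℝ ℝ i.succ
    refine contDiff_pi.2 fun j => ?_
    refine Fin.cases ?_ (fun j => ?_) j
    · exact contDiff_const.sub (contDiff_apply ℝ ℝ 0)
    · exact (contDiff_apply ℝ ℝ 0).mul (contDiff_pi.1 (ih.comp ht) j)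

theorem sum_cubeMap (k : ℕ) (x : Fin k → ℝ) : ∑ j, cubeMap k x j = 1 := by
  induction k with
  | zero => simp [cubeMap]
  | succ k ih =>
    rw [cubeMap_succ, Fin.sum_univ_succ]
    simp [← Finset.mul_sum, ih]

theorem cubeMap_mem {k : ℕ} {x : Fin k → ℝ} (hx : x ∈ Set.Icc 0 1) :
    cubeMap k x ∈ stdSimplex ℝ (Fin (k + 1)) := by
  refine ⟨?_, sum_cubeMap k x⟩
  induction k with
  | zero => intro j; simp [cubeMap]
  | succ k ih =>
    intro j
    refine Fin.cases ?_ (fun j => ?_) j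
    · simpa [cubeMap_succ] using hx.2 0
    · simp only [cubeMap_succ, Fin.cons_succ, Pi.smul_apply, smul_eq_mul]
      exact mul_nonneg (hx.1 0) (ih ⟨fun i => hx.1 i.succ, fun i => hx.2 i.succ⟩ j)

/-- The open unit cube. -/
def openCube (k : ℕ) : Set (Fin k → ℝ) := Set.univ.pi fun _ => Set.Ioo 0 1

theorem isOpen_openCube (k : ℕ) : IsOpen (openCube k) :=
  isOpen_set_pi Set.finite_univ fun _ _ => isOpen_Ioo

theorem openCube_subset (k : ℕ) : openCube k ⊆ Set.Icc 0 1 := fun _ hx =>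
  ⟨fun i => (hx i trivial).1.le, fun i => (hx i trivial).2.le⟩

theorem openCube_ae_eq (k : ℕ) :
    openCube k =ᵐ[MeasureTheory.volume] (Set.Icc 0 1 : Set (Fin k → ℝ)) := by
  rw [MeasureTheory.volume_pi]
  exact MeasureTheory.Measure.univ_pi_Ioo_ae_eq_Icc

theorem tail_mem_openCube {k : ℕ} {x : Fin (k + 1) → ℝ} (hx : x ∈ openCube (k + 1)) :
    Fin.tail x ∈ openCube k := fun i _ => hx i.succ trivial

theorem injOn_cubeMap (k : ℕ) : Set.InjOn (cubeMap k) (openCube k) := by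
  induction k with
  | zero => intro x _ y _ _; exact Subsingleton.elim _ _
  | succ k ih =>
    intro x hx y hy hxy
    rw [cubeMap_succ, cubeMap_succ, Fin.cons_inj] at hxy
    have h0 : x 0 = y 0 := by linarith [hxy.1]
    have hne : y 0 ≠ 0 := (hy 0 trivial).1.ne'
    have ht : Fin.tail x = Fin.tail y := by
      refine ih (tail_mem_openCube hx) (tail_mem_openCube hy) ?_
      have := hxy.2
      rw [h0] at this
      exact smul_right_injective _ hne this
    rw [← Fin.cons_self_tail x, ← Fin.cons_self_tail y, h0, ht]

theorem exists_cubeMap_eq {k : ℕ} {t : Fin (k + 1) → ℝ} (h : ∀ i, 0 < t i) (hs : ∑ i, t i = 1) :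
    ∃ a ∈ openCube k, cubeMap k a = t := by
  induction k with
  | zero =>
    refine ⟨0, fun i => i.elim0, ?_⟩
    ext i
    rw [Fin.fin_one_eq_zero i]
    simpa [cubeMap] using hs.symm
  | succ k ih =>
    rw [Fin.sum_univ_succ] at hs
    have hpos : 0 < ∑ i : Fin (k + 1), t i.succ :=
      Finset.sum_pos (fun i _ => h i.succ) Finset.univ_nonempty
    have h1 : 0 < 1 - t 0 := by linarith
    obtain ⟨a, ha, hat⟩ := ih (t := fun i => t i.succ / (1 - t 0))
      (fun i => div_pos (h _) h1) (by rw [← Finset.sum_div, div_eq_one_iff_eq h1.ne']; linarith)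
    refine ⟨Fin.cons (1 - t 0) a, ?_, ?_⟩
    · intro i _
      refine Fin.cases ?_ (fun i => ?_) i
      · simp only [Fin.cons_zero, Set.mem_Ioo]
        exact ⟨h1, by linarith [h 0]⟩
      · simpa using ha i trivial
    · rw [cubeMap_succ]
      ext i
      refine Fin.cases ?_ (fun i => ?_) i
      · simp
      · simp only [Fin.cons_zero, Fin.tail_cons, hat, Fin.cons_succ, Pi.smul_apply, smul_eq_mul]
        field_simp

/-- The face `x_i = 1` of the cube is mapped to the `i`-th face of the simplex. -/
theorem cubeMap_insertNth_one {k : ℕ} (i : Fin (k + 1)) (y : Fin k → ℝ) :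
    cubeMap (k + 1) (i.insertNth 1 y) =
      (i.castSucc.insertNth 0 (cubeMap k y) : Fin (k + 2) → ℝ) := by
  induction k with
  | zero =>
    rw [Fin.fin_one_eq_zero i]
    ext j
    fin_cases j <;> simp [cubeMap]
  | succ k ih =>
    refine Fin.cases ?_ (fun i => ?_) i
    · rw [cubeMap_succ, Fin.castSucc_zero, Fin.insertNth_zero, Fin.insertNth_zero]
      simp [Fin.tail_cons]
    · rw [← Fin.cons_self_tail y, Fin.insertNth_succ_cons, cubeMap_succ (k + 1),
        Fin.tail_cons, ih, cubeMap_succ k, Fin.castSucc_succ, Fin.insertNth_succ_cons,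
        Fin.tail_cons, Fin.cons_zero, Fin.cons_zero]
      congr 1
      ext j
      refine Fin.succAboveCases i.castSucc ?_ (fun j => ?_) j <;> simp

/-- The face on which the last coordinate vanishes is mapped to the last face of the simplex. -/
theorem cubeMap_insertNth_last_zero {k : ℕ} (y : Fin k → ℝ) :
    cubeMap (k + 1) ((Fin.last k).insertNth 0 y) =
      ((Fin.last (k + 1)).insertNth 0 (cubeMap k y) : Fin (k + 2) → ℝ) := by
  induction k with
  | zero =>
    ext j
    fin_cases j <;> simp [cubeMap]
  | succ k ih =>
    rw [← Fin.cons_self_tail y, ← Fin.succ_last, Fin.insertNth_succ_cons,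
      cubeMap_succ (k + 1), Fin.tail_cons, ih, cubeMap_succ k, ← Fin.succ_last (k + 1),
      Fin.insertNth_succ_cons, Fin.tail_cons, Fin.cons_zero, Fin.cons_zero]
    congr 1
    ext j
    refine Fin.succAboveCases (Fin.last (k + 1)) ?_ (fun j => ?_) j <;> simp

/-- On the face `x_i = 0` the collapse does not depend on the coordinates after the `i`-th. -/
theorem cubeMap_update_last {k : ℕ} (x : Fin (k + 1) → ℝ) (i : Fin (k + 1)) (hi : i ≠ Fin.last k)
    (hx : x i = 0) (s : ℝ) :
    cubeMap (k + 1) (Function.update x (Fin.last k) s) = cubeMap (k + 1) x := by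
  induction k with
  | zero => exact absurd (Fin.fin_one_eq_zero i) hi
  | succ k ih =>
    rw [cubeMap_succ (k + 1), cubeMap_succ (k + 1) x, Function.update_of_ne (Fin.last_pos).ne]
    refine Fin.cases (fun hi hx => ?_) (fun i hi hx => ?_) i hi hx
    · rw [hx, zero_smul, zero_smul]
    · have ht : Fin.tail (Function.update x (Fin.last (k + 1)) s) =
          Function.update (Fin.tail x) (Fin.last k) s := by
        rw [← Fin.succ_last, Fin.tail_update_succ]
      rw [ht, ih (Fin.tail x) i (fun h => hi (by rw [h, Fin.succ_last])) hx]

/-- The collapse in terms of the products `u_i = x_0 ⋯ x_i` and of the edges of the simplex. -/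
theorem cubeMap_eq_sum (k : ℕ) (x : Fin k → ℝ) :
    cubeMap k x = Pi.single 0 1 + ∑ i : Fin k, (∏ l, if l ≤ i then x l else 1) •
      (Pi.single i.succ (1 : ℝ) - Pi.single i.castSucc (1 : ℝ) : Fin (k + 1) → ℝ) := by
  induction k with
  | zero => ext j; rw [Fin.fin_one_eq_zero j]; simp [cubeMap]
  | succ k ih =>
    have hp : ∀ i : Fin k, (∏ l, if l ≤ i.succ then x l else 1) =
        x 0 * ∏ l, if l ≤ i then Fin.tail x l else 1 := fun i => by
      rw [Fin.prod_univ_succ, if_pos (Fin.zero_le _)]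
      simp [Fin.tail]
    have h0 : (∏ l, if l ≤ (0 : Fin (k + 1)) then x l else 1) = x 0 := by
      rw [Fin.prod_univ_succ, if_pos (Fin.zero_le _)]
      simp [Fin.succ_ne_zero]
    rw [cubeMap_succ, ih, Fin.sum_univ_succ, h0]
    simp only [hp]
    ext j
    refine Fin.cases ?_ (fun j => ?_) j
    · simp [Finset.sum_apply, Fin.succ_ne_zero, eq_comm (a := (0 : Fin (k + 2)))]
      ring
    · have h1 : (j.succ = 1) = (j = 0) := by rw [← Fin.succ_zero_eq_one, Fin.succ_inj]
      simp [Finset.sum_apply, Pi.single_apply, Fin.succ_ne_zero, Finset.mul_sum, mul_assoc, h1]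

end Cube

/-! ### Integration of forms over smooth singular simplices -/

section SimplexIntegral

variable {n k : ℕ} {M : Type*} [TopologicalSpace M] [ChartedSpace (EuclideanSpace ℝ (Fin n)) M]

/-- The standard frame of `ℝ^k`. -/
def stdFrame (k : ℕ) : Fin k → Fin k → ℝ := fun i => Pi.single i 1

/-- An extension of a smooth simplex to the ambient space of the barycentric coordinates. -/
def SmoothSimplex.extension (τ : SmoothSimplex n k M) : (Fin (k + 1) → ℝ) → M :=
  τ.exists_extension.choose_spec.choose

theorem SmoothSimplex.extension_apply (τ : SmoothSimplex n k M)
    (t : stdSimplex ℝ (Fin (k + 1))) : τ.extension t = τ.toFun t :=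
  τ.exists_extension.choose_spec.choose_spec.2.2.2 t

/-- The integral of a `k`-form over a smooth `k`-simplex, computed on the open cube. It does not
depend on the choice of the extension: the collapse maps the open cube into the simplex, so that
the composite is determined near every point of the open cube (see `simplexIntegral_eq`). -/
def simplexIntegral (β : DForm n k M) (τ : SmoothSimplex n k M) : ℝ :=
  ∫ a in openCube k, formPullback β (τ.extension ∘ cubeMap k) a (stdFrame k)

theorem simplexIntegral_eq (β : DForm n k M) (τ : SmoothSimplex n k M)
    {F : (Fin (k + 1) → ℝ) → M} (hF : ∀ t : stdSimplex ℝ (Fin (k + 1)), F t = τ.toFun t) :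
    simplexIntegral β τ = ∫ a in openCube k, formPullback β (F ∘ cubeMap k) a (stdFrame k) := by
  refine MeasureTheory.setIntegral_congr_fun (isOpen_openCube k).measurableSet fun a ha => ?_
  refine congrArg (fun η : (Fin k → ℝ) [⋀^Fin k]→L[ℝ] ℝ => η (stdFrame k))
    (formPullback_congr β ?_)
  filter_upwards [(isOpen_openCube k).mem_nhds ha] with b hb
  have hb := cubeMap_mem (openCube_subset k hb)
  exact (τ.extension_apply ⟨_, hb⟩).trans (hF ⟨_, hb⟩).symm

/-- The chain rule, for a base point `x` that is equal to `g a`, but not by definition. -/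
theorem mfderiv_comp_apply_of_eq {E' E'' : Type*} [NormedAddCommGroup E'] [NormedSpace ℝ E']
    [NormedAddCommGroup E''] [NormedSpace ℝ E''] {G : E' → M} {g : E'' → E'}
    {L : E'' →L[ℝ] E'} {a : E''} {x : E'} (hx : g a = x)
    (hG : MDifferentiableAt 𝓘(ℝ, E') (𝓡 n) G x) (hg : HasFDerivAt g L a) (v : E'') :
    (mfderiv 𝓘(ℝ, E'') (𝓡 n) (G ∘ g) a v : EuclideanSpace ℝ (Fin n)) =
      mfderiv 𝓘(ℝ, E') (𝓡 n) G x (L v) := by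
  subst hx
  rw [(hG.hasMFDerivAt.comp a hg.hasMFDerivAt).mfderiv]
  rfl

theorem formPullback_comp {E' E'' : Type*} [NormedAddCommGroup E'] [NormedSpace ℝ E']
    [NormedAddCommGroup E''] [NormedSpace ℝ E''] (β : DForm n k M) {G : E' → M} {g : E'' → E'}
    {L : E'' →L[ℝ] E'} {a : E''}
    (hG : MDifferentiableAt 𝓘(ℝ, E') (𝓡 n) G (g a)) (hg : HasFDerivAt g L a) (v : Fin k → E'') :
    formPullback β (G ∘ g) a v = formPullback β G (g a) (fun i => L (v i)) := by
  rw [formPullback_apply, formPullback_apply,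
    (hG.hasMFDerivAt.comp a hg.hasMFDerivAt).mfderiv]
  rfl

/-- The linear inclusion of `ℝ^k` as the `i`-th coordinate hyperplane. -/
def insertZero {k : ℕ} (i : Fin (k + 1)) : (Fin k → ℝ) →L[ℝ] (Fin (k + 1) → ℝ) :=
  ContinuousLinearMap.pi (i.insertNth (α := fun _ => (Fin k → ℝ) →L[ℝ] ℝ) 0
    fun l => ContinuousLinearMap.proj l)

theorem insertZero_single {k : ℕ} (i : Fin (k + 1)) (j : Fin k) :
    insertZero i (stdFrame k j) = stdFrame (k + 1) (i.succAbove j) := by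
  ext l
  refine Fin.succAboveCases i ?_ (fun l => ?_) l
  · simp [insertZero, stdFrame]
  · simp [insertZero, stdFrame, Pi.single_apply]

theorem hasFDerivAt_insertNth {k : ℕ} (i : Fin (k + 1)) (c : ℝ) (y : Fin k → ℝ) :
    HasFDerivAt (fun y : Fin k → ℝ => (i.insertNth c y : Fin (k + 1) → ℝ)) (insertZero i) y := by
  refine hasFDerivAt_pi.2 fun l => ?_
  refine Fin.succAboveCases i ?_ (fun l => ?_) l
  · simpa using hasFDerivAt_const c y
  · simpa using hasFDerivAt_apply l y

theorem stdSimplex_map_succAbove {k : ℕ} (i : Fin (k + 2)) (t : stdSimplex ℝ (Fin (k + 1))) :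
    (stdSimplex.map i.succAbove t : Fin (k + 2) → ℝ) =
      (i.insertNth 0 (t : Fin (k + 1) → ℝ) : Fin (k + 2) → ℝ) := by
  ext l
  rw [stdSimplex.map_coe, FunOnFinite.linearMap_apply_apply]
  refine Fin.succAboveCases i ?_ (fun l => ?_) l
  · rw [Fin.insertNth_apply_same, Finset.filter_eq_empty_iff.2 fun j _ => i.succAbove_ne j,
      Finset.sum_empty]
  · rw [Fin.insertNth_apply_succAbove, Finset.sum_filter]
    simp

/-- Stokes' theorem for a closed form: its integral over the boundary of a simplex vanishes. -/
theorem sum_simplexIntegral_face [IsManifold (𝓡 n) ∞ M] {β : DForm n k M}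
    (hβ : β.IsDifferentiable) (hd : β.d = 0) (τ : SmoothSimplex n (k + 1) M) :
    ∑ i : Fin (k + 2), (-1 : ℝ) ^ (i : ℕ) * simplexIntegral β (τ.face i) = 0 := by
  obtain ⟨U, F, hU, hsub, hF, hFτ⟩ := τ.exists_extension
  set D := cubeMap (k + 1) with hD
  set G := F ∘ D with hGdef
  have hDc : ContDiff ℝ ∞ D := contDiff_cubeMap (k + 1)
  have hU' : IsOpen (D ⁻¹' U) := hU.preimage hDc.continuous
  have hsub' : Set.Icc 0 1 ⊆ D ⁻¹' U := fun x hx => hsub (cubeMap_mem hx)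
  have hG : ContMDiffOn 𝓘(ℝ, Fin (k + 1) → ℝ) (𝓡 n) ∞ G (D ⁻¹' U) :=
    hF.comp hDc.contMDiff.contMDiffOn fun _ h => h
  have hηd : ∀ x ∈ D ⁻¹' U, DifferentiableAt ℝ (formPullback β G) x := fun x hx =>
    differentiableAt_formPullback hβ hU' hG hx
  -- the components of the vector field whose divergence is the exterior derivative
  let f : Fin (k + 1) → (Fin (k + 1) → ℝ) → ℝ := fun i x =>
    (-1) ^ (i : ℕ) * formPullback β G x (i.removeNth (stdFrame (k + 1)))
  have hfd : ∀ i, ∀ x ∈ D ⁻¹' U, DifferentiableAt ℝ (f i) x := fun i x hx =>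
    ((hηd x hx).continuousAlternatingMap_apply
      (g := fun j _ => i.removeNth (stdFrame (k + 1)) j) fun _ =>
        differentiableAt_const _).const_mul _
  have hdiv : ∀ x ∈ D ⁻¹' U, ∑ i, fderiv ℝ (f i) x (Pi.single i 1) = 0 := by
    intro x hx
    have h := extDeriv_apply (hηd x hx) (stdFrame (k + 1))
    rw [extDeriv_formPullback hβ hU' hG hx, formPullback_apply, hd] at h
    rw [show (0 : ℝ) = _ from h]
    refine Finset.sum_congr rfl fun i _ => ?_
    have : fderiv ℝ (f i) x = (-1 : ℝ) ^ (i : ℕ) •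
        fderiv ℝ (fun x => formPullback β G x (i.removeNth (stdFrame (k + 1)))) x :=
      fderiv_const_mul
        ((hηd x hx).continuousAlternatingMap_apply
      (g := fun j _ => i.removeNth (stdFrame (k + 1)) j) fun _ => differentiableAt_const _) _
    rw [this, _root_.smul_apply, smul_eq_mul, zsmul_eq_mul]
    push_cast
    rfl
  have hstokes := MeasureTheory.integral_divergence_of_hasFDerivAt_off_countable'
    (0 : Fin (k + 1) → ℝ) 1 zero_le_one f (fun i x => fderiv ℝ (f i) x) ∅ Set.countable_empty
    (fun i x hx => (hfd i x (hsub' hx)).continuousAt.continuousWithinAt)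
    (fun x hx i => (hfd i x (hsub' (openCube_subset _ hx.1))).hasFDerivAt)
    ((MeasureTheory.integrableOn_zero).congr_fun (fun x hx => (hdiv x (hsub' hx)).symm)
      measurableSet_Icc)
  rw [MeasureTheory.setIntegral_congr_fun measurableSet_Icc
    (fun x hx => hdiv x (hsub' hx) : Set.EqOn _ (fun _ => (0 : ℝ)) _),
    MeasureTheory.integral_zero] at hstokes
  have hins : ∀ (i : Fin (k + 1)) (c : ℝ), c ∈ Set.Icc (0 : ℝ) 1 → ∀ y ∈ openCube k,
      (i.insertNth c y : Fin (k + 1) → ℝ) ∈ D ⁻¹' U := by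
    intro i c hc y hy
    have hy := openCube_subset k hy
    refine hsub' ⟨fun l => ?_, fun l => ?_⟩
    · refine Fin.succAboveCases i ?_ (fun l => ?_) l
      · simpa using hc.1
      · simpa using hy.1 l
    · refine Fin.succAboveCases i ?_ (fun l => ?_) l
      · simpa using hc.2
      · simpa using hy.2 l
  have hpull : ∀ (i : Fin (k + 1)) (c : ℝ), c ∈ Set.Icc (0 : ℝ) 1 → ∀ y ∈ openCube k,
      formPullback β (fun y => G (i.insertNth c y)) y (stdFrame k) =
        formPullback β G (i.insertNth c y) (i.removeNth (stdFrame (k + 1))) := by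
    intro i c hc y hy
    rw [show (fun y : Fin k → ℝ => G (i.insertNth c y)) =
      G ∘ (fun y : Fin k → ℝ => (i.insertNth c y : Fin (k + 1) → ℝ)) from rfl,
      formPullback_comp β (mdifferentiableAt_of_contMDiffOn hU' hG (hins i c hc y hy))
        (hasFDerivAt_insertNth i c y)]
    refine congrArg _ (funext fun j => ?_)
    rw [insertZero_single]
    rfl
  -- the faces `x_i = 1`, and the last face `x_k = 0`, of the cube
  have hface : ∀ (i : Fin (k + 1)) (j : Fin (k + 2)) (c : ℝ), c ∈ Set.Icc (0 : ℝ) 1 →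
      (∀ y, D (i.insertNth c y) = (j.insertNth 0 (cubeMap k y) : Fin (k + 2) → ℝ)) →
      ∫ y in Set.Icc 0 1, f i (i.insertNth c y) =
        (-1) ^ (i : ℕ) * simplexIntegral β (τ.face j) := by
    intro i j c hc hDi
    rw [← MeasureTheory.setIntegral_congr_set (openCube_ae_eq k),
      simplexIntegral_eq β (τ.face j) (F := fun t => F (j.insertNth 0 t)),
      ← MeasureTheory.integral_const_mul]
    · refine MeasureTheory.setIntegral_congr_fun (isOpen_openCube k).measurableSet fun y hy => ?_
      have : (fun t : Fin (k + 1) → ℝ => F (j.insertNth 0 t)) ∘ cubeMap k =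
          fun y => G (i.insertNth c y) := funext fun y => congrArg F (hDi y).symm
      simp only [f, this, hpull i c hc y hy]
    · intro t
      rw [← stdSimplex_map_succAbove]
      exact hFτ _
  -- the other faces `x_i = 0` collapse, and the form vanishes on them
  have hdeg : ∀ i : Fin (k + 1), i ≠ Fin.last k →
      ∫ y in Set.Icc 0 1, f i (i.insertNth 0 y) = 0 := by
    intro i hi
    rw [← MeasureTheory.setIntegral_congr_set (openCube_ae_eq k)]
    refine MeasureTheory.setIntegral_eq_zero_of_forall_eq_zero fun y hy => ?_
    obtain ⟨j, hj⟩ := Fin.exists_succAbove_eq hi.symm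
    have hx := hins i 0 (by simp) y hy
    set x : Fin (k + 1) → ℝ := i.insertNth 0 y with hxdef
    have hGx := mdifferentiableAt_of_contMDiffOn hU' hG hx
    -- the pulled back map does not depend on the last coordinate
    have hline : HasFDerivAt (fun s : ℝ => Function.update x (Fin.last k) s)
        (ContinuousLinearMap.pi (Pi.single (Fin.last k) (ContinuousLinearMap.id ℝ ℝ)))
        (x (Fin.last k)) := hasFDerivAt_update x _
    have hxx : (fun s : ℝ => Function.update x (Fin.last k) s) (x (Fin.last k)) = x :=
      Function.update_eq_self _ _
    have hconst : G ∘ (fun s : ℝ => Function.update x (Fin.last k) s) = fun _ => G x :=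
      funext fun s => congrArg F (cubeMap_update_last x i hi (by simp [hxdef]) s)
    have hzero : mfderiv 𝓘(ℝ, Fin (k + 1) → ℝ) (𝓡 n) G x (stdFrame (k + 1) (Fin.last k)) = 0 := by
      have h := mfderiv_comp_apply_of_eq hxx hGx hline 1
      rw [hconst, mfderiv_const] at h
      have h1 : (ContinuousLinearMap.pi (Pi.single (Fin.last k) (ContinuousLinearMap.id ℝ ℝ)) :
          ℝ →L[ℝ] Fin (k + 1) → ℝ) 1 = stdFrame (k + 1) (Fin.last k) := by
        ext l
        by_cases hl : l = Fin.last k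
        · subst hl; simp [stdFrame]
        · simp [stdFrame, hl]
      rw [h1] at h
      exact h.symm
    have : formPullback β G x (i.removeNth (stdFrame (k + 1))) = 0 := by
      rw [formPullback_apply]
      refine (β (G x)).map_coord_zero j ?_
      rw [Fin.removeNth, hj]
      exact hzero
    simp only [f, this, mul_zero]
  rw [Fin.sum_univ_castSucc]
  have hdeg' := Finset.sum_eq_single (Fin.last k) (fun i _ hi => hdeg i hi) fun h => absurd
    (Finset.mem_univ _) h
  rw [Finset.sum_sub_distrib] at hstokes
  replace hstokes := hstokes.trans (congrArg (_ - ·) hdeg')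
  have h1 : ∀ i : Fin (k + 1), ∫ y in Set.Icc 0 1, f i (i.insertNth 1 y) =
      (-1) ^ (i : ℕ) * simplexIntegral β (τ.face i.castSucc) := fun i =>
    hface i i.castSucc 1 (by simp) (cubeMap_insertNth_one i)
  have h2 := hface (Fin.last k) (Fin.last (k + 1)) 0 (by simp) cubeMap_insertNth_last_zero
  have h3 : ∑ i : Fin (k + 1), (-1) ^ (i : ℕ) * simplexIntegral β (τ.face i.castSucc) -
      (-1) ^ (Fin.last k : ℕ) * simplexIntegral β (τ.face (Fin.last (k + 1))) = 0 := by
    rw [← h2, ← Finset.sum_congr rfl fun i _ => h1 i]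
    exact hstokes.symm
  rw [← h3]
  simp [pow_succ]
  ring

end SimplexIntegral

/-! ### Forms of top degree, and their products with functions -/

section Top

variable {q : ℕ} {S : Type*} [TopologicalSpace S] [ChartedSpace (EuclideanSpace ℝ (Fin q)) S]

/-- The product of a form with a function. -/
def mulForm (f : S → ℝ) (η : DForm q q S) : DForm q q S := fun x => f x • η x

theorem d_eq_zero_of_top (η : DForm q q S) : η.d = 0 := by
  funext x
  ext v
  refine (η.d x).toAlternatingMap.map_linearDependent v fun hv => ?_
  have h1 := hv.fintype_card_le_finrank
  have h2 : finrank ℝ (TangentSpace (𝓡 q) x) = q := finrank_euclideanSpace_fin (𝕜 := ℝ) (n := q)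
  rw [h2] at h1
  simp at h1

theorem simplexIntegral_mulForm_eq_zero {f : S → ℝ} (η : DForm q q S)
    {σ : SmoothSimplex q q S} (h : ∀ x ∈ Set.range σ.toFun, f x = 0) :
    simplexIntegral (mulForm f η) σ = 0 := by
  refine MeasureTheory.setIntegral_eq_zero_of_forall_eq_zero fun a ha => ?_
  have ha' := cubeMap_mem (openCube_subset q ha)
  have hx : f ((σ.extension ∘ cubeMap q) a) = 0 := by
    refine h _ ⟨⟨_, ha'⟩, ?_⟩
    exact (σ.extension_apply ⟨_, ha'⟩).symm
  rw [formPullback_apply]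
  change f _ * _ = 0
  rw [hx, zero_mul]

theorem SmoothSimplex.isClosed_range [T2Space S] {k : ℕ} (σ : SmoothSimplex q k S) :
    IsClosed (Set.range σ.toFun) := by
  obtain ⟨U, F, hU, hsub, hF, hFσ⟩ := σ.exists_extension
  have : Continuous σ.toFun := by
    have h : σ.toFun = fun t : stdSimplex ℝ (Fin (k + 1)) => F t := funext fun t => (hFσ t).symm
    rw [h]
    exact continuousOn_iff_continuous_domRestrict.1 (hF.continuousOn.mono hsub)
  exact (isCompact_range this).isClosed

end Top

/-! ### Pairing of forms and chains -/

section Pairing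

variable {n k q : ℕ} {M : Type*} [TopologicalSpace M] [ChartedSpace (EuclideanSpace ℝ (Fin n)) M]
  {S : Type*} [TopologicalSpace S] [ChartedSpace (EuclideanSpace ℝ (Fin q)) S]

/-- The pullback of a form by a smooth map of manifolds. -/
def pullbackForm (ι : C^∞⟮𝓡 q, S; 𝓡 n, M⟯) (β : DForm n k M) : DForm q k S := fun x =>
  (β (ι x)).compContinuousLinearMap (mfderiv (𝓡 q) (𝓡 n) ι x)

theorem formPullback_pullbackForm {E' : Type*} [NormedAddCommGroup E'] [NormedSpace ℝ E']
    (ι : C^∞⟮𝓡 q, S; 𝓡 n, M⟯) (β : DForm n k M) {G : E' → S} {a : E'}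
    (hG : MDifferentiableAt 𝓘(ℝ, E') (𝓡 q) G a) :
    formPullback (pullbackForm ι β) G a = formPullback β (ι ∘ G) a := by
  ext v
  rw [formPullback_apply, formPullback_apply,
    mfderiv_comp a (ι.contMDiff.mdifferentiableAt (by simp)) hG]
  rfl

theorem isDifferentiable_pullbackForm [IsManifold (𝓡 n) ∞ M] [IsManifold (𝓡 q) ∞ S]
    (ι : C^∞⟮𝓡 q, S; 𝓡 n, M⟯) {β : DForm n k M} (hβ : β.IsDifferentiable) :
    (pullbackForm ι β).IsDifferentiable := by
  intro x₀
  set e := chartAt (EuclideanSpace ℝ (Fin q)) x₀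
  have he : ContMDiffOn (𝓡 q) (𝓡 q) ∞ e.symm e.target := contMDiffOn_chart_symm
  intro y hy
  refine DifferentiableAt.differentiableWithinAt ?_
  have h := differentiableAt_formPullback hβ e.open_target
    (ι.contMDiff.comp_contMDiffOn he) hy
  refine h.congr_of_eventuallyEq ?_
  filter_upwards [e.open_target.mem_nhds hy] with z hz
  exact formPullback_pullbackForm ι β (mdifferentiableAt_chart_symm x₀ hz)

theorem simplexIntegral_push (ι : C^∞⟮𝓡 q, S; 𝓡 n, M⟯) (β : DForm n k M)
    (τ : SmoothSimplex q k S) :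
    simplexIntegral β (τ.push ι) = simplexIntegral (pullbackForm ι β) τ := by
  obtain ⟨U, F, hU, hsub, hF, hFτ⟩ := τ.exists_extension
  rw [simplexIntegral_eq β (τ.push ι) (F := ι ∘ F) fun t => congrArg ι (hFτ t),
    simplexIntegral_eq _ τ hFτ]
  refine MeasureTheory.setIntegral_congr_fun (isOpen_openCube k).measurableSet fun a ha => ?_
  have hc := contDiff_cubeMap k
  have hm : MDifferentiableAt 𝓘(ℝ, Fin k → ℝ) (𝓡 q) (F ∘ cubeMap k) a :=
    mdifferentiableAt_of_contMDiffOn (hU.preimage hc.continuous)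
      (hF.comp hc.contMDiff.contMDiffOn fun _ h => h) (hsub (cubeMap_mem (openCube_subset k ha)))
  simp only [formPullback_pullbackForm ι β hm]
  rfl

variable (R : Type*) [CommRing R] [Algebra R ℝ]

/-- The integral of a form over a chain. -/
def chainIntegral (β : DForm n k M) : Chain R n k M →ₗ[R] ℝ :=
  Finsupp.linearCombination R (simplexIntegral β)

theorem chainIntegral_single (β : DForm n k M) (τ : SmoothSimplex n k M) (r : R) :
    chainIntegral R β (Finsupp.single τ r) = r • simplexIntegral β τ :=
  Finsupp.linearCombination_single ..

theorem chainIntegral_boundary [IsManifold (𝓡 n) ∞ M] {β : DForm n k M} (hβ : β.IsDifferentiable)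
    (hd : β.d = 0) (b : Chain R n (k + 1) M) : chainIntegral R β (boundary R b) = 0 := by
  suffices h : (chainIntegral R β).comp (boundary R) = 0 from LinearMap.congr_fun h b
  refine Finsupp.lhom_ext fun τ r => ?_
  simp only [LinearMap.comp_apply, boundary, Finsupp.linearCombination_single, map_smul, map_sum,
    chainIntegral_single, LinearMap.zero_apply]
  have : ∀ i : Fin (k + 2), ((-1 : R) ^ (i : ℕ)) • simplexIntegral β (τ.face i) =
      (-1 : ℝ) ^ (i : ℕ) * simplexIntegral β (τ.face i) := fun i => by
    rw [Algebra.smul_def]; simp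
  rw [Finset.sum_congr rfl fun i _ => this i, sum_simplexIntegral_face hβ hd, smul_zero]

theorem chainIntegral_pushChain (ι : C^∞⟮𝓡 q, S; 𝓡 n, M⟯) (β : DForm n k M) (c : Chain R q k S) :
    chainIntegral R β (pushChain R ι c) = chainIntegral R (pullbackForm ι β) c := by
  suffices h : (chainIntegral R β).comp (pushChain R ι) = chainIntegral R (pullbackForm ι β) from
    LinearMap.congr_fun h c
  refine Finsupp.lhom_ext fun τ r => ?_
  simp [pushChain, chainIntegral_single, simplexIntegral_push]

/-- The pullbacks of a closed form by homologous maps have the same integral over some fundamental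
cycle. -/
theorem Homologous.exists_chainIntegral_eq [IsManifold (𝓡 n) ∞ M] {R : Type*} [CommRing R]
    [Algebra R ℝ] {o : ManifoldOrientation q S} {ι ι' : C^∞⟮𝓡 q, S; 𝓡 n, M⟯}
    (h : Homologous R o ι ι') {β : DForm n q M} (hβ : β.IsDifferentiable) (hd : β.d = 0) :
    ∃ c : Chain R q q S, IsFundamentalCycle R o c ∧
      chainIntegral R (pullbackForm ι β) c = chainIntegral R (pullbackForm ι' β) c := by
  obtain ⟨c, hc, b, hb⟩ := h
  refine ⟨c, hc, ?_⟩
  rw [← chainIntegral_pushChain, ← chainIntegral_pushChain, ← sub_eq_zero, ← map_sub, hb,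
    chainIntegral_boundary R hβ hd]

end Pairing

/-! ### Densities and change of variables -/

section Density

variable {q : ℕ} {S : Type*} [TopologicalSpace S] [ChartedSpace (EuclideanSpace ℝ (Fin q)) S]

theorem isPositiveFrame_basis_iff {T : Type*} [AddCommGroup T] [Module ℝ T]
    (o : Orientation ℝ T (Fin q)) (b : Basis (Fin q) ℝ T) :
    IsPositiveFrame o b ↔ b.orientation = o := by
  constructor
  · rintro ⟨b', hb', h⟩
    rwa [← DFunLike.coe_injective hb']
  · exact fun h => ⟨b, rfl, h⟩

theorem exists_basis_matFrame {T : Type*} [AddCommGroup T] [Module ℝ T]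
    (b : Basis (Fin q) ℝ T) {A : Matrix (Fin q) (Fin q) ℝ} (hA : A.det ≠ 0) :
    ∃ b' : Basis (Fin q) ℝ T, ⇑b' = matFrame A b ∧ b.det b' = A.det := by
  have hdet : b.det (matFrame A b) = A.det := by rw [alternating_matFrame, b.det_self, mul_one]
  have h := (b.is_basis_iff_det (v := matFrame A b)).2 (by rw [hdet]; exact isUnit_iff_ne_zero.2 hA)
  refine ⟨Basis.mk h.1 h.2.ge, Basis.coe_mk .., ?_⟩
  rw [Basis.coe_mk, hdet]

theorem isPositiveFrame_matFrame_of_pos {T : Type*} [AddCommGroup T] [Module ℝ T]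
    {o : Orientation ℝ T (Fin q)} {u : Fin q → T} {A : Matrix (Fin q) (Fin q) ℝ} (hA : 0 < A.det)
    (hu : IsPositiveFrame o u) : IsPositiveFrame o (matFrame A u) := by
  obtain ⟨b, rfl, hb⟩ := hu
  obtain ⟨b', hb', hdet⟩ := exists_basis_matFrame b hA.ne'
  rw [← hb', isPositiveFrame_basis_iff, ← hb, eq_comm, b.orientation_eq_iff_det_pos, hdet]
  exact hA

theorem isPositiveFrame_matFrame_iff_of_neg {T : Type*} [AddCommGroup T] [Module ℝ T]
    (o : Orientation ℝ T (Fin q)) (b : Basis (Fin q) ℝ T) {A : Matrix (Fin q) (Fin q) ℝ}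
    (hA : A.det < 0) : IsPositiveFrame o (matFrame A b) ↔ ¬ IsPositiveFrame o b := by
  obtain ⟨b', hb', hdet⟩ := exists_basis_matFrame b hA.ne
  rw [← hb', isPositiveFrame_basis_iff, isPositiveFrame_basis_iff]
  have hne : b.orientation ≠ b'.orientation := by
    rw [Ne, b.orientation_eq_iff_det_pos, hdet]
    exact hA.le.not_gt
  constructor
  · rintro rfl h
    exact hne h
  · intro h
    rw [(b.orientation_ne_iff_eq_neg b'.orientation).1 hne.symm,
      (b.orientation_ne_iff_eq_neg o).1 (Ne.symm h)]

open Classical in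
/-- The density of the `q`-form `η` on an oriented `q`-manifold: it is equal to `η` on the positive
frames and to `-η` on the negative frames. -/
def orientedDensity (o : ManifoldOrientation q S) (η : DForm q q S) (x : S)
    (u : Fin q → TangentSpace (𝓡 q) x) : ℝ :=
  if IsPositiveFrame (o.orient x) u then η x u else -η x u

theorem orientedDensity_of_positive {o : ManifoldOrientation q S} (η : DForm q q S) {x : S}
    {u : Fin q → TangentSpace (𝓡 q) x} (hu : IsPositiveFrame (o.orient x) u) :
    orientedDensity o η x u = η x u := if_pos hu

/-- The function `δ` of frames is multiplied by `|det A|` under the change of frame `A`. -/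
def IsDensity (δ : ∀ x : S, (Fin q → TangentSpace (𝓡 q) x) → ℝ) : Prop :=
  ∀ x (A : Matrix (Fin q) (Fin q) ℝ) u, δ x (matFrame A u) = |A.det| * δ x u

theorem isDensity_orientedDensity (o : ManifoldOrientation q S) (η : DForm q q S) :
    IsDensity (orientedDensity o η) := by
  intro x A u
  by_cases hu : LinearIndependent ℝ u
  · have hfin : finrank ℝ (TangentSpace (𝓡 q) x) = q :=
      finrank_euclideanSpace_fin (𝕜 := ℝ) (n := q)
    let b : Basis (Fin q) ℝ (TangentSpace (𝓡 q) x) :=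
      basisOfLinearIndependentOfCardEqFinrank' u hu (by simp [hfin])
    have hb : ⇑b = u := coe_basisOfLinearIndependentOfCardEqFinrank' ..
    rw [orientedDensity, orientedDensity, form_matFrame]
    rcases lt_trichotomy A.det 0 with h | h | h
    · have := isPositiveFrame_matFrame_iff_of_neg (o.orient x) b h
      rw [hb] at this
      simp only [this, abs_of_neg h]
      split_ifs <;> simp_all
    · simp [h]
    · have : IsPositiveFrame (o.orient x) (matFrame A u) ↔ IsPositiveFrame (o.orient x) u := by
        refine ⟨fun h' => ?_, isPositiveFrame_matFrame_of_pos h⟩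
        have := isPositiveFrame_matFrame_of_pos (A := A⁻¹)
          (by rw [Matrix.det_nonsing_inv]; simpa using h) h'
        rwa [← matFrame_mul, Matrix.nonsing_inv_mul _ (isUnit_iff_ne_zero.2 h.ne'),
          matFrame_one] at this
      rw [abs_of_pos h]
      by_cases hp : IsPositiveFrame (o.orient x) u
      · rw [if_pos hp, if_pos (this.2 hp)]
      · rw [if_neg hp, if_neg fun h' => hp (this.1 h'), mul_neg]
  · have h0 : η x u = 0 := (η x).toAlternatingMap.map_linearDependent u hu
    simp [orientedDensity, form_matFrame, h0]

theorem IsDensity.mul {δ : ∀ x : S, (Fin q → TangentSpace (𝓡 q) x) → ℝ} (hδ : IsDensity δ)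
    (f : S → ℝ) : IsDensity fun x u => f x * δ x u := by
  intro x A u
  simp only [hδ x A u]
  ring

/-- The frame of the parametrization `G` at `a`. -/
def paramFrame (G : (Fin q → ℝ) → S) (a : Fin q → ℝ) : Fin q → TangentSpace (𝓡 q) (G a) :=
  fun i => mfderiv 𝓘(ℝ, Fin q → ℝ) (𝓡 q) G a (stdFrame q i)

/-- Equality of the values of a density at base points that are equal, but not by definition. -/
theorem density_congr (δ : ∀ x : S, (Fin q → TangentSpace (𝓡 q) x) → ℝ) {x y : S} (h : x = y)
    (u : Fin q → EuclideanSpace ℝ (Fin q)) :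
    (δ x : (Fin q → TangentSpace (𝓡 q) x) → ℝ) u =
      (δ y : (Fin q → TangentSpace (𝓡 q) y) → ℝ) u := by
  subst h; rfl

open MeasureTheory in
/-- Change of variables from a chart to an injective parametrization `G`, for a density that
vanishes away from the common range. -/
theorem setIntegral_chart_eq [IsManifold (𝓡 q) ∞ S]
    {δ : ∀ x : S, (Fin q → TangentSpace (𝓡 q) x) → ℝ} (hδ : IsDensity δ)
    (x₀ : S) {G : (Fin q → ℝ) → S} {A : Set (Fin q → ℝ)} (hA : IsOpen A)
    (hG : ContMDiffOn 𝓘(ℝ, Fin q → ℝ) (𝓡 q) ∞ G A) (hinj : Set.InjOn G A)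
    (hs : ∀ x u, x ∉ (chartAt (EuclideanSpace ℝ (Fin q)) x₀).source → δ x u = 0)
    (hsA : ∀ x u, x ∉ G '' A → δ x u = 0) :
    ((∫ y in (chartAt (EuclideanSpace ℝ (Fin q)) x₀).target,
      δ ((chartAt (EuclideanSpace ℝ (Fin q)) x₀).symm y) (chartFrame x₀ y)) =
        ∫ a in A, δ (G a) (paramFrame G a)) ∧
    (IntegrableOn (fun a => δ (G a) (paramFrame G a)) A →
      IntegrableOn (fun y => δ ((chartAt (EuclideanSpace ℝ (Fin q)) x₀).symm y) (chartFrame x₀ y))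
        (chartAt (EuclideanSpace ℝ (Fin q)) x₀).target) := by
  set e := chartAt (EuclideanSpace ℝ (Fin q)) x₀ with he
  let P : EuclideanSpace ℝ (Fin q) ≃L[ℝ] (Fin q → ℝ) := EuclideanSpace.equiv (Fin q) ℝ
  have hP : MeasurePreserving P.symm := PiLp.volume_preserving_toLp (Fin q)
  have hPe : MeasurableEmbedding P.symm := P.symm.toHomeomorph.measurableEmbedding
  let g₀ : EuclideanSpace ℝ (Fin q) → ℝ := fun y => δ (e.symm y) (chartFrame x₀ y)
  let g : (Fin q → ℝ) → ℝ := g₀ ∘ P.symm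
  let A' := A ∩ G ⁻¹' e.source
  have hA' : IsOpen A' := hG.continuousOn.isOpen_inter_preimage hA e.open_source
  let ψ : (Fin q → ℝ) → (Fin q → ℝ) := fun a => P (e (G a))
  have hmd : ∀ a ∈ A', MDifferentiableAt 𝓘(ℝ, Fin q → ℝ) (𝓡 q) G a := fun a ha =>
    mdifferentiableAt_of_contMDiffOn hA hG ha.1
  let ψ' : (Fin q → ℝ) → (Fin q → ℝ) →L[ℝ] (Fin q → ℝ) := fun a =>
    (P : EuclideanSpace ℝ (Fin q) →L[ℝ] (Fin q → ℝ)).comp (fderiv ℝ (e ∘ G) a)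
  have hψ' : ∀ a ∈ A', HasFDerivWithinAt ψ (ψ' a) A' a := fun a ha =>
    (P.hasFDerivAt.comp a
      (differentiableAt_chart_comp x₀ (hmd a ha) ha.2).hasFDerivAt).hasFDerivWithinAt
  have hψinj : Set.InjOn ψ A' := fun a ha b hb hab =>
    hinj ha.1 hb.1 (e.injOn ha.2 hb.2 (P.injective hab))
  have hpt : ∀ a ∈ A', |(ψ' a).det| • g (ψ a) = δ (G a) (paramFrame G a) := by
    intro a ha
    have hPP : P.symm (ψ a) = e (G a) := P.symm_apply_apply _
    have hfr : (paramFrame G a : Fin q → EuclideanSpace ℝ (Fin q)) =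
        matFrame (LinearMap.toMatrix' (ψ' a : (Fin q → ℝ) →ₗ[ℝ] (Fin q → ℝ))).transpose
          (chartFrame x₀ (e (G a))) := by
      ext1 i
      refine (mfderiv_eq_comp_chart x₀ (hmd a ha) ha.2 (stdFrame q i)).trans ?_
      have : fderiv ℝ (e ∘ G) a (stdFrame q i) = ∑ j,
          (LinearMap.toMatrix' (ψ' a : (Fin q → ℝ) →ₗ[ℝ] (Fin q → ℝ))).transpose i j •
            EuclideanSpace.single j (1 : ℝ) := by
        ext l
        simp [LinearMap.toMatrix'_apply, ψ', P, stdFrame, Pi.single_apply]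
      rw [this]
      exact (map_sum _ _ _).trans (Finset.sum_congr rfl fun j _ => map_smul _ _ _)
    have hg : g (ψ a) = δ (e.symm (e (G a))) (chartFrame x₀ (e (G a))) :=
      congrArg g₀ hPP
    rw [hg]
    refine Eq.trans ?_ ((density_congr δ (e.left_inv ha.2).symm (paramFrame G a)).trans
      (congrArg (δ (e.symm (e (G a)))) hfr)).symm
    rw [hδ, Matrix.det_transpose, LinearMap.det_toMatrix']
    rfl
  have himg : ψ '' A' ⊆ P.symm ⁻¹' e.target := by
    rintro _ ⟨a, ha, rfl⟩
    have h : P.symm (ψ a) = e (G a) := P.symm_apply_apply _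
    rw [Set.mem_preimage, h]
    exact e.map_source ha.2
  have hoff : ∀ z ∈ P.symm ⁻¹' e.target \ ψ '' A', g z = 0 := by
    rintro z ⟨hz, hz'⟩
    refine hsA _ _ ?_
    rintro ⟨a, ha, hGa⟩
    refine hz' ⟨a, ⟨ha, ?_⟩, ?_⟩
    · change G a ∈ e.source
      rw [hGa]; exact e.map_target hz
    · change P (e (G a)) = z
      rw [hGa, e.right_inv hz, P.apply_symm_apply]
  have hoff' : ∀ a ∈ A \ A', δ (G a) (paramFrame G a) = 0 := fun a ha =>
    hs _ _ fun h => ha.2 ⟨ha.1, h⟩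
  have hmt : MeasurableSet (P.symm ⁻¹' e.target) :=
    (e.open_target.preimage P.symm.continuous).measurableSet
  constructor
  · calc ∫ y in e.target, g₀ y = ∫ z in P.symm ⁻¹' e.target, g z :=
        (hP.setIntegral_preimage_emb hPe _ _).symm
      _ = ∫ z in ψ '' A', g z := (setIntegral_eq_of_subset_of_forall_sdiff_eq_zero hmt himg hoff)
      _ = ∫ a in A', |(ψ' a).det| • g (ψ a) :=
        integral_image_eq_integral_abs_det_fderiv_smul volume hA'.measurableSet hψ' hψinj g
      _ = ∫ a in A', δ (G a) (paramFrame G a) := setIntegral_congr_fun hA'.measurableSet hpt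
      _ = ∫ a in A, δ (G a) (paramFrame G a) :=
        (setIntegral_eq_of_subset_of_forall_sdiff_eq_zero hA.measurableSet
          Set.inter_subset_left hoff').symm
  · intro h
    have h1 : IntegrableOn g (ψ '' A') := by
      rw [integrableOn_image_iff_integrableOn_abs_det_fderiv_smul volume hA'.measurableSet hψ'
        hψinj]
      exact (h.mono_set Set.inter_subset_left).congr_fun (fun a ha => (hpt a ha).symm)
        hA'.measurableSet
    have h2 : IntegrableOn g (P.symm ⁻¹' e.target) :=
      h1.of_forall_sdiff_eq_zero hmt hoff
    exact (hP.integrableOn_comp_preimage hPe).1 h2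

end Density

/-! ### The cube parametrization preserves orientations -/

section CubeDerivative

variable {k : ℕ}

theorem hasDerivAt_prod_update (a : Fin k → ℝ) (i j : Fin k) :
    HasDerivAt (fun s => ∏ l, if l ≤ j then Function.update a i s l else 1)
      (if i ≤ j then ∏ l ∈ Finset.univ.erase i, (if l ≤ j then a l else 1) else 0) (a i) := by
  have h : (fun s => ∏ l, if l ≤ j then Function.update a i s l else 1) =
      fun s => (if i ≤ j then s else 1) *
        ∏ l ∈ Finset.univ.erase i, (if l ≤ j then a l else 1) := by
    funext s
    rw [← Finset.mul_prod_erase Finset.univ _ (Finset.mem_univ i), Function.update_self]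
    congr 1
    refine Finset.prod_congr rfl fun l hl => ?_
    rw [Function.update_of_ne (Finset.ne_of_mem_erase hl)]
  rw [h]
  split_ifs with hij
  · simpa using (hasDerivAt_id (a i)).mul_const _
  · exact hasDerivAt_const _ _

/-- In the frame `e_j - e_0` of the simplex, the derivative of the cube parametrization is a
product of two triangular matrices with positive diagonal. -/
theorem exists_fderiv_cubeMap {a : Fin k → ℝ} (ha : a ∈ openCube k) :
    ∃ B : Matrix (Fin k) (Fin k) ℝ, 0 < B.det ∧
      (fun i => fderiv ℝ (cubeMap k) a (stdFrame k i)) =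
        matFrame B fun j => (Pi.single j.succ 1 - Pi.single 0 1 : Fin (k + 1) → ℝ) := by
  let u : Fin k → (Fin k → ℝ) → ℝ := fun j x => ∏ l, if l ≤ j then x l else 1
  let c : Fin k → Fin (k + 1) → ℝ := fun j => Pi.single j.succ 1 - Pi.single j.castSucc 1
  let B₁ : Matrix (Fin k) (Fin k) ℝ := Matrix.of fun i j => fderiv ℝ (u j) a (stdFrame k i)
  let B₂ : Matrix (Fin k) (Fin k) ℝ := Matrix.of fun j l =>
    (if l = j then 1 else 0) - (if l.succ = j.castSucc then 1 else 0)
  have hu : ∀ j, Differentiable ℝ (u j) := fun j => by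
    have : ContDiff ℝ 1 (u j) := contDiff_prod fun l _ => by
      split_ifs
      · exact contDiff_apply ℝ ℝ l
      · exact contDiff_const
    exact this.differentiable one_ne_zero
  have hB₁ : ∀ i j, B₁ i j =
      if i ≤ j then ∏ l ∈ Finset.univ.erase i, (if l ≤ j then a l else 1) else 0 := by
    intro i j
    have h1 : HasFDerivAt (u j) (fderiv ℝ (u j) a) (Function.update a i (a i)) := by
      rw [Function.update_eq_self]
      exact (hu j a).hasFDerivAt
    exact (h1.comp_hasDerivAt (a i) (hasDerivAt_update a i (a i))).unique
      (hasDerivAt_prod_update a i j)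
  have hd₁ : 0 < B₁.det := by
    rw [Matrix.det_of_isUpperTriangular (fun i j hij => by
      have hij : j < i := hij
      rw [hB₁, if_neg hij.not_ge])]
    refine Finset.prod_pos fun i _ => ?_
    rw [hB₁, if_pos le_rfl]
    refine Finset.prod_pos fun l _ => ?_
    split_ifs
    · exact (ha l trivial).1
    · exact one_pos
  have hd₂ : B₂.det = 1 := by
    rw [Matrix.det_of_isLowerTriangular _ (fun i j hij => ?_)]
    · refine Finset.prod_eq_one fun i _ => ?_
      have : i.succ ≠ i.castSucc := (Fin.castSucc_lt_succ).ne'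
      simp [B₂, this]
    · have hij : i < j := hij
      have h2 : j.succ ≠ i.castSucc := by
        intro h
        have := congrArg Fin.val h
        simp at this
        omega
      simp [B₂, hij.ne', h2]
  refine ⟨B₁ * B₂, by rw [Matrix.det_mul, hd₂, mul_one]; exact hd₁, ?_⟩
  have hc : matFrame B₂ (fun j => (Pi.single j.succ 1 - Pi.single 0 1 : Fin (k + 1) → ℝ)) = c := by
    funext j
    have : ∀ m : Fin (k + 1), ∑ l : Fin k, (if l.succ = m then (1 : ℝ) else 0) •
        (Pi.single l.succ 1 - Pi.single 0 1 : Fin (k + 1) → ℝ) =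
        Pi.single m 1 - Pi.single 0 1 := by
      intro m
      refine Fin.cases ?_ (fun m => ?_) m
      · simp [Fin.succ_ne_zero]
      · simp [Fin.succ_inj]
    simp only [matFrame, B₂, Matrix.of_apply, sub_smul, Finset.sum_sub_distrib, this, c]
    simp
  rw [matFrame_mul, hc]
  funext i
  have hD : cubeMap k = fun x => Pi.single 0 1 + ∑ j, u j x • c j := funext (cubeMap_eq_sum k)
  have hfd : HasFDerivAt (cubeMap k)
      (∑ j, (fderiv ℝ (u j) a).smulRight (c j)) a := by
    rw [hD]
    refine HasFDerivAt.const_add _ (HasFDerivAt.fun_sum fun j _ => ?_)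
    exact (hu j a).hasFDerivAt.smul_const (c j)
  rw [hfd.fderiv, _root_.sum_apply]
  rfl

end CubeDerivative

/-! ### The integral over the manifold and the fundamental cycle -/

section FundamentalCycle

variable {q : ℕ} {S : Type*} [TopologicalSpace S] [ChartedSpace (EuclideanSpace ℝ (Fin q)) S]
  [IsManifold (𝓡 q) ∞ S]

/-- The map `G` is injective on the open cube, with positive frames, and it is smooth on the
neighbourhood `U` of the closed cube. On the boundary of the cube it may degenerate. -/
structure IsPositiveParam (o : ManifoldOrientation q S) (G : (Fin q → ℝ) → S)
    (U : Set (Fin q → ℝ)) : Prop where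
  isOpen : IsOpen U
  subset : Set.Icc 0 1 ⊆ U
  contMDiffOn : ContMDiffOn 𝓘(ℝ, Fin q → ℝ) (𝓡 q) ∞ G U
  injOn : Set.InjOn G (openCube q)
  positive : ∀ a ∈ openCube q, IsPositiveFrame (o.orient (G a)) (paramFrame G a)

/-- The image of a set with a nondegenerate frame of the parametrization at `a` is a neighbourhood
of the image of `a`, by the inverse function theorem. -/
theorem image_mem_nhds {G : (Fin q → ℝ) → S} {A : Set (Fin q → ℝ)} (hA : IsOpen A)
    (hG : ContMDiffOn 𝓘(ℝ, Fin q → ℝ) (𝓡 q) ∞ G A) {a : Fin q → ℝ} (ha : a ∈ A)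
    (hfr : LinearIndependent ℝ (paramFrame G a)) : G '' A ∈ 𝓝 (G a) := by
  set e := chartAt (EuclideanSpace ℝ (Fin q)) (G a) with he
  have hx : G a ∈ e.source := mem_chart_source _ _
  have hmd := mdifferentiableAt_of_contMDiffOn hA hG ha
  have hA' : IsOpen (A ∩ G ⁻¹' e.source) := hG.continuousOn.isOpen_inter_preimage hA e.open_source
  have hstrict := (contDiffAt_chart_comp hA hG ha (G a) hx).hasStrictFDerivAt (by simp)
  have hinj : Function.Injective (fderiv ℝ (e ∘ G) a).toLinearMap := by
    rw [injective_iff_map_eq_zero]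
    intro v hv
    have h0 : (mfderiv 𝓘(ℝ, Fin q → ℝ) (𝓡 q) G a v : EuclideanSpace ℝ (Fin q)) = 0 :=
      (mfderiv_eq_comp_chart (G a) hmd hx v).trans
        ((congrArg (mfderiv (𝓡 q) (𝓡 q) e.symm (e (G a))) hv).trans (map_zero _))
    have hv' : ∑ i, v i • stdFrame q i = v := by
      ext l; simp [stdFrame, Pi.single_apply]
    have h1 : ∑ i, v i • paramFrame G a i = 0 :=
      ((map_sum _ _ _).trans (Finset.sum_congr rfl fun i _ => map_smul _ _ _)).symm.trans
        ((congrArg (mfderiv 𝓘(ℝ, Fin q → ℝ) (𝓡 q) G a) hv').trans h0)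
    exact funext (Fintype.linearIndependent_iff.1 hfr v h1)
  have hsurj : Function.Surjective (fderiv ℝ (e ∘ G) a).toLinearMap :=
    (LinearMap.injective_iff_surjective_of_finrank_eq_finrank (by simp)).1 hinj
  have hmap := hstrict.map_nhds_eq_of_surj (LinearMap.range_eq_top.2 hsurj)
  have h1 : (e ∘ G) '' (A ∩ G ⁻¹' e.source) ∈ 𝓝 (e (G a)) := by
    rw [show 𝓝 (e (G a)) = _ from hmap.symm]
    exact Filter.image_mem_map (hA'.mem_nhds ⟨ha, hx⟩)
  filter_upwards [(e.continuousAt hx).preimage_mem_nhds h1, e.open_source.mem_nhds hx] with y hy hy'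
  obtain ⟨b, hb, hby⟩ := hy
  exact ⟨b, hb.1, e.injOn hb.2 hy' hby⟩

/-- A positive simplex around `x`, composed with the collapse of the cube, is a positive
parametrization of a neighbourhood of `x`. -/
theorem IsPositiveSimplexAround.exists_param {o : ManifoldOrientation q S}
    {τ : SmoothSimplex q q S} {x : S} (h : IsPositiveSimplexAround o τ x) :
    ∃ (G : (Fin q → ℝ) → S) (U : Set (Fin q → ℝ)), IsPositiveParam o G U ∧
      G '' openCube q ∈ 𝓝 x ∧ ∀ η : DForm q q S,
        simplexIntegral η τ = ∫ a in openCube q, η (G a) (paramFrame G a) := by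
  obtain ⟨hinj, ⟨t, ht, htx⟩, U, F, hU, hsub, hF, hFτ, hpos⟩ := h
  have hc := contDiff_cubeMap q
  have hU' : IsOpen (cubeMap q ⁻¹' U) := hU.preimage hc.continuous
  have hG : ContMDiffOn 𝓘(ℝ, Fin q → ℝ) (𝓡 q) ∞ (F ∘ cubeMap q) (cubeMap q ⁻¹' U) :=
    hF.comp hc.contMDiff.contMDiffOn fun _ h => h
  have hparam : IsPositiveParam o (F ∘ cubeMap q) (cubeMap q ⁻¹' U) := by
    refine ⟨hU', fun a ha => hsub (cubeMap_mem ha), hG, fun a ha b hb hab => ?_, fun a ha => ?_⟩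
    · have ha' := cubeMap_mem (openCube_subset q ha)
      have hb' := cubeMap_mem (openCube_subset q hb)
      have := hinj ((hFτ ⟨_, ha'⟩).symm.trans (Eq.trans hab (hFτ ⟨_, hb'⟩)))
      exact injOn_cubeMap q ha hb (congrArg Subtype.val this)
    · have ha' := cubeMap_mem (openCube_subset q ha)
      obtain ⟨B, hB, hBe⟩ := exists_fderiv_cubeMap ha
      have hfr : paramFrame (F ∘ cubeMap q) a = matFrame B fun i : Fin q =>
          mfderiv 𝓘(ℝ, Fin (q + 1) → ℝ) (𝓡 q) F (cubeMap q a)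
            (Pi.single i.succ (1 : ℝ) - Pi.single 0 (1 : ℝ) : Fin (q + 1) → ℝ) := by
        have h1 := map_matFrame
          (mfderiv 𝓘(ℝ, Fin (q + 1) → ℝ) (𝓡 q) F (cubeMap q a)).toLinearMap B
          fun j : Fin q => (Pi.single j.succ 1 - Pi.single 0 1 : Fin (q + 1) → ℝ)
        refine Eq.trans (funext fun i => ?_) h1
        exact (mfderiv_comp_apply_of_eq rfl (mdifferentiableAt_of_contMDiffOn hU hF (hsub ha'))
          (hc.differentiable (by simp) a).hasFDerivAt (stdFrame q i)).trans
            (congrArg (mfderiv 𝓘(ℝ, Fin (q + 1) → ℝ) (𝓡 q) F (cubeMap q a)) (congrFun hBe i))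
      rw [hfr]
      exact isPositiveFrame_matFrame_of_pos hB (hpos _ ha')
  refine ⟨F ∘ cubeMap q, _, hparam, ?_, fun η => simplexIntegral_eq η τ hFτ⟩
  obtain ⟨a, ha, hat⟩ := exists_cubeMap_eq ht t.2.2
  have hxa : (F ∘ cubeMap q) a = x := by
    rw [← htx, ← hFτ, Function.comp_apply, hat]
  rw [← hxa]
  obtain ⟨b, hb, -⟩ := hparam.positive a ha
  exact image_mem_nhds (isOpen_openCube q)
    (hG.mono ((openCube_subset q).trans hparam.subset)) ha (hb ▸ b.linearIndependent)

theorem isDifferentiable_mulForm (f : C^∞⟮𝓡 q, S; 𝓘(ℝ, ℝ), ℝ⟯) {η : DForm q q S}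
    (hη : η.IsDifferentiable) : (mulForm f η).IsDifferentiable := by
  intro x₀
  set e := chartAt (EuclideanSpace ℝ (Fin q)) x₀
  have he : ContMDiffOn (𝓡 q) (𝓡 q) ∞ e.symm e.target := contMDiffOn_chart_symm
  have hf : ContDiffOn ℝ ∞ (f ∘ e.symm) e.target :=
    contMDiffOn_iff_contDiffOn.1 (f.contMDiff.comp_contMDiffOn he)
  have h := (hf.differentiableOn (by simp)).smul (hη x₀)
  exact h

theorem continuousOn_form_paramFrame {η : DForm q q S} (hη : η.IsDifferentiable)
    {G : (Fin q → ℝ) → S} {U : Set (Fin q → ℝ)} (hU : IsOpen U)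
    (hG : ContMDiffOn 𝓘(ℝ, Fin q → ℝ) (𝓡 q) ∞ G U) :
    ContinuousOn (fun a => η (G a) (paramFrame G a)) U := fun _ ha =>
  (((differentiableAt_formPullback hη hU hG ha).continuousAlternatingMap_apply
    (g := fun i _ => stdFrame q i) fun _ => differentiableAt_const _).continuousAt
      ).continuousWithinAt

open MeasureTheory in
theorem integrableOn_openCube {g : (Fin q → ℝ) → ℝ} {U : Set (Fin q → ℝ)}
    (hsub : Set.Icc 0 1 ⊆ U) (hg : ContinuousOn g U) : IntegrableOn g (openCube q) :=
  ((hg.mono hsub).integrableOn_compact isCompact_Icc).mono_set (openCube_subset q)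

variable [T2Space S] [CompactSpace S]

/-- The charts whose function of the partition of unity does not vanish identically. -/
def chartSupport (S : Type*) [TopologicalSpace S] [ChartedSpace (EuclideanSpace ℝ (Fin q)) S]
    [IsManifold (𝓡 q) ∞ S] [T2Space S] [CompactSpace S] : Finset S :=
  ((chartPartition (q := q) S).locallyFinite.finite_nonempty_of_compact).toFinset

theorem chartPartition_eq_zero {x₀ : S} (h : x₀ ∉ chartSupport (q := q) S) (x : S) :
    chartPartition (q := q) S x₀ x = 0 := by
  by_contra hne
  exact h ((Set.Finite.mem_toFinset _).2 ⟨x, hne⟩)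

theorem sum_chartPartition (x : S) :
    ∑ x₀ ∈ chartSupport (q := q) S, chartPartition (q := q) S x₀ x = 1 := by
  rw [← (chartPartition (q := q) S).sum_eq_one (Set.mem_univ x), finsum_eq_sum_of_support_subset]
  intro x₀ hx₀
  by_contra h
  exact hx₀ (chartPartition_eq_zero h x)

theorem chartPartition_subordinate (x₀ : S) :
    tsupport (chartPartition (q := q) S x₀) ⊆ (chartAt (EuclideanSpace ℝ (Fin q)) x₀).source :=
  (SmoothPartitionOfUnity.exists_isSubordinate_chartAt_source (𝓡 q) S).choose_spec x₀

theorem chartPartition_eq_zero_of_notMem {x₀ x : S}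
    (h : x ∉ (chartAt (EuclideanSpace ℝ (Fin q)) x₀).source) :
    chartPartition (q := q) S x₀ x = 0 := by
  by_contra hne
  exact h (chartPartition_subordinate x₀ (subset_tsupport _ hne))

/-- The part of the integral of a density that lies in one chart. -/
def chartIntegrand (δ : ∀ x : S, (Fin q → TangentSpace (𝓡 q) x) → ℝ) (x₀ : S)
    (y : EuclideanSpace ℝ (Fin q)) : ℝ :=
  chartPartition (q := q) S x₀ ((chartAt (EuclideanSpace ℝ (Fin q)) x₀).symm y) *
      δ ((chartAt (EuclideanSpace ℝ (Fin q)) x₀).symm y) (chartFrame x₀ y)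

theorem integralDensity_eq_sum (δ : ∀ x : S, (Fin q → TangentSpace (𝓡 q) x) → ℝ) :
    integralDensity δ = ∑ x₀ ∈ chartSupport (q := q) S,
      ∫ y in (chartAt (EuclideanSpace ℝ (Fin q)) x₀).target, chartIntegrand δ x₀ y := by
  refine finsum_eq_sum_of_support_subset _ fun x₀ hx₀ => ?_
  by_contra h
  refine hx₀ ?_
  simp [chartPartition_eq_zero h]

open MeasureTheory in
/-- The integral of a form supported in the range of a positive parametrization. -/
theorem integralDensity_mul_eq {o : ManifoldOrientation q S} {G : (Fin q → ℝ) → S}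
    {U : Set (Fin q → ℝ)} (hG : IsPositiveParam o G U) {η : DForm q q S}
    (hη : η.IsDifferentiable) {f : S → ℝ} (hf : Continuous f)
    (hfG : ∀ x, x ∉ G '' openCube q → f x = 0) :
    (∀ x₀, IntegrableOn (chartIntegrand (fun x u => f x * orientedDensity o η x u) x₀)
      (chartAt (EuclideanSpace ℝ (Fin q)) x₀).target) ∧
    integralDensity (fun x u => f x * orientedDensity o η x u) =
      ∫ a in openCube q, f (G a) * η (G a) (paramFrame G a) := by
  have hGA := hG.contMDiffOn.mono ((openCube_subset q).trans hG.subset)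
  have hcont : ∀ x₀ : S, ContinuousOn (fun a => chartPartition (q := q) S x₀ (G a) *
      (f (G a) * η (G a) (paramFrame G a))) U := fun x₀ =>
    ((chartPartition (q := q) S x₀).contMDiff.continuous.comp_continuousOn
      hG.contMDiffOn.continuousOn).mul ((hf.comp_continuousOn hG.contMDiffOn.continuousOn).mul
        (continuousOn_form_paramFrame hη hG.isOpen hG.contMDiffOn))
  have hpos : ∀ x₀ : S, Set.EqOn (fun a => chartPartition (q := q) S x₀ (G a) *
      (f (G a) * orientedDensity o η (G a) (paramFrame G a)))
      (fun a => chartPartition (q := q) S x₀ (G a) *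
      (f (G a) * η (G a) (paramFrame G a))) (openCube q) := fun x₀ a ha => by
    simp only [orientedDensity_of_positive η (hG.positive a ha)]
  have key := fun x₀ : S => setIntegral_chart_eq
    (((isDensity_orientedDensity o η).mul f).mul (chartPartition (q := q) S x₀)) x₀
    (isOpen_openCube q) hGA hG.injOn
    (fun x u hx => by rw [chartPartition_eq_zero_of_notMem hx, zero_mul])
    (fun x u hx => by rw [hfG x hx, zero_mul, mul_zero])
  refine ⟨fun x₀ => (key x₀).2 ?_, ?_⟩
  · exact (integrableOn_openCube hG.subset (hcont x₀)).congr_fun (hpos x₀).symm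
      (isOpen_openCube q).measurableSet
  · rw [integralDensity_eq_sum]
    have h1 : ∀ x₀ : S, ∫ y in (chartAt (EuclideanSpace ℝ (Fin q)) x₀).target,
        chartIntegrand (fun x u => f x * orientedDensity o η x u) x₀ y =
        ∫ a in openCube q, chartPartition (q := q) S x₀ (G a) *
          (f (G a) * η (G a) (paramFrame G a)) := fun x₀ =>
      (key x₀).1.trans (setIntegral_congr_fun (isOpen_openCube q).measurableSet (hpos x₀))
    rw [Finset.sum_congr rfl fun x₀ _ => h1 x₀, ← integral_finsetSum _ fun x₀ _ =>
      integrableOn_openCube hG.subset (hcont x₀)]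
    simp only [← Finset.sum_mul, sum_chartPartition, one_mul]

variable {R : Type*} [CommRing R] [Algebra R ℝ]

open MeasureTheory in
/-- The integral of a form over the manifold is its integral over a fundamental cycle. By a
partition of unity this is a local statement; near `x` the cycle is, up to a boundary, a positive
simplex around `x`. The integrability in the charts is part of the conclusion, because it is
needed to compare integrals. -/
theorem IsFundamentalCycle.integralDensity_eq {o : ManifoldOrientation q S} {c : Chain R q q S}
    (hc : IsFundamentalCycle R o c) {η : DForm q q S} (hη : η.IsDifferentiable) :
    (∀ x₀, IntegrableOn (chartIntegrand (orientedDensity o η) x₀)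
      (chartAt (EuclideanSpace ℝ (Fin q)) x₀).target) ∧
    integralDensity (orientedDensity o η) = chainIntegral R η c := by
  choose τ hτ a b ha hcab using hc.2
  choose G U hG hGx hGτ using fun x => (hτ x).exists_param
  -- near `x` the cycle `c` is the simplex `τ x` up to a boundary
  let W : S → Set S := fun x => interior (G x '' openCube q) ∩
    (⋃ σ ∈ (a x).support, Set.range σ.toFun)ᶜ
  have hWo : ∀ x, IsOpen (W x) := fun x => by
    refine isOpen_interior.inter (IsClosed.isOpen_compl (self := ?_))
    exact (a x).support.finite_toSet.isClosed_biUnion fun σ _ => σ.isClosed_range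
  have hWx : ∀ x, x ∈ W x := fun x => by
    refine ⟨mem_interior_iff_mem_nhds.2 (hGx x), ?_⟩
    simp only [Set.mem_compl_iff, Set.mem_iUnion, not_exists]
    exact fun σ hσ => ha x σ hσ
  obtain ⟨f, hf⟩ := SmoothPartitionOfUnity.exists_isSubordinate (𝓡 q) isClosed_univ W hWo
    fun x _ => Set.mem_iUnion.2 ⟨x, hWx x⟩
  let T : Finset S := f.locallyFinite.finite_nonempty_of_compact.toFinset
  have hT : ∀ x, ∑ i ∈ T, f i x = 1 := by
    intro x
    rw [← f.sum_eq_one (Set.mem_univ x), finsum_eq_sum_of_support_subset]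
    intro i hi
    exact (Set.Finite.mem_toFinset _).2 ⟨x, hi⟩
  have hfW : ∀ i x, x ∉ W i → f i x = 0 := fun i x hx => by
    by_contra hne
    exact hx (hf i (subset_tsupport _ hne))
  have hloc := fun i => integralDensity_mul_eq (hG i) hη (f i).contMDiff.continuous
    fun x hx => hfW i x fun h => hx (interior_subset h.1)
  have hmul : ∀ x₀ y, chartIntegrand (orientedDensity o η) x₀ y =
      ∑ i ∈ T, chartIntegrand (fun x u => f i x * orientedDensity o η x u) x₀ y := by
    intro x₀ y
    simp only [chartIntegrand]
    rw [← Finset.mul_sum, ← Finset.sum_mul, hT, one_mul]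
  have hsimp : ∀ σ : SmoothSimplex q q S, simplexIntegral η σ =
      ∑ i ∈ T, simplexIntegral (mulForm (f i) η) σ := by
    intro σ
    obtain ⟨V, F, hV, hsub, hF, hFσ⟩ := σ.exists_extension
    have hcm := contDiff_cubeMap q
    have hFG : ContMDiffOn 𝓘(ℝ, Fin q → ℝ) (𝓡 q) ∞ (F ∘ cubeMap q) (cubeMap q ⁻¹' V) :=
      hF.comp hcm.contMDiff.contMDiffOn fun _ h => h
    have hV' : IsOpen (cubeMap q ⁻¹' V) := hV.preimage hcm.continuous
    have hsub' : Set.Icc 0 1 ⊆ cubeMap q ⁻¹' V := fun a ha => hsub (cubeMap_mem ha)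
    simp only [simplexIntegral_eq _ σ hFσ]
    have hint : ∀ i ∈ T, IntegrableOn
        (fun z => formPullback (mulForm (f i) η) (F ∘ cubeMap q) z (stdFrame q)) (openCube q) :=
      fun i _ => integrableOn_openCube hsub'
        (continuousOn_form_paramFrame (isDifferentiable_mulForm (f i) hη) hV' hFG)
    rw [← integral_finsetSum _ hint]
    refine setIntegral_congr_fun (isOpen_openCube q).measurableSet fun z _ => ?_
    change _ = ∑ i ∈ T, f i _ * η _ _
    rw [← Finset.sum_mul, hT, one_mul]
    rfl
  have hchain : chainIntegral R η c = ∑ i ∈ T, chainIntegral R (mulForm (f i) η) c := by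
    simp only [chainIntegral, Finsupp.linearCombination_apply, Finsupp.sum]
    rw [Finset.sum_comm]
    exact Finset.sum_congr rfl fun σ _ => by rw [hsimp σ, Finset.smul_sum]
  -- each piece is closed, so that the boundary in the decomposition of `c` near `i` is irrelevant
  have hpiece : ∀ i, chainIntegral R (mulForm (f i) η) c =
      integralDensity (fun x u => f i x * orientedDensity o η x u) := by
    intro i
    rw [hcab i, map_add, map_add, chainIntegral_boundary R (isDifferentiable_mulForm (f i) hη)
      (d_eq_zero_of_top _), chainIntegral_single, one_smul, add_zero, (hloc i).2, hGτ i]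
    have h0 : chainIntegral R (mulForm (f i) η) (a i) = 0 := by
      rw [chainIntegral, Finsupp.linearCombination_apply]
      refine Finset.sum_eq_zero fun σ hσ => ?_
      change (a i) σ • simplexIntegral (mulForm (f i) η) σ = 0
      rw [simplexIntegral_mulForm_eq_zero η fun x hx => hfW i x fun h => h.2 ?_, smul_zero]
      exact Set.mem_iUnion₂.2 ⟨σ, hσ, hx⟩
    rw [h0, add_zero]
    rfl
  refine ⟨fun x₀ => ?_, ?_⟩
  · simp only [show chartIntegrand (orientedDensity o η) x₀ = _ from funext (hmul x₀)]
    exact integrable_finsetSum _ fun i _ => (hloc i).1 x₀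
  · rw [hchain, Finset.sum_congr rfl fun i _ => hpiece i]
    simp only [integralDensity_eq_sum]
    rw [Finset.sum_comm]
    refine Finset.sum_congr rfl fun x₀ _ => ?_
    rw [← integral_finsetSum _ fun i _ => (hloc i).1 x₀]
    exact congrArg _ (funext (hmul x₀))

end FundamentalCycle

/-! ### Smoothness of the horizontal projection -/

/-- The orthogonal projection in terms of a basis that need not be orthonormal. -/
theorem starProjection_span_eq {T : Type*} [NormedAddCommGroup T] [InnerProductSpace ℝ T] {q : ℕ}
    {X : Fin q → T} (hX : LinearIndependent ℝ X) {K : Submodule ℝ T} [K.HasOrthogonalProjection]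
    (hK : K = Submodule.span ℝ (Set.range X)) (v : T) :
    K.starProjection v = ∑ l, (∑ k, (Matrix.gram ℝ X)⁻¹ k l * inner ℝ (X k) v) • X l := by
  have hG : (Matrix.gram ℝ X)⁻¹ * Matrix.gram ℝ X = 1 :=
    Matrix.nonsing_inv_mul _ (isUnit_iff_ne_zero.2
      (Matrix.det_gram_ne_zero_iff_linearIndependent.2 hX))
  refine Submodule.eq_starProjection_of_mem_of_inner_eq_zero ?_ fun w hw => ?_
  · rw [hK]
    exact Submodule.sum_mem _ fun l _ =>
      Submodule.smul_mem _ _ (Submodule.subset_span (Set.mem_range_self l))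
  rw [hK] at hw
  induction hw using Submodule.span_induction with
  | zero => simp
  | add a b _ _ ha hb => rw [inner_add_right, ha, hb, add_zero]
  | smul c a _ ha => rw [inner_smul_right, ha, mul_zero]
  | mem a ha =>
    obtain ⟨m, rfl⟩ := ha
    rw [inner_sub_left, sum_inner, sub_eq_zero]
    simp only [real_inner_smul_left, Finset.sum_mul]
    rw [Finset.sum_comm]
    have : ∀ k, ∑ l, (Matrix.gram ℝ X)⁻¹ k l * inner ℝ (X k) v * inner ℝ (X l) (X m) =
        inner ℝ (X k) v * (1 : Matrix (Fin q) (Fin q) ℝ) k m := by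
      intro k
      rw [← hG, Matrix.mul_apply, Finset.mul_sum]
      refine Finset.sum_congr rfl fun l _ => ?_
      rw [Matrix.gram_apply]
      ring
    simp only [this, Matrix.one_apply]
    simp [real_inner_comm]

section Matrix

variable {E' : Type*} [NormedAddCommGroup E'] [NormedSpace ℝ E'] {q : ℕ}
  {A : E' → Matrix (Fin q) (Fin q) ℝ} {a : E'}

theorem contDiffAt_det (hA : ∀ i j, ContDiffAt ℝ ∞ (fun y => A y i j) a) :
    ContDiffAt ℝ ∞ (fun y => (A y).det) a := by
  simp only [Matrix.det_apply']
  exact ContDiffAt.sum fun σ _ => contDiffAt_const.mul (contDiffAt_prod fun i _ => hA _ _)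

theorem contDiffAt_inv_apply (hA : ∀ i j, ContDiffAt ℝ ∞ (fun y => A y i j) a)
    (h : (A a).det ≠ 0) (i j : Fin q) : ContDiffAt ℝ ∞ (fun y => (A y)⁻¹ i j) a := by
  simp only [Matrix.inv_def, Matrix.smul_apply, Ring.inverse_eq_inv', smul_eq_mul,
    Matrix.adjugate_apply]
  refine ((contDiffAt_det hA).inv h).mul (contDiffAt_det fun k l => ?_)
  simp only [Matrix.updateRow_apply]
  split_ifs
  · exact contDiffAt_const
  · exact hA k l

end Matrix

section Projection

variable {n q : ℕ} {M : Type*} [TopologicalSpace M] [ChartedSpace (EuclideanSpace ℝ (Fin n)) M]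
  [IsManifold (𝓡 n) ∞ M]
  {E' : Type*} [NormedAddCommGroup E'] [NormedSpace ℝ E']

/-- The partial derivatives of a smooth map are smooth vector fields along it. -/
theorem contMDiffOn_mfderiv_apply {b : E' → M} {U : Set E'} (hU : IsOpen U)
    (hb : ContMDiffOn 𝓘(ℝ, E') (𝓡 n) ∞ b U) (v : E') :
    ContMDiffOn 𝓘(ℝ, E') (𝓡 n).tangent ∞
      (fun y => (⟨b y, mfderiv 𝓘(ℝ, E') (𝓡 n) b y v⟩ : TangentBundle (𝓡 n) M)) U := by
  have : IsManifold (𝓡 n) 1 M := IsManifold.of_le (n := ∞) (by simp)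
  have h1 := hb.contMDiffOn_tangentMapWithin (m := ∞) (by simp) hU.uniqueMDiffOn
  have h2 : ContMDiffOn 𝓘(ℝ, E') 𝓘(ℝ, E').tangent ∞
      (fun y => (⟨y, v⟩ : TangentBundle 𝓘(ℝ, E') E')) U :=
    contMDiffOn_vectorSpace_iff_contDiffOn.2 contDiffOn_const
  refine (h1.comp h2 fun y hy => hy).congr fun y hy => ?_
  simp only [Function.comp_apply, tangentMapWithin]
  rw [mfderivWithin_of_isOpen hU hy]

/-- The expression of a smooth vector field in a chart is smooth. -/
theorem contDiffOn_chart_vectorField (x₀ : M) {X : ∀ x : M, TangentSpace (𝓡 n) x} {U : Set M}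
    (hX : ContMDiffOn (𝓡 n) (𝓡 n).tangent ∞ (fun x => (⟨x, X x⟩ : TangentBundle (𝓡 n) M)) U) :
    ContDiffOn ℝ ∞ (fun y => (mfderiv (𝓡 n) (𝓡 n) (chartAt (EuclideanSpace ℝ (Fin n)) x₀)
        ((chartAt (EuclideanSpace ℝ (Fin n)) x₀).symm y)
        (X ((chartAt (EuclideanSpace ℝ (Fin n)) x₀).symm y)) : EuclideanSpace ℝ (Fin n)))
      ((chartAt (EuclideanSpace ℝ (Fin n)) x₀).target ∩
        (chartAt (EuclideanSpace ℝ (Fin n)) x₀).symm ⁻¹' U) := by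
  have : IsManifold (𝓡 n) 1 M := IsManifold.of_le (n := ∞) (by simp)
  set e := chartAt (EuclideanSpace ℝ (Fin n)) x₀
  have he : ContMDiffOn (𝓡 n) (𝓡 n) ∞ e.symm e.target := contMDiffOn_chart_symm
  have h1 := (contMDiffOn_chart (I := 𝓡 n) (n := ∞) (x := x₀)).contMDiffOn_tangentMapWithin
    (m := ∞) (by simp) e.open_source.uniqueMDiffOn
  have h2 := hX.comp (he.mono Set.inter_subset_left) (fun y hy => hy.2)
  have h3 := h1.comp h2 fun y hy => e.map_target hy.1
  have h4 := (contMDiff_snd_tangentBundle_modelSpace (EuclideanSpace ℝ (Fin n)) (𝓡 n)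
    (n := ∞)).comp_contMDiffOn h3
  refine (contMDiffOn_iff_contDiffOn.1 h4).congr fun y hy => ?_
  exact congrArg (fun L : EuclideanSpace ℝ (Fin n) →L[ℝ] EuclideanSpace ℝ (Fin n) =>
    L (X (e.symm y))) (mfderivWithin_of_isOpen e.open_source (e.map_target hy.1)).symm

variable [RiemannianBundle (fun x : M => TangentSpace (𝓡 n) x)]

/-- A smooth local frame of the distribution, with the resulting formula for the projection. -/
theorem SmoothDistribution.exists_frame_pH_eq (H : SmoothDistribution n q M) (x₀ : M) :
    ∃ U, IsOpen U ∧ x₀ ∈ U ∧ ∃ X : Fin q → ∀ x : M, TangentSpace (𝓡 n) x,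
      (∀ i, ContMDiffOn (𝓡 n) (𝓡 n).tangent ∞
        (fun x => (⟨x, X i x⟩ : TangentBundle (𝓡 n) M)) U) ∧
      ∀ x ∈ U, (Matrix.gram ℝ (X · x)).det ≠ 0 ∧ ∀ v, H.pH x v =
        ∑ l, (∑ k, (Matrix.gram ℝ (X · x))⁻¹ k l * inner ℝ (X k x) v) • X l x := by
  obtain ⟨U, hU, X, hX, hspan⟩ := H.exists_frame x₀
  obtain ⟨W, hWU, hW, hxW⟩ := mem_nhds_iff.1 hU
  refine ⟨W, hW, hxW, X, fun i => (hX i).mono hWU, fun x hx => ?_⟩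
  have hli : LinearIndependent ℝ (X · x) := by
    rw [linearIndependent_iff_card_eq_finrank_span, Set.finrank, ← hspan x (hWU hx),
      H.finrank_fiber, Fintype.card_fin]
  exact ⟨Matrix.det_gram_ne_zero_iff_linearIndependent.2 hli, fun v =>
    starProjection_span_eq hli (hspan x (hWU hx)) v⟩

variable [IsContMDiffRiemannianBundle (𝓡 n) ∞ (EuclideanSpace ℝ (Fin n))
        (fun x : M => TangentSpace (𝓡 n) x)]

theorem contDiffAt_inner {b : E' → M} {a : E'} {V W : ∀ y, TangentSpace (𝓡 n) (b y)}
    (hV : ContMDiffAt 𝓘(ℝ, E') (𝓡 n).tangent ∞ (fun y => (⟨b y, V y⟩ : TangentBundle (𝓡 n) M)) a)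
    (hW : ContMDiffAt 𝓘(ℝ, E') (𝓡 n).tangent ∞ (fun y => (⟨b y, W y⟩ : TangentBundle (𝓡 n) M)) a) :
    ContDiffAt ℝ ∞ (fun y => (inner ℝ (V y) (W y) : ℝ)) a :=
  contMDiffAt_iff_contDiffAt.1 (hV.inner_bundle hW)

/-- The coefficients, in a local frame `X`, of the horizontal part of a vector field `V` along a
map are smooth. -/
theorem contDiffAt_coeff {b : E' → M} {a : E'} {X : Fin q → ∀ x : M, TangentSpace (𝓡 n) x}
    (hX : ∀ i, ContMDiffAt 𝓘(ℝ, E') (𝓡 n).tangent ∞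
      (fun y => (⟨b y, X i (b y)⟩ : TangentBundle (𝓡 n) M)) a)
    (hdet : (Matrix.gram ℝ (X · (b a))).det ≠ 0) {V : ∀ y, TangentSpace (𝓡 n) (b y)}
    (hV : ContMDiffAt 𝓘(ℝ, E') (𝓡 n).tangent ∞ (fun y => (⟨b y, V y⟩ : TangentBundle (𝓡 n) M)) a)
    (l : Fin q) :
    ContDiffAt ℝ ∞ (fun y => ∑ k, (Matrix.gram ℝ (X · (b y)))⁻¹ k l *
      (inner ℝ (X k (b y)) (V y) : ℝ)) a :=
  ContDiffAt.sum fun k _ => (contDiffAt_inv_apply (A := fun y => Matrix.gram ℝ (X · (b y)))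
    (fun i j => contDiffAt_inner (hX i) (hX j)) hdet k l).mul (contDiffAt_inner (hX k) hV)

/-- The horizontal inner product of smooth vector fields along a map is smooth. -/
theorem SmoothDistribution.contDiffAt_inner_pH (H : SmoothDistribution n q M) {b : E' → M} {a : E'}
    {V W : ∀ y, TangentSpace (𝓡 n) (b y)}
    (hV : ContMDiffAt 𝓘(ℝ, E') (𝓡 n).tangent ∞ (fun y => (⟨b y, V y⟩ : TangentBundle (𝓡 n) M)) a)
    (hW : ContMDiffAt 𝓘(ℝ, E') (𝓡 n).tangent ∞ (fun y => (⟨b y, W y⟩ : TangentBundle (𝓡 n) M)) a) :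
    ContDiffAt ℝ ∞ (fun y => (inner ℝ (H.pH (b y) (V y)) (W y) : ℝ)) a := by
  obtain ⟨U, hU, ha, X, hX, hpH⟩ := H.exists_frame_pH_eq (b a)
  have hb : ContMDiffAt 𝓘(ℝ, E') (𝓡 n) ∞ b a := (contMDiffAt_totalSpace.1 hV).1
  have hX' : ∀ i, ContMDiffAt 𝓘(ℝ, E') (𝓡 n).tangent ∞
      (fun y => (⟨b y, X i (b y)⟩ : TangentBundle (𝓡 n) M)) a := fun i =>
    ((hX i).contMDiffAt (hU.mem_nhds ha)).comp a hb
  have h : ContDiffAt ℝ ∞ (fun y => ∑ l, (∑ k, (Matrix.gram ℝ (X · (b y)))⁻¹ k l *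
      (inner ℝ (X k (b y)) (V y) : ℝ)) * (inner ℝ (X l (b y)) (W y) : ℝ)) a :=
    ContDiffAt.sum fun l _ => (contDiffAt_coeff hX' (hpH _ ha).1 hV l).mul
      (contDiffAt_inner (hX' l) hW)
  refine h.congr_of_eventuallyEq ?_
  filter_upwards [hb.continuousAt.preimage_mem_nhds (hU.mem_nhds ha)] with y hy
  rw [(hpH _ hy).2, sum_inner]
  simp only [real_inner_smul_left]

/-- The expression in a chart of the horizontal part of a coordinate vector field. -/
theorem SmoothDistribution.exists_chart_pH (H : SmoothDistribution n q M) (x₀ : M)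
    {y₀ : EuclideanSpace ℝ (Fin n)} (hy₀ : y₀ ∈ (chartAt (EuclideanSpace ℝ (Fin n)) x₀).target)
    (v : EuclideanSpace ℝ (Fin n)) :
    ∃ P : EuclideanSpace ℝ (Fin n) → EuclideanSpace ℝ (Fin n), ContDiffAt ℝ ∞ P y₀ ∧
      ∀ᶠ y in 𝓝 y₀, H.pH ((chartAt (EuclideanSpace ℝ (Fin n)) x₀).symm y)
        (mfderiv (𝓡 n) (𝓡 n) (chartAt (EuclideanSpace ℝ (Fin n)) x₀).symm y v) =
          mfderiv (𝓡 n) (𝓡 n) (chartAt (EuclideanSpace ℝ (Fin n)) x₀).symm y (P y) := by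
  have : IsManifold (𝓡 n) 1 M := IsManifold.of_le (n := ∞) (by simp)
  set e := chartAt (EuclideanSpace ℝ (Fin n)) x₀ with he
  have hs : ContMDiffOn (𝓡 n) (𝓡 n) ∞ e.symm e.target := contMDiffOn_chart_symm
  obtain ⟨U, hU, ha, X, hX, hpH⟩ := H.exists_frame_pH_eq (e.symm y₀)
  have hb : ContMDiffAt (𝓡 n) (𝓡 n) ∞ e.symm y₀ := hs.contMDiffAt (e.open_target.mem_nhds hy₀)
  have hX' : ∀ i, ContMDiffAt (𝓡 n) (𝓡 n).tangent ∞
      (fun y => (⟨e.symm y, X i (e.symm y)⟩ : TangentBundle (𝓡 n) M)) y₀ := fun i =>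
    ((hX i).contMDiffAt (hU.mem_nhds ha)).comp y₀ hb
  have hV := (contMDiffOn_mfderiv_apply e.open_target hs v).contMDiffAt (e.open_target.mem_nhds hy₀)
  have hWU : e.target ∩ e.symm ⁻¹' U ∈ 𝓝 y₀ := Filter.inter_mem (e.open_target.mem_nhds hy₀)
    (hb.continuousAt.preimage_mem_nhds (hU.mem_nhds ha))
  refine ⟨fun y => ∑ l, (∑ k, (Matrix.gram ℝ (X · (e.symm y)))⁻¹ k l *
      (inner ℝ (X k (e.symm y)) (mfderiv (𝓡 n) (𝓡 n) e.symm y v) : ℝ)) •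
      (mfderiv (𝓡 n) (𝓡 n) e (e.symm y) (X l (e.symm y)) : EuclideanSpace ℝ (Fin n)), ?_, ?_⟩
  · exact ContDiffAt.sum fun l _ => (contDiffAt_coeff hX' (hpH _ ha).1 hV l).smul
      ((contDiffOn_chart_vectorField x₀ (hX l)).contDiffAt hWU)
  · filter_upwards [hWU] with y hy
    have hinv : ∀ w : TangentSpace (𝓡 n) (e.symm y),
        mfderiv (𝓡 n) (𝓡 n) e.symm y (mfderiv (𝓡 n) (𝓡 n) e (e.symm y) w) = w := by
      intro w
      have h1 := (mdifferentiable_chart (I := 𝓡 n) x₀).symm_comp_deriv (e.map_target hy.1)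
      have h2 : ∀ z, e (e.symm y) = z → (mfderiv (𝓡 n) (𝓡 n) e.symm z :
          EuclideanSpace ℝ (Fin n) →L[ℝ] EuclideanSpace ℝ (Fin n))
            (mfderiv (𝓡 n) (𝓡 n) e (e.symm y) w) = w := by
        rintro z rfl
        exact congrArg (fun L : EuclideanSpace ℝ (Fin n) →L[ℝ] EuclideanSpace ℝ (Fin n) => L w) h1
      exact h2 y (e.right_inv hy.1)
    rw [(hpH _ hy.2).2]
    erw [map_sum]
    refine Finset.sum_congr rfl fun l _ => ?_
    erw [map_smul, hinv]

/-- Differentiability of a family of forms can be tested on constant vectors. -/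
theorem differentiableAt_of_forall_apply {k : ℕ}
    {f : E' → EuclideanSpace ℝ (Fin n) [⋀^Fin k]→L[ℝ] ℝ} {a : E'}
    (h : ∀ v, DifferentiableAt ℝ (fun y => f y v) a) : DifferentiableAt ℝ f a := by
  let b := (EuclideanSpace.basisFun (Fin n) ℝ).toBasis
  let Φ : (EuclideanSpace ℝ (Fin n) [⋀^Fin k]→L[ℝ] ℝ) →ₗ[ℝ] (Fin k → Fin n) → ℝ :=
    { toFun := fun g s => g fun i => b (s i)
      map_add' := fun _ _ => rfl
      map_smul' := fun _ _ => rfl }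
  have hΦ : LinearMap.ker Φ = ⊥ := LinearMap.ker_eq_bot.2 fun g g' hg => by
    refine ContinuousAlternatingMap.toContinuousMultilinearMap_injective
      (ContinuousMultilinearMap.toMultilinearMap_injective ?_)
    exact Basis.ext_multilinear (fun _ => b) fun s => congrFun hg s
  obtain ⟨Ψ, hΨ⟩ := Φ.exists_leftInverse_of_injective hΦ
  have hf : f = fun y => Ψ.toContinuousLinearMap (Φ (f y)) :=
    funext fun y => (LinearMap.congr_fun hΨ (f y)).symm
  rw [hf]
  exact Ψ.toContinuousLinearMap.differentiableAt.comp a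
    (differentiableAt_pi.2 fun s => h fun i => b (s i))

/-- The components of a smooth form are differentiable, as the projections `p_H` and `p_V` depend
smoothly on the point. -/
theorem DForm.IsSmooth.isDifferentiable_component {α : DForm n q M} (hα : α.IsSmooth)
    (H : SmoothDistribution n q M) (p : ℕ) : (α.component H p).IsDifferentiable := by
  intro x₀ y₀ hy₀
  refine (differentiableAt_of_forall_apply fun u => ?_).differentiableWithinAt
  set e := chartAt (EuclideanSpace ℝ (Fin n)) x₀ with he
  choose P hP hPe using H.exists_chart_pH x₀ hy₀
  have hd : DifferentiableAt ℝ (α.inChart x₀) y₀ :=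
    ((hα x₀).contDiffAt (e.open_target.mem_nhds hy₀)).differentiableAt (by simp)
  have h : DifferentiableAt ℝ (fun y => ∑ s ∈ Finset.powersetCard p (Finset.univ : Finset (Fin q)),
      α.inChart x₀ y (fun j => if j ∈ s then u j - P (u j) y else P (u j) y)) y₀ := by
    refine DifferentiableAt.fun_sum fun s _ => hd.continuousAlternatingMap_apply fun j => ?_
    have hj := (hP (u j)).differentiableAt (by simp)
    split_ifs
    · exact (differentiableAt_const _).sub hj
    · exact hj
  refine h.congr_of_eventuallyEq ?_
  filter_upwards [Filter.eventually_all.2 fun j => hPe (u j)] with y hy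
  change (α.component H p (e.symm y)) (fun j => mfderiv (𝓡 n) (𝓡 n) e.symm y (u j)) = _
  rw [component_apply]
  refine Finset.sum_congr rfl fun s _ => ?_
  have hV : ∀ j, H.pV (e.symm y) (mfderiv (𝓡 n) (𝓡 n) e.symm y (u j)) =
      mfderiv (𝓡 n) (𝓡 n) e.symm y (u j - P (u j) y) := fun j =>
    ((eq_sub_of_add_eq' (pH_add_pV (H := H) _)).trans (congrArg _ (hy j))).trans
      ((mfderiv (𝓡 n) (𝓡 n) e.symm y).map_sub (u j) (P (u j) y)).symm
  have key : ∀ j, (if j ∈ s then H.pV (e.symm y) else H.pH (e.symm y))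
      (mfderiv (𝓡 n) (𝓡 n) e.symm y (u j)) =
      mfderiv (𝓡 n) (𝓡 n) e.symm y (if j ∈ s then u j - P (u j) y else P (u j) y) := by
    intro j
    by_cases hj : j ∈ s
    · rw [if_pos hj]
      exact (hV j).trans (congrArg (mfderiv (𝓡 n) (𝓡 n) e.symm y) (if_pos hj).symm)
    · rw [if_neg hj]
      exact (hy j).trans (congrArg (mfderiv (𝓡 n) (𝓡 n) e.symm y) (if_neg hj).symm)
  exact congrArg (α (e.symm y)) (funext key)

end Projection

/-! ### Frames of positive horizontally projectable immersions -/

section Frames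

variable {q : ℕ} {S : Type*} [TopologicalSpace S] [ChartedSpace (EuclideanSpace ℝ (Fin q)) S]

theorem exists_basis_chartFrame [IsManifold (𝓡 q) ∞ S] (x₀ : S) {y : EuclideanSpace ℝ (Fin q)}
    (hy : y ∈ (chartAt (EuclideanSpace ℝ (Fin q)) x₀).target) :
    ∃ b : Basis (Fin q) ℝ
      (TangentSpace (𝓡 q) ((chartAt (EuclideanSpace ℝ (Fin q)) x₀).symm y)),
      ⇑b = chartFrame x₀ y := by
  have : IsManifold (𝓡 q) 1 S := IsManifold.of_le (n := ∞) (by simp)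
  set e := chartAt (EuclideanSpace ℝ (Fin q)) x₀ with he
  let L := (mdifferentiable_chart (I := 𝓡 q) x₀).symm.mfderiv (x := y) hy
  refine ⟨(EuclideanSpace.basisFun (Fin q) ℝ).toBasis.map L.toLinearEquiv, funext fun i => ?_⟩
  have hi : (EuclideanSpace.basisFun (Fin q) ℝ).toBasis i = EuclideanSpace.single i (1 : ℝ) := by
    simp
  exact (Basis.map_apply ..).trans (congrArg L hi)

/-- A basis becomes positive after at most one change of sign of a vector. In dimension `0` there is
no vector, and the empty basis may be negative. -/
theorem exists_isPositiveFrame_matFrame {T : Type*} [AddCommGroup T] [Module ℝ T] (hq : 0 < q)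
    (o : Orientation ℝ T (Fin q)) (b : Basis (Fin q) ℝ T) : ∃ B : Matrix (Fin q) (Fin q) ℝ,
      IsPositiveFrame o (matFrame B b) ∧ (B = 1 ∨ B.det = -1) := by
  by_cases h : IsPositiveFrame o b
  · exact ⟨1, by rwa [matFrame_one], Or.inl rfl⟩
  · have hdet : (Matrix.diagonal (Function.update 1 ⟨0, hq⟩ (-1 : ℝ)) :
        Matrix (Fin q) (Fin q) ℝ).det = -1 := by
      rw [Matrix.det_diagonal, Finset.prod_update_of_mem (Finset.mem_univ _)]
      simp
    exact ⟨_, (isPositiveFrame_matFrame_iff_of_neg o b (by rw [hdet]; norm_num)).2 h,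
      Or.inr hdet⟩

theorem linearIndependent_of_matFrame {T : Type*} [NormedAddCommGroup T] [InnerProductSpace ℝ T]
    {B : Matrix (Fin q) (Fin q) ℝ} {v : Fin q → T} (h : LinearIndependent ℝ (matFrame B v)) :
    LinearIndependent ℝ v := by
  rw [← Matrix.det_gram_ne_zero_iff_linearIndependent, gram_matFrame, Matrix.det_mul,
    Matrix.det_mul] at h
  exact Matrix.det_gram_ne_zero_iff_linearIndependent.1 (right_ne_zero_of_mul
    (left_ne_zero_of_mul h))

variable {n : ℕ} {M : Type*} [TopologicalSpace M] [ChartedSpace (EuclideanSpace ℝ (Fin n)) M]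

theorem pushFrame_matFrame (ι : C^∞⟮𝓡 q, S; 𝓡 n, M⟯) {x : S} (B : Matrix (Fin q) (Fin q) ℝ)
    (u : Fin q → TangentSpace (𝓡 q) x) :
    pushFrame ι (matFrame B u) = matFrame B (pushFrame ι u) :=
  map_matFrame (mfderiv (𝓡 q) (𝓡 n) ι x).toLinearMap B u

variable [IsManifold (𝓡 n) ∞ M] [RiemannianBundle (fun x : M => TangentSpace (𝓡 n) x)]
  {H : SmoothDistribution n q M} {α : DForm n q M} {o : ManifoldOrientation q S}
  {ι : C^∞⟮𝓡 q, S; 𝓡 n, M⟯}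

theorem IsPositiveHPI.linearIndependent_pH (h : IsPositiveHPI α H o ι) {x : S}
    (b : Basis (Fin q) ℝ (TangentSpace (𝓡 q) x)) :
    LinearIndependent ℝ fun i => H.pH (ι x) (pushFrame ι b i) := by
  rcases Nat.eq_zero_or_pos q with rfl | hq
  · exact linearIndependent_empty_type
  obtain ⟨B, hB, -⟩ := exists_isPositiveFrame_matFrame hq (o.orient x) b
  have h1 := (h.2 x _ hB).1
  rw [pushFrame_matFrame] at h1
  have h2 := map_matFrame (H.pH (ι x)).toLinearMap B (pushFrame ι b)
  simp only [ContinuousLinearMap.coe_coe] at h2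
  rw [h2] at h1
  exact linearIndependent_of_matFrame h1

/-- A comparison of the density of a form with the density of the vertical energy has to be checked
on positive frames only. -/
theorem IsPositiveHPI.exists_positive (h : IsPositiveHPI α H o ι) (hcal : H.IsCalibratedBy α)
    (hq : 0 < q) (η : DForm q q S) {x : S} (b : Basis (Fin q) ℝ (TangentSpace (𝓡 q) x)) :
    ∃ u : Fin q → TangentSpace (𝓡 q) x, IsPositiveFrame (o.orient x) u ∧
      orientedDensity o η x b = η x u ∧
      H.ve (pushFrame ι b) * H.volH (pushFrame ι b) =
        H.ve (pushFrame ι u) * H.volH (pushFrame ι u) := by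
  obtain ⟨B, hB, hB1⟩ := exists_isPositiveFrame_matFrame hq (o.orient x) b
  have habs : |B.det| = 1 := by rcases hB1 with rfl | h <;> simp [*]
  refine ⟨_, hB, ?_, ?_⟩
  · rw [← orientedDensity_of_positive η hB, isDensity_orientedDensity o η x B b, habs, one_mul]
  · rw [pushFrame_matFrame]
    rcases hB1 with rfl | hB1
    · rw [matFrame_one]
    · exact (ve_mul_volH_matFrame hcal (h.linearIndependent_pH b) B hB1).symm

theorem IsPositiveHPI.orientedDensity_le (h : IsPositiveHPI α H o ι) (hα : IsSemiCalibration α)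
    (hcal : H.IsCalibratedBy α) (hq : 0 < q) {x : S} (b : Basis (Fin q) ℝ (TangentSpace (𝓡 q) x)) :
    orientedDensity o (pullbackForm ι (α.component H 2)) x b ≤
      H.ve (pushFrame ι b) * H.volH (pushFrame ι b) := by
  obtain ⟨u, hu, h1, h2⟩ := h.exists_positive hcal hq (pullbackForm ι (α.component H 2)) b
  rw [h1, h2]
  exact component_two_le_ve_mul_volH hα hcal (h.2 x u hu)

theorem IsFCalibrated.orientedDensity_eq (h : IsFCalibrated α H (α.component H 2) o ι)
    (hcal : H.IsCalibratedBy α) (hq : 0 < q) {x : S} (b : Basis (Fin q) ℝ (TangentSpace (𝓡 q) x)) :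
    orientedDensity o (pullbackForm ι (α.component H 2)) x b =
      H.ve (pushFrame ι b) * H.volH (pushFrame ι b) := by
  obtain ⟨u, hu, h1, h2⟩ := h.1.exists_positive hcal hq (pullbackForm ι (α.component H 2)) b
  rw [h1, h2, ← f_mul_vol (h.1.2 x u hu).1]
  exact h.2 x u hu

end Frames

/-! ### Integrability of the vertical energy -/

section Integrability

open MeasureTheory

variable {q : ℕ} {S : Type*} [TopologicalSpace S] [ChartedSpace (EuclideanSpace ℝ (Fin q)) S]
  [IsManifold (𝓡 q) ∞ S] [T2Space S] [CompactSpace S]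

/-- The functions of the partition of unity have compact support in their charts, so a density that
is continuous in the chart has an integrable product with them. -/
theorem integrableOn_chartIntegrand {δ : ∀ x : S, (Fin q → TangentSpace (𝓡 q) x) → ℝ} {x₀ : S}
    (hδ : ContinuousOn (fun y => δ ((chartAt (EuclideanSpace ℝ (Fin q)) x₀).symm y)
      (chartFrame x₀ y)) (chartAt (EuclideanSpace ℝ (Fin q)) x₀).target) :
    IntegrableOn (chartIntegrand δ x₀) (chartAt (EuclideanSpace ℝ (Fin q)) x₀).target := by
  set e := chartAt (EuclideanSpace ℝ (Fin q)) x₀ with he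
  let K := e '' tsupport (chartPartition (q := q) S x₀)
  have hsub := chartPartition_subordinate (q := q) x₀
  have hK : IsCompact K := (isClosed_tsupport _).isCompact.image_of_continuousOn
    (e.continuousOn.mono hsub)
  have hKt : K ⊆ e.target := by
    rintro _ ⟨x, hx, rfl⟩
    exact e.map_source (hsub hx)
  have hc : ContinuousOn (chartIntegrand δ x₀) e.target :=
    ((chartPartition (q := q) S x₀).contMDiff.continuous.comp_continuousOn
      e.continuousOn_symm).mul hδ
  refine IntegrableOn.of_forall_sdiff_eq_zero ((hc.mono hKt).integrableOn_compact hK)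
    e.open_target.measurableSet fun y hy => ?_
  have : chartPartition (q := q) S x₀ (e.symm y) = 0 := by
    by_contra hne
    exact hy.2 ⟨e.symm y, subset_tsupport _ hne, e.right_inv hy.1⟩
  rw [chartIntegrand, ← he, this, zero_mul]

variable {n : ℕ} {M : Type*} [TopologicalSpace M] [ChartedSpace (EuclideanSpace ℝ (Fin n)) M]
  [IsManifold (𝓡 n) ∞ M] [RiemannianBundle (fun x : M => TangentSpace (𝓡 n) x)]
  [IsContMDiffRiemannianBundle (𝓡 n) ∞ (EuclideanSpace ℝ (Fin n))
        (fun x : M => TangentSpace (𝓡 n) x)]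
  {H : SmoothDistribution n q M} {α : DForm n q M} {o : ManifoldOrientation q S}
  {ι : C^∞⟮𝓡 q, S; 𝓡 n, M⟯}

/-- The density of the vertical energy is integrable. Otherwise the energy would be the junk value
`0`, and the calibration inequality could not be integrated. -/
theorem IsPositiveHPI.integrableOn (h : IsPositiveHPI α H o ι) (x₀ : S) :
    IntegrableOn (chartIntegrand
      (fun x u => H.ve (pushFrame ι u) * H.volH (pushFrame ι u)) x₀)
      (chartAt (EuclideanSpace ℝ (Fin q)) x₀).target := by
  refine integrableOn_chartIntegrand fun y hy => ContinuousAt.continuousWithinAt ?_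
  set e := chartAt (EuclideanSpace ℝ (Fin q)) x₀ with he
  have hs : ContMDiffOn (𝓡 q) (𝓡 q) ∞ e.symm e.target := contMDiffOn_chart_symm
  have hb : ContMDiffOn (𝓡 q) (𝓡 n) ∞ (ι ∘ e.symm) e.target := ι.contMDiff.comp_contMDiffOn hs
  have hV : ∀ i, ContMDiffAt (𝓡 q) (𝓡 n).tangent ∞ (fun y =>
      (⟨ι (e.symm y), pushFrame ι (chartFrame x₀ y) i⟩ : TangentBundle (𝓡 n) M)) y := fun i => by
    refine ((contMDiffOn_mfderiv_apply e.open_target hb (EuclideanSpace.single i 1)).congr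
      fun z hz => ?_).contMDiffAt (e.open_target.mem_nhds hy)
    rw [mfderiv_comp z (ι.contMDiff.mdifferentiableAt (by simp))
      (mdifferentiableAt_chart_symm x₀ hz)]
    rfl
  have hG : ∀ i j, ContDiffAt ℝ ∞ (fun z => H.gramH (pushFrame ι (chartFrame x₀ z)) i j) y := by
    intro i j
    refine (H.contDiffAt_inner_pH (hV i) (hV j)).congr_of_eventuallyEq (.of_forall fun z => ?_)
    exact inner_pH_pH _ _
  have hP : ∀ i j, ContDiffAt ℝ ∞ (fun z =>
      (inner ℝ (H.pV (ι (e.symm z)) (pushFrame ι (chartFrame x₀ z) i))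
        (H.pV (ι (e.symm z)) (pushFrame ι (chartFrame x₀ z) j)) : ℝ)) y := by
    intro i j
    refine ((contDiffAt_inner (hV i) (hV j)).sub
      (H.contDiffAt_inner_pH (hV i) (hV j))).congr_of_eventuallyEq (.of_forall fun z => ?_)
    exact inner_pV_pV _ _
  have hdet : (H.gramH (pushFrame ι (chartFrame x₀ y))).det ≠ 0 := by
    obtain ⟨b, hb⟩ := exists_basis_chartFrame x₀ hy
    rw [← hb]
    exact Matrix.det_gram_ne_zero_iff_linearIndependent.2 (h.linearIndependent_pH b)
  refine ContinuousAt.mul ?_ (contDiffAt_det hG).continuousAt.sqrt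
  exact (contDiffAt_const.mul (ContDiffAt.sum fun i _ => ContDiffAt.sum fun j _ =>
    (contDiffAt_inv_apply hG hdet i j).mul (hP i j))).continuousAt

end Integrability

/-! ### Minimization of the vertical energy -/

section Minimization

open MeasureTheory

variable {n q : ℕ} {M : Type*} [TopologicalSpace M] [ChartedSpace (EuclideanSpace ℝ (Fin n)) M]
  [IsManifold (𝓡 n) ∞ M] [RiemannianBundle (fun x : M => TangentSpace (𝓡 n) x)]
  [IsContMDiffRiemannianBundle (𝓡 n) ∞ (EuclideanSpace ℝ (Fin n))
        (fun x : M => TangentSpace (𝓡 n) x)]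
  {S : Type*} [TopologicalSpace S] [ChartedSpace (EuclideanSpace ℝ (Fin q)) S]
  [IsManifold (𝓡 q) ∞ S] [T2Space S] [CompactSpace S]
  {H : SmoothDistribution n q M} {α : DForm n q M} {o : ManifoldOrientation q S}
  {ι : C^∞⟮𝓡 q, S; 𝓡 n, M⟯}

/-- The calibration argument: `VE(ι) = ∫ ι^*α₂ = ∫ ι'^*α₂ ≤ VE(ι')`. -/
theorem IsFCalibrated.minimizesInRestrictedClass (R : Type*) [CommRing R] [Algebra R ℝ]
    (hs : α.IsSmooth) (hα : IsSemiCalibration α) (hcal : H.IsCalibratedBy α)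
    (hd : (α.component H 2).d = 0) (hι : IsFCalibrated α H (α.component H 2) o ι) :
    MinimizesInRestrictedClass R o (IsPositiveHPI α H o) (verticalEnergy H) ι := by
  refine ⟨hι.1, fun ι' hι' hhom => ?_⟩
  rcases Nat.eq_zero_or_pos q with rfl | hq
  -- in dimension `0` the vertical energy is zero
  · simp [verticalEnergy, SmoothDistribution.ve, integralDensity]
  have hβ := hs.isDifferentiable_component H 2
  obtain ⟨c, hc, heq⟩ := hhom.exists_chainIntegral_eq hβ hd
  obtain ⟨-, h1⟩ := hc.integralDensity_eq (isDifferentiable_pullbackForm ι hβ)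
  obtain ⟨hint, h2⟩ := hc.integralDensity_eq (isDifferentiable_pullbackForm ι' hβ)
  have hmeas : ∀ x₀ : S, MeasurableSet (chartAt (EuclideanSpace ℝ (Fin q)) x₀).target :=
    fun x₀ => (chartAt (EuclideanSpace ℝ (Fin q)) x₀).open_target.measurableSet
  have h3 : verticalEnergy H ι =
      integralDensity (orientedDensity o (pullbackForm ι (α.component H 2))) := by
    rw [verticalEnergy, integralDensity_eq_sum, integralDensity_eq_sum]
    refine Finset.sum_congr rfl fun x₀ _ => setIntegral_congr_fun (hmeas x₀) fun y hy => ?_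
    obtain ⟨b, hb⟩ := exists_basis_chartFrame x₀ hy
    simp only [chartIntegrand]
    rw [← hb, hι.orientedDensity_eq hcal hq b]
  have h4 : integralDensity (orientedDensity o (pullbackForm ι' (α.component H 2))) ≤
      verticalEnergy H ι' := by
    rw [verticalEnergy, integralDensity_eq_sum, integralDensity_eq_sum]
    refine Finset.sum_le_sum fun x₀ _ => setIntegral_mono_on (hint x₀) (hι'.integrableOn x₀)
      (hmeas x₀) fun y hy => ?_
    obtain ⟨b, hb⟩ := exists_basis_chartFrame x₀ hy
    simp only [chartIntegrand]
    rw [← hb]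
    exact mul_le_mul_of_nonneg_left (hι'.orientedDensity_le hα hcal hq b)
      ((chartPartition (q := q) S).nonneg _ _)
  rw [h3, h1, heq, ← h2]
  exact h4

end Minimization

/-! ### The cross product of `ℝ⁷` -/

section Octonions

/-- The cross product of `ℝ⁷`, determined by `⟨u × v, w⟩ = φ₀(u, v, w)`. -/
def cross0 (u v : EuclideanSpace ℝ (Fin 7)) : EuclideanSpace ℝ (Fin 7) :=
  !₂[u 1 * v 2 - u 2 * v 1 + (u 3 * v 4 - u 4 * v 3) + (u 5 * v 6 - u 6 * v 5),
    u 2 * v 0 - u 0 * v 2 + (u 3 * v 5 - u 5 * v 3) - (u 4 * v 6 - u 6 * v 4),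
    u 0 * v 1 - u 1 * v 0 - (u 3 * v 6 - u 6 * v 3) - (u 4 * v 5 - u 5 * v 4),
    u 4 * v 0 - u 0 * v 4 + (u 5 * v 1 - u 1 * v 5) - (u 6 * v 2 - u 2 * v 6),
    u 0 * v 3 - u 3 * v 0 - (u 6 * v 1 - u 1 * v 6) - (u 5 * v 2 - u 2 * v 5),
    u 6 * v 0 - u 0 * v 6 + (u 1 * v 3 - u 3 * v 1) - (u 2 * v 4 - u 4 * v 2),
    u 0 * v 5 - u 5 * v 0 - (u 1 * v 4 - u 4 * v 1) - (u 2 * v 3 - u 3 * v 2)]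

theorem inner_eq_sum_seven (u v : EuclideanSpace ℝ (Fin 7)) : (inner ℝ u v : ℝ) =
    u 0 * v 0 + u 1 * v 1 + u 2 * v 2 + u 3 * v 3 + u 4 * v 4 + u 5 * v 5 + u 6 * v 6 := by
  simp [PiLp.inner_apply, Fin.sum_univ_succ]
  ring

theorem inner_cross0 (u v w : EuclideanSpace ℝ (Fin 7)) :
    (inner ℝ (cross0 u v) w : ℝ) = phi0 u v w := by
  simp [inner_eq_sum_seven, cross0, phi0, dx, Matrix.det_fin_three]
  ring

theorem phi0_rotate (u v w : EuclideanSpace ℝ (Fin 7)) : phi0 u v w = phi0 v w u := by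
  simp [phi0, dx, Matrix.det_fin_three]
  ring

theorem phi0_swap (u v w : EuclideanSpace ℝ (Fin 7)) : phi0 u v w = -phi0 v u w := by
  simp [phi0, dx, Matrix.det_fin_three]
  ring

/-- The inner product of two cross products. Modulo the inner products of the entries, it says that
`u × (v × c) = -(u × v) × c`. -/
theorem inner_cross0_cross0 (u v b c : EuclideanSpace ℝ (Fin 7)) :
    (inner ℝ (cross0 u b) (cross0 v c) : ℝ) = phi0 (cross0 u v) c b + inner ℝ u v * inner ℝ b c
      - 2 * (inner ℝ u c * inner ℝ v b) + inner ℝ v c * inner ℝ u b := by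
  rw [← inner_cross0]
  simp [inner_eq_sum_seven, cross0]
  ring

theorem norm_cross0_sq (u v : EuclideanSpace ℝ (Fin 7)) :
    ‖cross0 u v‖ ^ 2 = ‖u‖ ^ 2 * ‖v‖ ^ 2 - inner ℝ u v ^ 2 := by
  have h : phi0 (cross0 u u) v v = 0 := by
    have : cross0 u u = 0 := by
      ext i; fin_cases i <;> simp [cross0] <;> ring
    rw [this, ← inner_cross0]
    simp [inner_eq_sum_seven, cross0]
  rw [← real_inner_self_eq_norm_sq, inner_cross0_cross0, h, real_inner_self_eq_norm_sq,
    real_inner_self_eq_norm_sq]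
  ring

theorem cross0_eq_of_phi0_eq_one {a b c : EuclideanSpace ℝ (Fin 7)} (ha : ‖a‖ = 1) (hb : ‖b‖ = 1)
    (hc : ‖c‖ = 1) (hab : (inner ℝ a b : ℝ) = 0) (h : phi0 a b c = 1) : cross0 a b = c := by
  have hn : ‖cross0 a b‖ = 1 := by
    have := norm_cross0_sq a b
    rw [ha, hb, hab] at this
    nlinarith [norm_nonneg (cross0 a b)]
  exact (inner_eq_one_iff_of_norm_eq_one hn hc).1 ((inner_cross0 a b c).trans h)

/-- The vanishing of the Fueter operator is the equality case of the calibration inequality. The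
squared norm of `∑ a i × b i` is twice the difference of the two sides. -/
theorem phi0_eq_of_sum_cross0_eq_zero {a b : Fin 3 → EuclideanSpace ℝ (Fin 7)}
    (ha : Orthonormal ℝ a) (hab : ∀ i j, (inner ℝ (a i) (b j) : ℝ) = 0)
    (h1 : phi0 (a 0) (a 1) (a 2) = 1) (h : ∑ i, cross0 (a i) (b i) = 0) :
    phi0 (a 0) (b 1) (b 2) + phi0 (b 0) (a 1) (b 2) + phi0 (b 0) (b 1) (a 2) =
      (1 / 2) * ∑ i, ‖b i‖ ^ 2 := by
  have h01 : (inner ℝ (a 0) (a 1) : ℝ) = 0 := ha.2 (by decide)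
  have h12 : (inner ℝ (a 1) (a 2) : ℝ) = 0 := ha.2 (by decide)
  have h02 : (inner ℝ (a 0) (a 2) : ℝ) = 0 := ha.2 (by decide)
  have h20 : (inner ℝ (a 2) (a 0) : ℝ) = 0 := ha.2 (by decide)
  have c01 : cross0 (a 0) (a 1) = a 2 :=
    cross0_eq_of_phi0_eq_one (ha.1 0) (ha.1 1) (ha.1 2) h01 h1
  have c12 : cross0 (a 1) (a 2) = a 0 :=
    cross0_eq_of_phi0_eq_one (ha.1 1) (ha.1 2) (ha.1 0) h12 (by rw [← phi0_rotate, h1])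
  have c20 : cross0 (a 2) (a 0) = a 1 :=
    cross0_eq_of_phi0_eq_one (ha.1 2) (ha.1 0) (ha.1 1) h20
      (by rw [phi0_rotate, h1])
  have hn : ∀ i, (inner ℝ (cross0 (a i) (b i)) (cross0 (a i) (b i)) : ℝ) = ‖b i‖ ^ 2 := fun i => by
    rw [real_inner_self_eq_norm_sq, norm_cross0_sq, ha.1 i, hab]
    ring
  have e01 := inner_cross0_cross0 (a 0) (a 1) (b 0) (b 1)
  have e12 := inner_cross0_cross0 (a 1) (a 2) (b 1) (b 2)
  have e20 := inner_cross0_cross0 (a 2) (a 0) (b 2) (b 0)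
  simp only [c01, h01, hab] at e01
  simp only [c12, h12, hab] at e12
  simp only [c20, h20, hab] at e20
  have s01 : phi0 (a 2) (b 1) (b 0) = -phi0 (b 0) (b 1) (a 2) := by
    rw [phi0_swap, phi0_rotate, phi0_rotate]
  have s12 : phi0 (a 0) (b 2) (b 1) = -phi0 (a 0) (b 1) (b 2) := by
    rw [phi0_swap, phi0_rotate]
  have s20 : phi0 (a 1) (b 0) (b 2) = -phi0 (b 0) (a 1) (b 2) := phi0_swap ..
  have hz : (inner ℝ (∑ i, cross0 (a i) (b i)) (∑ i, cross0 (a i) (b i)) : ℝ) = 0 := by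
    rw [h, inner_zero_left]
  simp only [Fin.sum_univ_three, inner_add_left, inner_add_right, hn] at hz
  simp only [Fin.sum_univ_three]
  linarith [real_inner_comm (cross0 (a 0) (b 0)) (cross0 (a 1) (b 1)),
    real_inner_comm (cross0 (a 1) (b 1)) (cross0 (a 2) (b 2)),
    real_inner_comm (cross0 (a 2) (b 2)) (cross0 (a 0) (b 0))]

end Octonions

/-! ### Fueter immersions are `f`-calibrated -/

section Fueter

variable {M : Type*} [TopologicalSpace M] [ChartedSpace (EuclideanSpace ℝ (Fin 7)) M]
  {φ : DForm 7 3 M}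

theorem form_three_apply (x : M) (v : Fin 3 → TangentSpace (𝓡 7) x) :
    φ x v = φ x ![v 0, v 1, v 2] :=
  congrArg (φ x) (funext fun i => by fin_cases i <;> rfl)

variable [RiemannianBundle (fun x : M => TangentSpace (𝓡 7) x)]

theorem inner_cross (x : M) (u v w : TangentSpace (𝓡 7) x) :
    (inner ℝ (cross φ u v) w : ℝ) = φ x ![u, v, w] := by
  rw [cross, InnerProductSpace.toDual_symm_apply]
  change φ x (Function.update ![u, v, 0] 2 w) = _
  congr 1
  ext i : 1
  fin_cases i <;> rfl

theorem map_cross {x : M} {A : TangentSpace (𝓡 7) x ≃ₗᵢ[ℝ] EuclideanSpace ℝ (Fin 7)}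
    (hA : ∀ u v w : TangentSpace (𝓡 7) x, φ x ![u, v, w] = phi0 (A u) (A v) (A w))
    (u v : TangentSpace (𝓡 7) x) : A (cross φ u v) = cross0 (A u) (A v) := by
  refine ext_inner_right ℝ fun w => ?_
  obtain ⟨w, rfl⟩ := A.surjective w
  rw [A.inner_map_map, inner_cross, hA, inner_cross0]

theorem IsG2Structure.isSemiCalibration (hφ : IsG2Structure φ) : IsSemiCalibration φ := by
  intro x e he
  obtain ⟨A, hA⟩ := hφ.2 x
  rw [form_three_apply, hA, ← inner_cross0]
  refine (real_inner_le_norm _ _).trans ?_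
  have h := norm_cross0_sq (A (e 0)) (A (e 1))
  rw [A.norm_map, A.norm_map, A.inner_map_map, he.1, he.1, he.2 (by decide)] at h
  rw [A.norm_map, he.1]
  nlinarith [norm_nonneg (cross0 (A (e 0)) (A (e 1)))]

variable [IsManifold (𝓡 7) ∞ M] {H : SmoothDistribution 7 3 M}

theorem component_two_three (x : M) (w : Fin 3 → TangentSpace (𝓡 7) x) :
    φ.component H 2 x w = φ x ![H.pH x (w 0), H.pV x (w 1), H.pV x (w 2)] +
      φ x ![H.pV x (w 0), H.pH x (w 1), H.pV x (w 2)] +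
      φ x ![H.pV x (w 0), H.pV x (w 1), H.pH x (w 2)] := by
  have hp : Finset.powersetCard 2 (Finset.univ : Finset (Fin 3)) =
      {{1, 2}, {0, 2}, {0, 1}} := by decide
  rw [component_apply, hp, Finset.sum_insert (by decide), Finset.sum_insert (by decide),
    Finset.sum_singleton, ← add_assoc]
  exact congrArg₂ (· + ·) (congrArg₂ (· + ·) (form_three_apply x _) (form_three_apply x _))
    (form_three_apply x _)

/-- Equality in the calibration inequality on an adapted frame of a Fueter plane. -/
theorem component_two_eq_of_fueter (hφ : IsG2Structure φ) {x : M}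
    {w : Fin 3 → TangentSpace (𝓡 7) x} (hw : Orthonormal ℝ fun i => H.pH x (w i))
    (hφw : φ x (fun i => H.pH x (w i)) = 1) (hF : fueter φ H w = 0) :
    φ.component H 2 x w = (1 / 2) * ∑ i, ‖H.pV x (w i)‖ ^ 2 := by
  obtain ⟨A, hA⟩ := hφ.2 x
  have key := phi0_eq_of_sum_cross0_eq_zero (a := fun i => A (H.pH x (w i)))
    (b := fun i => A (H.pV x (w i))) (hw.comp_linearIsometryEquiv A)
    (fun i j => by rw [A.inner_map_map, inner_pH_pV])
    (by rw [← hA]; exact (form_three_apply x _).symm.trans hφw)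
    (by simp only [← map_cross hA, ← map_sum]; rw [show ∑ i, _ = _ from hF, map_zero])
  simp only [A.norm_map] at key
  rw [component_two_three, hA, hA, hA, key]

variable {S : Type*} [TopologicalSpace S] [ChartedSpace (EuclideanSpace ℝ (Fin 3)) S]
  {o : ManifoldOrientation 3 S} {ι : C^∞⟮𝓡 3, S; 𝓡 7, M⟯}

theorem IsFueterImmersion.isFCalibrated (hφ : IsG2Structure φ) (hcal : H.IsCalibratedBy φ)
    (h : IsFueterImmersion φ H o ι) : IsFCalibrated φ H (φ.component H 2) o ι := by
  refine ⟨h.1, fun x u hu => ?_⟩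
  obtain ⟨hli, hpos⟩ := h.1.2 x u hu
  obtain ⟨A, w, hA, hAw, hw, hφw, hdet⟩ := exists_adapted hcal hli
  have hA0 : 0 < A.det := hdet ▸ hpos
  have hunit : IsUnit A.det := isUnit_iff_ne_zero.2 hA
  have hwu : w = pushFrame ι (matFrame A⁻¹ u) := by
    rw [pushFrame_matFrame, hAw, ← matFrame_mul, Matrix.nonsing_inv_mul _ hunit, matFrame_one]
  have hpos' : IsPositiveFrame (o.orient x) (matFrame A⁻¹ u) :=
    isPositiveFrame_matFrame_of_pos (by rw [Matrix.det_nonsing_inv]; simpa using hA0) hu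
  have hF : fueter φ H w = 0 := by
    rw [hwu] at hw ⊢
    exact h.2 x _ hpos' hw
  rw [f_mul_vol hli, hAw, form_matFrame, volH_matFrame A hw, ve_matFrame A hA hw,
    abs_of_pos hA0, component_two_eq_of_fueter hφ hw hφw hF, mul_comm]

end Fueter

end VerticalEnergy

end

open VerticalEnergy
theorem mainTheorem3 (R : Type*) [CommRing R] [Algebra R ℝ] :
    -- the general case
    (∀ (n q : ℕ)
      (M : Type*) [TopologicalSpace M] [ChartedSpace (EuclideanSpace ℝ (Fin n)) M]
      [IsManifold (𝓡 n) ∞ M] [T2Space M] [SecondCountableTopology M]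
      [RiemannianBundle (fun x : M => TangentSpace (𝓡 n) x)]
      [IsContMDiffRiemannianBundle (𝓡 n) ∞ (EuclideanSpace ℝ (Fin n))
        (fun x : M => TangentSpace (𝓡 n) x)]
      (α : DForm n q M) (_ : α.IsSmooth) (_ : IsSemiCalibration α)
      (H : SmoothDistribution n q M) (_ : H.IsCalibratedBy α)
      (_ : (α.component H 2).d = 0)
      (S : Type*) [TopologicalSpace S] [ChartedSpace (EuclideanSpace ℝ (Fin q)) S]
      [IsManifold (𝓡 q) ∞ S] [T2Space S] [CompactSpace S]
      (o : ManifoldOrientation q S) (ι : C^∞⟮𝓡 q, S; 𝓡 n, M⟯),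
      IsFCalibrated α H (α.component H 2) o ι →
        MinimizesInRestrictedClass R o (IsPositiveHPI α H o) (verticalEnergy H) ι) ∧
    -- the case of G₂-structures
    (∀ (M : Type*) [TopologicalSpace M] [ChartedSpace (EuclideanSpace ℝ (Fin 7)) M]
      [IsManifold (𝓡 7) ∞ M] [T2Space M] [SecondCountableTopology M]
      [RiemannianBundle (fun x : M => TangentSpace (𝓡 7) x)]
      [IsContMDiffRiemannianBundle (𝓡 7) ∞ (EuclideanSpace ℝ (Fin 7))
        (fun x : M => TangentSpace (𝓡 7) x)]
      (φ : DForm 7 3 M) (_ : IsG2Structure φ)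
      (H : SmoothDistribution 7 3 M) (_ : H.IsCalibratedBy φ)
      (_ : (φ.component H 2).d = 0)
      (S : Type*) [TopologicalSpace S] [ChartedSpace (EuclideanSpace ℝ (Fin 3)) S]
      [IsManifold (𝓡 3) ∞ S] [T2Space S] [CompactSpace S]
      (o : ManifoldOrientation 3 S) (ι : C^∞⟮𝓡 3, S; 𝓡 7, M⟯),
      IsFueterImmersion φ H o ι →
        MinimizesInRestrictedClass R o (IsPositiveHPI φ H o) (verticalEnergy H) ι) := by
  refine ⟨?_, ?_⟩
  · intro n q M _ _ _ _ _ _ _ α hs hα H hcal hd S _ _ _ _ _ o ι hι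
    exact hι.minimizesInRestrictedClass R hs hα hcal hd
  · intro M _ _ _ _ _ _ _ φ hφ H hcal hd S _ _ _ _ _ o ι hι
    exact (hι.isFCalibrated hφ hcal).minimizesInRestrictedClass R hφ.1 hφ.isSemiCalibration hcal hd
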